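/- Conventions. A \emph{fan} in $\mathbb{R}^n$ (with lattice $\mathbb{Z}^n$) is a nonempty finite set of strongly convex rational polyhedral cones, closed under taking faces, any two of which meet in a common face. It is \emph{complete} if its cones cover $\mathbb{R}^n$, and \emph{non-singular} if each of its cones is generated by part of a $\mathbb{Z}$-basis of $\mathbb{Z}^n$. An $n$-dimensional \emph{toric manifold} is the toric variety $X_\Sigma$ over $\mathbb{C}$ (glued from the affine charts $\operatorname{Spec}\mathbb{C}[\sigma^\vee\cap\mathbb{Z}^n]$, $\sigma\in\Sigma$) of a complete non-singular fan $\Sigma$ in $\mathbb{R}^n$. Let $K$ be a simplicial complex on the vertex set $[m]=\{1,\dots,m\}$. A \emph{fan-giving characteristic map} over $K$ is a map $\lambda:[m]\to\mathbb{Z}^n$ sending each facet of $K$ to a basis of $\mathbb{Z}^n$, such that there is a complete non-singular fan $\Sigma$ whose rays are, bijectively, the half-lines $\mathbb{R}_{\ge 0}\lambda(v)$, $v\in[m]$, and in which a set of vertices spans a cone of $\Sigma$ if and only if it is a face of $K$; then $X_\Sigma$ is the toric manifold over $(K,\lambda)$ and is said to be \emph{supported by} $K$. Two such maps are \emph{D-J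 equivalent} if they differ by left multiplication by an element of $GL_n(\mathbb{Z})$. A toric manifold is \emph{projective} if it admits a closed embedding into some $\mathbb{P}^N_{\mathbb{C}}$ over $\mathbb{C}$. The complex $K$ is \emph{polytopal} (of dimension $n-1$) if it is the boundary complex of a simplicial $n$-polytope, \emph{neighborly} if every set of at most $\lfloor n/2\rfloor$ vertices is a face, and a \emph{seed} if it is not isomorphic to a wedge $$\operatorname{wed}_v(L)=\{\sigma\cup\tau \mid (\sigma\subseteq\{v,v'\},\ \tau\in\operatorname{lk}_L(v))\ \text{or}\ (\sigma\subsetneq\{v,v'\},\ v\notin\tau\in L)\}$$ of a simplicial complex $L$ at a vertex $v$ of $L$. A toric manifold is supported by a neighborly polytope if it is supported by its boundary complex. Let $\mathcal{K}^4_{27}$ and $\mathcal{K}^4_{28}$ be the simplicial complexes on $\{1,\dots,9\}$ with minimal non-faces, respectively (writing $abc$ for $\{a,b,c\}$), $$126, 146, 149, 168, 257, 259, 348, 349, 378, 678, 3579$$ and $$127, 128, 137, 256, 268, 348, 349, 468, 569, 579.$$ \textbf{Proposition.} There exist both projective and non-projective toric manifolds supported by neighborly $n$-polytopes with at least $n+3$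 vertices, for some $n\ge 4$. In particular the following conjecture of Gretenkort, Kleinschmidt and Sturmfels is false: for $n\ge4$, no neighborly $n$-polytope with $n+3$ or more vertices supports a toric manifold. More precisely, $\mathcal{K}^4_{27}$ and $\mathcal{K}^4_{28}$ are seeds and are boundary complexes of neighborly simplicial $5$-polytopes with $9$ vertices, and: \begin{enumerate} \item over $\mathcal{K}^4_{27}$ there are, up to D-J equivalence, exactly two fan-giving characteristic maps, and every toric manifold supported by $\mathcal{K}^4_{27}$ is projective; \item over $\mathcal{K}^4_{28}$ there are, up to D-J equivalence, exactly four fan-giving characteristic maps, and no toric manifold supported by $\mathcal{K}^4_{28}$ is projective. \end{enumerate} -/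

import Mathlib

/-! Neighborly polytopes, complete non-singular fans, and toric manifolds over the complex numbers.

Simplicial complexes are Mathlib's `AbstractSimplicialComplex`: the faces are nonempty finite sets,
and every element of the vertex type is a vertex. The lattice is `Fin n → ℤ`, its real span is
`Fin n → ℝ`, and cones are Mathlib's `PointedCone`. -/

namespace ToricNeighborly

open CategoryTheory AlgebraicGeometry

/-! ### Simplicial complexes -/

section Complexes

/-- The facets of a simplicial complex: its inclusion-maximal faces. -/
def IsFacet {V : Type} (K : AbstractSimplicialComplex V) (s : Finset V) : Prop :=
  s ∈ K.faces ∧ ∀ t ∈ K.faces, s ⊆ t → s = t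

/-- Two simplicial complexes are isomorphic. -/
def Isomorphic {V W : Type} (K : AbstractSimplicialComplex V)
    (L : AbstractSimplicialComplex W) : Prop :=
  ∃ e : V ≃ W, ∀ s : Finset V, s ∈ K.faces ↔ s.map e.toEmbedding ∈ L.faces

/-- The complex whose faces are the nonempty sets that contain no member of `M`. If no member of `M`
has fewer than two elements, every point is a vertex; if moreover `M` is an antichain, then `M` is
the set of minimal non-faces. -/
def complexOfNonfaces {V : Type} (M : Set (Finset V)) (hM : ∀ m ∈ M, 2 ≤ m.card) :
    AbstractSimplicialComplex V where
  faces := {s | s.Nonempty ∧ ∀ m ∈ M, ¬ m ⊆ s}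
  isRelLowerSet_faces := fun _ hs =>
    ⟨hs.1, fun _ hts ht => ⟨ht, fun m hm hmt => hs.2 m hm (hmt.trans hts)⟩⟩
  singleton_mem := fun v => ⟨Finset.singleton_nonempty v, fun m hm hmv => by
    have h1 := Finset.card_le_card hmv
    have h2 := hM m hm
    simp at h1
    omega⟩

/-- A complex on a vertex set is `k`-neighborly if it has the same `(k-1)`-skeleton as the full
simplex on that vertex set. A complex of dimension `n - 1` is neighborly if it is
`⌊n / 2⌋`-neighborly. -/
def IsNeighborly {V : Type} (n : ℕ) (K : AbstractSimplicialComplex V) : Prop :=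
  ∀ s : Finset V, s.Nonempty → s.card ≤ n / 2 → s ∈ K.faces

/-- `K` is the boundary complex of a simplicial `n`-polytope `P ⊆ ℝⁿ`: the vertices of `K` are placed
bijectively at the vertices of a full-dimensional polytope `P`, and a nonempty set of vertices is a
face of `K` if and only if its convex hull is a proper face of `P`. (As `K` is closed under subsets,
all proper faces of `P` are then simplices.) -/
def IsPolytopal {V : Type} (n : ℕ) (K : AbstractSimplicialComplex V) : Prop :=
  Finite V ∧ ∃ p : V → Fin n → ℝ,
    Function.Injective p ∧
    Set.range p = (convexHull ℝ (Set.range p)).extremePoints ℝ ∧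
    affineSpan ℝ (Set.range p) = ⊤ ∧
    ∀ s : Finset V, s.Nonempty →
      (s ∈ K.faces ↔
        IsExposed ℝ (convexHull ℝ (Set.range p)) (convexHull ℝ (p '' (s : Set V))) ∧
          convexHull ℝ (p '' (s : Set V)) ≠ convexHull ℝ (Set.range p))

/-- The faces (including the empty one) of a complex. -/
def IsFaceOrEmpty {V : Type} (K : AbstractSimplicialComplex V) (t : Finset V) : Prop :=
  t = ∅ ∨ t ∈ K.faces

open Classical in
/-- Membership (including the empty face) in the link of the vertex `v`. -/
def InLink {V : Type} (K : AbstractSimplicialComplex V) (v : V) (t : Finset V) : Prop :=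
  v ∉ t ∧ insert v t ∈ K.faces

open Classical in
/-- The faces of the wedge of `K` at `v`. The two vertices `v`, `v'` that replace `v` are `some v` and
`none`; `I` is the 1-simplex on them. The faces are the unions of a face `σ` of `I` with a member of
the link of `v`, and the unions of a face `σ` of the boundary of `I` with a face of `K` that avoids
`v`. -/
def IsWedgeFace {V : Type} (K : AbstractSimplicialComplex V) (v : V)
    (s : Finset (Option V)) : Prop :=
  ∃ (σ : Finset (Option V)) (t : Finset V),
    s = σ ∪ t.map Function.Embedding.some ∧ σ ⊆ {some v, none} ∧
      (InLink K v t ∨ (σ ≠ {some v, none} ∧ v ∉ t ∧ IsFaceOrEmpty K t))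

theorem IsWedgeFace.mono {V : Type} {K : AbstractSimplicialComplex V} {v : V}
    {s s' : Finset (Option V)} (h : IsWedgeFace K v s) (hs : s' ⊆ s) : IsWedgeFace K v s' := by
  classical
  obtain ⟨σ, t, rfl, hσ, h⟩ := h
  refine ⟨σ ∩ s', t.filter (fun w => some w ∈ s'), ?_, ?_, ?_⟩
  · ext x
    have := @hs x
    simp only [Finset.mem_union, Finset.mem_map, Finset.mem_inter, Finset.mem_filter,
      Function.Embedding.some_apply] at this ⊢
    constructor
    · intro hx
      rcases this hx with h | ⟨w, hw, rfl⟩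
      · exact Or.inl ⟨h, hx⟩
      · exact Or.inr ⟨w, ⟨hw, hx⟩, rfl⟩
    · rintro (⟨-, hx⟩ | ⟨w, ⟨-, hx⟩, rfl⟩) <;> exact hx
  · exact fun x hx => hσ (Finset.mem_of_mem_inter_left hx)
  · have hsub : t.filter (fun w => some w ∈ s') ⊆ t := Finset.filter_subset _ _
    rcases h with ⟨hv, ht⟩ | ⟨hne, hv, ht⟩
    · left
      refine ⟨fun hh => hv (hsub hh), ?_⟩
      refine (K.isRelLowerSet_faces ht).2 ?_ (Finset.insert_nonempty _ _)
      exact Finset.insert_subset_insert v hsub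
    · right
      refine ⟨fun h => hne ?_, fun hh => hv (hsub hh), ?_⟩
      · exact Finset.Subset.antisymm hσ (h ▸ Finset.inter_subset_left)
      · rcases Finset.eq_empty_or_nonempty (t.filter (fun w => some w ∈ s')) with h0 | h0
        · exact Or.inl h0
        · right
          rcases ht with rfl | ht
          · simp at h0
          · exact (K.isRelLowerSet_faces ht).2 hsub h0

/-- The wedge of `K` at the vertex `v`. -/
def wedge {V : Type} (K : AbstractSimplicialComplex V) (v : V) :
    AbstractSimplicialComplex (Option V) where
  faces := {s | s.Nonempty ∧ IsWedgeFace K v s}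
  isRelLowerSet_faces := fun _ hs => ⟨hs.1, fun _ hts ht => ⟨ht, hs.2.mono hts⟩⟩
  singleton_mem := fun x => by
    classical
    refine ⟨Finset.singleton_nonempty x, ?_⟩
    by_cases hx : x = some v ∨ x = none
    · refine ⟨{x}, ∅, by simp, by simpa using hx, Or.inl ⟨by simp, ?_⟩⟩
      have : (insert v ∅ : Finset V) = {v} := by ext; simp
      rw [this]
      exact K.singleton_mem v
    · push Not at hx
      obtain ⟨w, rfl⟩ := Option.ne_none_iff_exists'.mp hx.2
      refine ⟨∅, {w}, by simp, by simp, Or.inr ⟨?_, ?_, Or.inr (K.singleton_mem w)⟩⟩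
      · exact fun h => by simpa using congrArg (some v ∈ ·) h
      · simpa using fun h : v = w => hx.1 (by rw [h])

/-- `K` is a seed: it is not (isomorphic to) a wedge of a simplicial complex. The seeds among
spheres are defined by the same condition: a complex whose wedge is a PL sphere is a link of
that wedge, hence itself a PL sphere. -/
def IsSeed {V : Type} (K : AbstractSimplicialComplex V) : Prop :=
  ∀ (W : Type) (L : AbstractSimplicialComplex W) (w : W), ¬ Isomorphic K (wedge L w)

end Complexes

/-! ### Fans -/

section Fans

variable {n : ℕ}

/-- A lattice vector as a real vector. -/
def toReal (u : Fin n → ℤ) : Fin n → ℝ := fun i => (u i : ℝ)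

/-- The cone generated by a set of lattice vectors. -/
noncomputable def coneOf (S : Set (Fin n → ℤ)) : PointedCone ℝ (Fin n → ℝ) :=
  PointedCone.hull ℝ (toReal '' S)

variable (n) in
/-- A fan in `ℝⁿ` with respect to the lattice `ℤⁿ`: a nonempty finite collection of strongly convex
rational polyhedral cones, closed under passing to faces, in which any two cones meet in a common
face. -/
structure Fan where
  cones : Set (PointedCone ℝ (Fin n → ℝ))
  finite : cones.Finite
  nonempty : cones.Nonempty
  rational : ∀ σ ∈ cones, ∃ S : Set (Fin n → ℤ), S.Finite ∧ σ = coneOf S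
  strongly_convex : ∀ σ ∈ cones, ∀ x ∈ σ, -x ∈ σ → x = 0
  face_mem : ∀ σ ∈ cones, ∀ τ : PointedCone ℝ (Fin n → ℝ), τ.IsFaceOf σ → τ ∈ cones
  inf_isFaceOf : ∀ σ ∈ cones, ∀ τ ∈ cones, (σ ⊓ τ).IsFaceOf σ ∧ (σ ⊓ τ).IsFaceOf τ

/-- The intersection of two cones of a fan, as a cone of the fan. -/
def Fan.inter (F : Fan n) (σ τ : F.cones) : F.cones :=
  ⟨σ.1 ⊓ τ.1, F.face_mem σ.1 σ.2 _ (F.inf_isFaceOf σ.1 σ.2 τ.1 τ.2).1⟩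

/-- The cones of a complete fan cover the space. -/
def Fan.IsComplete (F : Fan n) : Prop := ∀ x : Fin n → ℝ, ∃ σ ∈ F.cones, x ∈ σ

/-- Each cone of a non-singular fan is generated by a part of a basis of the lattice. -/
def Fan.IsNonsingular (F : Fan n) : Prop :=
  ∀ σ ∈ F.cones, ∃ (b : Module.Basis (Fin n) ℤ (Fin n → ℤ)) (s : Set (Fin n)), σ = coneOf (b '' s)

/-- The rays of a fan: its one-dimensional cones. -/
def Fan.rays (F : Fan n) : Set (PointedCone ℝ (Fin n → ℝ)) :=
  {σ ∈ F.cones | Module.finrank ℝ (Submodule.span ℝ (σ : Set (Fin n → ℝ))) = 1}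

/-- `K` is the underlying complex of the fan `F`, and each ray of `F` is generated by the vector
`ℓ v` of the corresponding vertex `v`. -/
def Fan.HasUnderlyingComplex (F : Fan n) {V : Type} (K : AbstractSimplicialComplex V)
    (ℓ : V → Fin n → ℤ) : Prop :=
  Set.BijOn (fun v => coneOf {ℓ v}) Set.univ F.rays ∧
    ∀ s : Finset V, s.Nonempty → (s ∈ K.faces ↔ coneOf (ℓ '' (s : Set V)) ∈ F.cones)

/-- A (non-singular) characteristic map over `K`: the vectors of each facet form a basis of `ℤⁿ`. -/
def IsCharacteristicMap {V : Type} (K : AbstractSimplicialComplex V) (ℓ : V → Fin n → ℤ) : Prop :=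
  ∀ s : Finset V, IsFacet K s →
    LinearIndependent ℤ (fun v : s => ℓ v) ∧ Submodule.span ℤ (ℓ '' (s : Set V)) = ⊤

/-- `F` is a complete non-singular fan with underlying complex `K` and ray vectors given by the
characteristic map `ℓ`. -/
structure IsFanOf {V : Type} (K : AbstractSimplicialComplex V) (ℓ : V → Fin n → ℤ)
    (F : Fan n) : Prop where
  characteristic : IsCharacteristicMap K ℓ
  complete : F.IsComplete
  nonsingular : F.IsNonsingular
  underlying : F.HasUnderlyingComplex K ℓ

variable (n) in
/-- The fan-giving characteristic maps over `K`. -/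
def FanGivingMap {V : Type} (K : AbstractSimplicialComplex V) : Type :=
  {ℓ : V → Fin n → ℤ // ∃ F : Fan n, IsFanOf K ℓ F}

variable (n) in
/-- Davis–Januszkiewicz equivalence: left multiplication by an invertible integer matrix. -/
def djSetoid {V : Type} (K : AbstractSimplicialComplex V) : Setoid (FanGivingMap n K) where
  r ℓ ℓ' := ∃ g : GL (Fin n) ℤ, ∀ v, ℓ'.1 v = (g : Matrix (Fin n) (Fin n) ℤ).mulVec (ℓ.1 v)
  iseqv :=
    { refl := fun _ => ⟨1, fun v => by simp⟩
      symm := by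
        rintro ℓ ℓ' ⟨g, h⟩
        refine ⟨g⁻¹, fun v => ?_⟩
        rw [h v, Matrix.mulVec_mulVec, ← Units.val_mul]
        simp
      trans := by
        rintro ℓ ℓ' ℓ'' ⟨g, h⟩ ⟨g', h'⟩
        refine ⟨g' * g, fun v => ?_⟩
        rw [h' v, h v, Matrix.mulVec_mulVec, Units.val_mul] }

variable (n) in
/-- The D-J equivalence classes of fan-giving characteristic maps over `K`. -/
def DJClass {V : Type} (K : AbstractSimplicialComplex V) : Type := Quotient (djSetoid n K)

end Fans

/-! ### Toric varieties -/

section Varieties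

variable {n : ℕ}

/-- The monoid `σ^∨ ∩ ℤⁿ` of lattice points of the dual cone. -/
def dualMonoid (σ : PointedCone ℝ (Fin n → ℝ)) : AddSubmonoid (Fin n → ℤ) where
  carrier := {m | ∀ x ∈ σ, 0 ≤ ∑ i, (m i : ℝ) * x i}
  zero_mem' := fun x _ => by simp
  add_mem' := fun {a b} ha hb x hx => by
    have : ∑ i, ((a + b) i : ℝ) * x i = ∑ i, (a i : ℝ) * x i + ∑ i, (b i : ℝ) * x i := by
      rw [← Finset.sum_add_distrib]
      exact Finset.sum_congr rfl fun i _ => by push_cast [Pi.add_apply]; ring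
    rw [this]
    exact add_nonneg (ha x hx) (hb x hx)

theorem dualMonoid_anti {σ τ : PointedCone ℝ (Fin n → ℝ)} (h : τ ≤ σ) :
    dualMonoid σ ≤ dualMonoid τ := fun _ hm x hx => hm x (h hx)

/-- The coordinate ring `ℂ[σ^∨ ∩ ℤⁿ]`. -/
abbrev coordRing (σ : PointedCone ℝ (Fin n → ℝ)) : Type := AddMonoidAlgebra ℂ (dualMonoid σ)

/-- `Spec ℂ`. -/
noncomputable abbrev specC : Scheme.{0} := Spec (CommRingCat.of ℂ)

/-- The affine toric variety `U_σ = Spec ℂ[σ^∨ ∩ ℤⁿ]`. -/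
noncomputable abbrev affineToric (σ : PointedCone ℝ (Fin n → ℝ)) : Scheme.{0} :=
  Spec (CommRingCat.of (coordRing σ))

/-- The structure morphism `U_σ ⟶ Spec ℂ`. -/
noncomputable def affineToricStr (σ : PointedCone ℝ (Fin n → ℝ)) : affineToric σ ⟶ specC :=
  Spec.map (CommRingCat.ofHom (algebraMap ℂ (coordRing σ)))

/-- The morphism `U_τ ⟶ U_σ` for `τ ⊆ σ`, induced by the inclusion `σ^∨ ∩ ℤⁿ ⊆ τ^∨ ∩ ℤⁿ`. -/
noncomputable def affineToricMap {σ τ : PointedCone ℝ (Fin n → ℝ)} (h : τ ≤ σ) :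
    affineToric τ ⟶ affineToric σ :=
  Spec.map (CommRingCat.ofHom
    (AddMonoidAlgebra.mapDomainRingHom ℂ (AddSubmonoid.inclusion (dualMonoid_anti h))))

/-- A presentation of a complex scheme `X` as the toric variety of the fan `F`: `X` is covered by open
subschemes `U_σ`, for the cones `σ` of `F`, with `U_σ ∩ U_τ = U_{σ ∩ τ}`, where `U_{σ ∩ τ}` is included
in `U_σ` and in `U_τ` by the toric morphisms. Thus `X` is the gluing of the `U_σ` along these. -/
structure ToricAtlas (F : Fan n) (X : Over specC) where
  chart (σ : F.cones) : affineToric σ.1 ⟶ X.left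
  isOpenImmersion (σ : F.cones) : IsOpenImmersion (chart σ)
  chart_over (σ : F.cones) : chart σ ≫ X.hom = affineToricStr σ.1
  map_chart (σ τ : F.cones) (h : τ.1 ≤ σ.1) : affineToricMap h ≫ chart σ = chart τ
  cover : ⋃ σ : F.cones, Set.range (chart σ) = Set.univ
  inter (σ τ : F.cones) :
    Set.range (chart σ) ∩ Set.range (chart τ) = Set.range (chart (F.inter σ τ))

/-- `X` is (isomorphic to) the toric variety of the fan `F`. -/
def IsToricVarietyOf (F : Fan n) (X : Over specC) : Prop := Nonempty (ToricAtlas F X)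

/-- `X` is the toric manifold (complete non-singular toric variety) given by the characteristic
pair `(K, ℓ)`. -/
def IsToricManifoldOf {V : Type} (K : AbstractSimplicialComplex V) (ℓ : V → Fin n → ℤ)
    (X : Over specC) : Prop :=
  ∃ F : Fan n, IsFanOf K ℓ F ∧ IsToricVarietyOf F X

variable (n) in
/-- `X` is an `n`-dimensional toric manifold supported by `K`. -/
def IsToricManifoldOver {V : Type} (K : AbstractSimplicialComplex V) (X : Over specC) : Prop :=
  ∃ ℓ : V → Fin n → ℤ, IsToricManifoldOf K ℓ X

/-- The homogeneous coordinate ring of `ℙ^N` over `ℂ`, with its grading. -/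
noncomputable abbrev homogCoord (N : ℕ) : ℕ → Submodule ℂ (MvPolynomial (Fin (N + 1)) ℂ) :=
  MvPolynomial.homogeneousSubmodule (Fin (N + 1)) ℂ

noncomputable instance homogCoordGraded (N : ℕ) : GradedAlgebra (homogCoord N) :=
  MvPolynomial.gradedAlgebra

/-- Projective space `ℙ^N` over `ℂ`. -/
noncomputable def projectiveSpace (N : ℕ) : Over specC :=
  Over.mk (Y := Proj (homogCoord N))
    (Proj.toSpecZero (homogCoord N) ≫
      Spec.map (CommRingCat.ofHom (algebraMap ℂ (homogCoord N 0))))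

/-- `X` is projective over `ℂ`: it has a closed embedding into some `ℙ^N` over `ℂ`. -/
def IsProjective (X : Over specC) : Prop :=
  ∃ (N : ℕ) (i : X ⟶ projectiveSpace N), IsClosedImmersion i.left

end Varieties

/-! ### The conjecture and the two seeds -/

/-- The conjecture of Gretenkort, Kleinschmidt and Sturmfels: for `n ≥ 4`, no neighborly
`n`-polytope with at least `n + 3` vertices supports a toric manifold. -/
def GKSConjecture : Prop :=
  ∀ n m : ℕ, 4 ≤ n → n + 3 ≤ m → ∀ K : AbstractSimplicialComplex (Fin m),
    IsPolytopal n K → IsNeighborly n K → ¬ ∃ X : Over specC, IsToricManifoldOver n K X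

/-- The minimal non-faces of the first seed; the vertices `1, …, 9` are written `0, …, 8`. -/
def nonfaces27 : Finset (Finset (Fin 9)) :=
  {{0, 1, 5}, {0, 3, 5}, {0, 3, 8}, {0, 5, 7}, {1, 4, 6}, {1, 4, 8}, {2, 3, 7}, {2, 3, 8},
    {2, 6, 7}, {5, 6, 7}, {2, 4, 6, 8}}

/-- The minimal non-faces of the second seed; the vertices `1, …, 9` are written `0, …, 8`. -/
def nonfaces28 : Finset (Finset (Fin 9)) :=
  {{0, 1, 6}, {0, 1, 7}, {0, 2, 6}, {1, 4, 5}, {1, 5, 7}, {2, 3, 7}, {2, 3, 8}, {3, 5, 7},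
    {4, 5, 8}, {4, 6, 8}}

set_option maxRecDepth 10000 in
theorem two_le_card_nonfaces27 : ∀ m ∈ nonfaces27, 2 ≤ m.card := by decide

/-- The complex `K^4_27` on nine vertices. -/
def K27 : AbstractSimplicialComplex (Fin 9) :=
  complexOfNonfaces (nonfaces27 : Set (Finset (Fin 9)))
    (fun m hm => two_le_card_nonfaces27 m (Finset.mem_coe.mp hm))

set_option maxRecDepth 10000 in
theorem two_le_card_nonfaces28 : ∀ m ∈ nonfaces28, 2 ≤ m.card := by decide

/-- The complex `K^4_28` on nine vertices. -/
def K28 : AbstractSimplicialComplex (Fin 9) :=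
  complexOfNonfaces (nonfaces28 : Set (Finset (Fin 9)))
    (fun m hm => two_le_card_nonfaces28 m (Finset.mem_coe.mp hm))

end ToricNeighborly

/-!
The statement combines algebraic geometry with finite computations, and four translations separate
the two.

*Fans and determinants.* A non-singular fan over a pure complex is a family of lattice bases, one
for each facet, whose cones meet in the cones over the intersections (`IsFanOf.isUnimodularFan`).
Across each wall of such a fan the determinant of the ray vectors changes its sign
(`IsUnimodularFan.det_update`), so that along a walk through all facets, in the basis of the first
facet, all determinants are known (`IsUnimodularFan.exists_normal_form`). For `K27` and `K28` these
are thirty polynomial equations over the integers, which are solved by splitting off factors and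
eliminating unknowns (`eq_map27_of_det`, `eq_map28_of_det`): there are two and four solutions.
Conversely, each solution is the characteristic map of a fan. That its cones meet properly is
certified by a list of hyperplanes (`isUnimodularFan_of_walk`), and it is complete since cones that
continue each other across each wall cover the space (`exists_mem_cone`). A matrix that relates two
of the solutions fixes the basis of the first facet, so the solutions represent different D-J
classes (`card_djClass`).

*Existence of toric varieties.* The affine charts are glued along the open immersions of the charts
of faces, which are localizations at monomials (`IsFanOf.exists_isToricVarietyOf`).

*Projectivity and support functions.* If the fan has a strictly concave integral support function,
the monomials of the vertices of its polytope, and of their neighbors on the edges, define a closed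
embedding into projective space (`IsFanOf.isProjective`). In the other direction, a closed
embedding is given on the torus by Laurent polynomials without common factor. On the chart of a
facet the least exponents form a covector `m t`; since the chart is the spectrum of a factorial
ring, the fixed point is mapped to the point whose coordinates are the coefficients at `m t`, and
as the embedding separates the fixed points, the covectors of different facets differ
(`IsFanOf.exists_support`). So no Picard group and no ample line bundle is needed. The two
characteristic maps over `K27` have explicit strictly concave support functions. For each of the
four over `K28` there are three walls whose relations sum to zero, whereas a concave function that
is strict across the walls takes a negative value on each of the relations
(`IsFanOf.not_isProjective`).

*Polytopes.* A strictly concave support function with negative values makes the complex the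
boundary complex of a simplicial polytope (`IsStrictSupport.isPolytopal`); this needs no lattice
bases, and applies to `K27` with one of its fans, and to `K28` with nine explicit points. In a
wedge, a minimal non-face contains both of the new vertices or neither, which fails for each pair
of vertices of `K27` and of `K28` (`isSeed_complexOfNonfaces`). -/

namespace ToricNeighborly

open CategoryTheory AlgebraicGeometry

/-! ### Points of projective space -/

section ProjectivePoints

open MvPolynomial

variable {N : ℕ}

/-- Evaluating a homogeneous polynomial of degree `d` at a point scaled by `u` multiplies its value
by `u ^ d`. -/
theorem aeval_smul_of_mem_homogCoord {R : Type} [CommRing R] [Algebra ℂ R] {d : ℕ}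
    {f : MvPolynomial (Fin (N + 1)) ℂ} (hf : f ∈ homogCoord N d) (u : R) (r : Fin (N + 1) → R) :
    aeval (fun j => u * r j) f = u ^ d * aeval r f := by
  have hf' : f.IsHomogeneous d := (mem_homogeneousSubmodule d f).mp hf
  rw [aeval_def, aeval_def, eval₂_eq', eval₂_eq', Finset.mul_sum]
  refine Finset.sum_congr rfl fun m hm => ?_
  have hdeg : ∑ i, m i = d := by
    have := hf' (mem_support_iff.mp hm)
    rw [← this, Finsupp.weight_apply, Finsupp.sum_fintype _ _ (by simp)]
    simp
  simp only [mul_pow, Finset.prod_mul_distrib, Finset.prod_pow_eq_pow_sum, hdeg]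
  ring

theorem evalAway_ext {R : Type} [CommRing R] {f : MvPolynomial (Fin (N + 1)) ℂ} {m : ℕ}
    (hf : f ∈ homogCoord N m)
    {φ ψ : HomogeneousLocalization.Away (homogCoord N) f →+* R}
    (h : ∀ (k : ℕ) (a : MvPolynomial (Fin (N + 1)) ℂ) (ha : a ∈ homogCoord N (k • m)),
      φ (HomogeneousLocalization.Away.mk _ hf k a ha) =
        ψ (HomogeneousLocalization.Away.mk _ hf k a ha)) : φ = ψ := by
  ext x
  obtain ⟨k, a, ha, rfl⟩ := HomogeneousLocalization.Away.mk_surjective _ hf x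
  exact h k a ha

variable {R : Type} [CommRing R] [Algebra ℂ R]

/-- Evaluation at the point with homogeneous coordinates `r`, on the fractions of degree zero with
denominator a power of `f`. -/
noncomputable def evalAway (r : Fin (N + 1) → R) (f : MvPolynomial (Fin (N + 1)) ℂ)
    (hu : IsUnit (aeval r f)) : HomogeneousLocalization.Away (homogCoord N) f →+* R :=
  (IsLocalization.Away.lift (S := Localization.Away f) f (g := (aeval r).toRingHom) hu).comp
    (algebraMap _ (Localization.Away f))

theorem evalAway_mk (r : Fin (N + 1) → R) {f : MvPolynomial (Fin (N + 1)) ℂ}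
    (hu : IsUnit (aeval r f)) {m : ℕ} (hf : f ∈ homogCoord N m) (k : ℕ)
    (a : MvPolynomial (Fin (N + 1)) ℂ) (ha : a ∈ homogCoord N (k • m)) :
    evalAway r f hu (HomogeneousLocalization.Away.mk _ hf k a ha) * aeval r f ^ k = aeval r a := by
  have h1 : evalAway r f hu (HomogeneousLocalization.Away.mk _ hf k a ha) =
      IsLocalization.Away.lift (S := Localization.Away f) f (g := (aeval r).toRingHom) hu
        (Localization.mk a ⟨f ^ k, k, rfl⟩) := by
    simp [evalAway, HomogeneousLocalization.Away.val_mk]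
  have h2 : ∀ y : MvPolynomial (Fin (N + 1)) ℂ, aeval r y = IsLocalization.Away.lift
      (S := Localization.Away f) f (g := (aeval r).toRingHom) hu (algebraMap _ _ y) := fun y => by
    rw [IsLocalization.Away.lift_eq]; rfl
  rw [h1, h2 f, h2 a, ← map_pow, ← map_mul, Localization.mk_eq_mk', ← map_pow]
  congr 1
  exact IsLocalization.mk'_spec _ a (⟨f ^ k, k, rfl⟩ : Submonoid.powers f)

/-- The morphism `Spec R ⟶ ℙ^N` with homogeneous coordinates `r`, defined through a homogeneous
polynomial `f` that does not vanish on it. -/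
noncomputable def projPoint (r : Fin (N + 1) → R) {f : MvPolynomial (Fin (N + 1)) ℂ} {m : ℕ}
    (hf : f ∈ homogCoord N m) (hm : 0 < m) (hu : IsUnit (aeval r f)) :
    Spec (CommRingCat.of R) ⟶ Proj (homogCoord N) :=
  Spec.map (CommRingCat.ofHom (evalAway r f hu)) ≫ Proj.awayι (homogCoord N) f hf hm

theorem projPoint_mul (r : Fin (N + 1) → R) {f g : MvPolynomial (Fin (N + 1)) ℂ} {m m' : ℕ}
    (hf : f ∈ homogCoord N m) (hm : 0 < m) (hg : g ∈ homogCoord N m') (hu : IsUnit (aeval r f))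
    (hfg : f * g ∈ homogCoord N (m + m')) (hu' : IsUnit (aeval r (f * g))) :
    projPoint r hfg (hm.trans_le (m.le_add_right m')) hu' = projPoint r hf hm hu := by
  unfold projPoint
  have key : (evalAway r (f * g) hu').comp (HomogeneousLocalization.awayMap (homogCoord N) hg rfl) =
      evalAway r f hu := ?_
  · rw [← Proj.SpecMap_awayMap_awayι (homogCoord N) hf hm hg rfl, ← Category.assoc,
      ← Spec.map_comp, ← CommRingCat.ofHom_comp, key]
  refine evalAway_ext hf fun k a ha => ?_
  rw [RingHom.comp_apply, HomogeneousLocalization.awayMap_mk]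
  have h1 := evalAway_mk r hu hf k a ha
  have h2 := evalAway_mk r hu' hfg k (a * g ^ k)
    (by rw [smul_add]; exact SetLike.mul_mem_graded ha (SetLike.pow_mem_graded _ hg))
  refine (hu'.pow k).mul_right_cancel ?_
  rw [h2, map_mul, map_mul, mul_pow, ← mul_assoc, h1, map_pow]

/-- The morphism with given homogeneous coordinates does not depend on the auxiliary polynomial. -/
theorem projPoint_eq (r : Fin (N + 1) → R) {f g : MvPolynomial (Fin (N + 1)) ℂ} {m m' : ℕ}
    (hf : f ∈ homogCoord N m) (hm : 0 < m) (hu : IsUnit (aeval r f))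
    (hg : g ∈ homogCoord N m') (hm' : 0 < m') (hu' : IsUnit (aeval r g)) :
    projPoint r hf hm hu = projPoint r hg hm' hu' := by
  have h1 : f * g ∈ homogCoord N (m + m') := SetLike.mul_mem_graded hf hg
  have h2 : g * f ∈ homogCoord N (m' + m) := SetLike.mul_mem_graded hg hf
  have hu1 : IsUnit (aeval r (f * g)) := by rw [map_mul]; exact hu.mul hu'
  have hu2 : IsUnit (aeval r (g * f)) := by rw [map_mul]; exact hu'.mul hu
  rw [← projPoint_mul r hf hm hg hu h1 hu1, ← projPoint_mul r hg hm' hf hu' h2 hu2]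
  congr 1
  · exact mul_comm f g
  · exact add_comm m m'

/-- Homogeneous coordinates matter only up to a unit. -/
theorem projPoint_smul (r : Fin (N + 1) → R) {u : R}
    {f : MvPolynomial (Fin (N + 1)) ℂ} {m : ℕ}
    (hf : f ∈ homogCoord N m) (hm : 0 < m) (hu : IsUnit (aeval r f))
    (hu' : IsUnit (aeval (fun j => u * r j) f)) :
    projPoint (fun j => u * r j) hf hm hu' = projPoint r hf hm hu := by
  unfold projPoint
  congr 3
  refine evalAway_ext hf fun k a ha => ?_
  have h1 := evalAway_mk _ hu' hf k a ha
  have h2 := evalAway_mk _ hu hf k a ha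
  refine (hu'.pow k).mul_right_cancel ?_
  rw [h1, aeval_smul_of_mem_homogCoord ha, aeval_smul_of_mem_homogCoord hf, ← h2]
  rw [smul_eq_mul, mul_pow, ← pow_mul, mul_comm k m]
  ring

theorem Spec_map_projPoint {R' : Type} [CommRing R'] [Algebra ℂ R'] (φ : R →ₐ[ℂ] R')
    (r : Fin (N + 1) → R) {f : MvPolynomial (Fin (N + 1)) ℂ} {m : ℕ}
    (hf : f ∈ homogCoord N m) (hm : 0 < m) (hu : IsUnit (aeval r f))
    (hu' : IsUnit (aeval (fun j => φ (r j)) f)) :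
    Spec.map (CommRingCat.ofHom φ.toRingHom) ≫ projPoint r hf hm hu =
      projPoint (fun j => φ (r j)) hf hm hu' := by
  unfold projPoint
  rw [← Category.assoc, ← Spec.map_comp, ← CommRingCat.ofHom_comp]
  congr 3
  have key : ∀ a : MvPolynomial (Fin (N + 1)) ℂ, aeval (fun j => φ (r j)) a = φ (aeval r a) :=
    fun a => by
      rw [← AlgHom.comp_apply]
      congr 1
      ext j
      simp
  refine evalAway_ext hf fun k a ha => ?_
  have h1 := evalAway_mk _ hu' hf k a ha
  have h2 := evalAway_mk _ hu hf k a ha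
  refine (hu'.pow k).mul_right_cancel ?_
  rw [h1, key, key, ← h2]
  simp

/-- The point with homogeneous coordinates `r` lies in `D₊(g)` where `g(r)` does not vanish. -/
theorem projPoint_mem_basicOpen (r : Fin (N + 1) → R) {f g : MvPolynomial (Fin (N + 1)) ℂ}
    {m m' : ℕ} (hf : f ∈ homogCoord N m) (hm : 0 < m) (hu : IsUnit (aeval r f))
    (hg : g ∈ homogCoord N m') (hm' : 0 < m') (x : Spec (CommRingCat.of R)) :
    projPoint r hf hm hu x ∈ Proj.basicOpen (homogCoord N) g ↔ aeval r g ∉ x.asIdeal := by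
  have h0 : projPoint r hf hm hu x ∈ Proj.basicOpen (homogCoord N) g ↔
      Spec.map (CommRingCat.ofHom (evalAway r f hu)) x ∈
        Proj.awayι (homogCoord N) f hf hm ⁻¹ᵁ Proj.basicOpen (homogCoord N) g := by
    simp [projPoint]
  rw [h0, Proj.awayι_preimage_basicOpen (homogCoord N) hf hm hg hm']
  have h1 := evalAway_mk r hu hf m' (g ^ m)
    (by simpa [mul_comm] using SetLike.pow_mem_graded m hg)
  have h2 : evalAway r f hu (HomogeneousLocalization.Away.isLocalizationElem hf hg) *
      aeval r f ^ m' = aeval r g ^ m := by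
    rw [← map_pow (aeval r) g m, ← h1]
  change ¬ (evalAway r f hu (HomogeneousLocalization.Away.isLocalizationElem hf hg) ∈ x.asIdeal) ↔ _
  rw [not_iff_not, ← Ideal.mul_unit_mem_iff_mem _ (hu.pow m'), h2]
  exact x.2.pow_mem_iff_mem m hm

theorem projPoint_comp_hom (r : Fin (N + 1) → R) {f : MvPolynomial (Fin (N + 1)) ℂ}
    {m : ℕ} (hf : f ∈ homogCoord N m) (hm : 0 < m) (hu : IsUnit (aeval r f)) :
    projPoint r hf hm hu ≫ (projectiveSpace N).hom =
      Spec.map (CommRingCat.ofHom (algebraMap ℂ R)) := by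
  change (_ ≫ _) ≫ (_ ≫ _) = _
  rw [Category.assoc, Proj.awayι_toSpecZero_assoc, ← Spec.map_comp, ← Spec.map_comp,
    ← CommRingCat.ofHom_comp, ← CommRingCat.ofHom_comp]
  congr 2
  ext c
  have h1 := evalAway_mk r hu hf 0 (C c) (by
    rw [zero_smul]; exact (mem_homogeneousSubmodule 0 _).mpr (isHomogeneous_C _ c))
  simp only [pow_zero, mul_one, aeval_C] at h1
  rw [← h1]
  rfl

theorem X_mem_homogCoord (l : Fin (N + 1)) :
    (X l : MvPolynomial (Fin (N + 1)) ℂ) ∈ homogCoord N 1 :=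
  (mem_homogeneousSubmodule 1 _).mpr (isHomogeneous_X ℂ l)

/-- A ring homomorphism over `ℂ` from the coordinate ring of `D₊(X l)` is the evaluation at the
images of the affine coordinates `X k / X l`. -/
theorem eq_evalAway (l : Fin (N + 1))
    (θ : HomogeneousLocalization.Away (homogCoord N) (X l : MvPolynomial (Fin (N + 1)) ℂ) →+* R)
    (hθ : ∀ c : homogCoord N 0, ∀ c' : ℂ, (c : MvPolynomial (Fin (N + 1)) ℂ) = C c' →
      θ (HomogeneousLocalization.fromZeroRingHom _ _ c) = algebraMap ℂ R c') :
    ∃ (r : Fin (N + 1) → R) (_ : r l = 1) (hu : IsUnit (aeval r (X l : MvPolynomial _ ℂ))),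
      θ = evalAway r (X l) hu := by
  set r : Fin (N + 1) → R := fun j =>
    θ (HomogeneousLocalization.Away.mk _ (X_mem_homogCoord l) 1 (X j)
      (by simpa using X_mem_homogCoord j)) with hr
  have hl : r l = 1 := by
    rw [hr]
    have : HomogeneousLocalization.Away.mk _ (X_mem_homogCoord l) 1 (X l)
      (by simpa using X_mem_homogCoord l) = 1 := by
      apply HomogeneousLocalization.val_injective
      rw [HomogeneousLocalization.Away.val_mk, HomogeneousLocalization.val_one]
      simp only [pow_one]
      exact Localization.mk_self
        (⟨X l, 1, by simp⟩ : Submonoid.powers (X l : MvPolynomial (Fin (N + 1)) ℂ))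
    simp only
    rw [this, map_one]
  refine ⟨r, hl, by simp [hl], ?_⟩
  refine evalAway_ext (X_mem_homogCoord l) fun k a ha => ?_
  have h1 := evalAway_mk r (by simp [hl]) (X_mem_homogCoord l) k a ha
  have h1' : aeval r (X l : MvPolynomial (Fin (N + 1)) ℂ) ^ k = 1 := by
    rw [aeval_X, hl, one_pow]
  rw [h1', mul_one] at h1
  rw [h1]
  let A := HomogeneousLocalization.Away (homogCoord N) (X l : MvPolynomial (Fin (N + 1)) ℂ)
  let ι : ℂ →+* A := (HomogeneousLocalization.fromZeroRingHom _ _).comp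
    (algebraMap ℂ (homogCoord N 0))
  let y : Fin (N + 1) → A := fun j =>
    HomogeneousLocalization.Away.mk _ (X_mem_homogCoord l) 1 (X j)
      (by simpa using X_mem_homogCoord j)
  have key : HomogeneousLocalization.Away.mk _ (X_mem_homogCoord l) k a ha = eval₂Hom ι y a := by
    apply HomogeneousLocalization.val_injective
    rw [HomogeneousLocalization.Away.val_mk]
    have e1 : ((eval₂Hom ι y a).val : Localization.Away (X l : MvPolynomial (Fin (N + 1)) ℂ)) =
        aeval (fun j => Localization.mk 1 (⟨X l, 1, by simp⟩ : Submonoid.powers (X l)) *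
          algebraMap (MvPolynomial (Fin (N + 1)) ℂ) _ (X j)) a := by
      rw [← HomogeneousLocalization.algebraMap_apply, ← RingHom.comp_apply, ← AlgHom.coe_toRingHom]
      congr 1
      refine MvPolynomial.ringHom_ext (fun c => ?_) fun j => ?_
      · simp only [RingHom.comp_apply, coe_eval₂Hom, eval₂_C]
        rw [HomogeneousLocalization.algebraMap_apply]
        simp only [AlgHom.coe_toRingHom, aeval_C]
        simp only [ι, RingHom.comp_apply]
        rfl
      · simp only [RingHom.comp_apply, coe_eval₂Hom, eval₂_X, AlgHom.coe_toRingHom, aeval_X,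
          HomogeneousLocalization.algebraMap_apply, y]
        rw [HomogeneousLocalization.Away.val_mk, ← Localization.mk_one_eq_algebraMap,
          Localization.mk_mul]
        simp
    rw [e1, aeval_smul_of_mem_homogCoord ha]
    have e2 : aeval (fun j => algebraMap (MvPolynomial (Fin (N + 1)) ℂ)
        (Localization.Away (X l : MvPolynomial (Fin (N + 1)) ℂ)) (X j)) a = algebraMap _ _ a := by
      have : aeval (fun j => algebraMap (MvPolynomial (Fin (N + 1)) ℂ)
        (Localization.Away (X l : MvPolynomial (Fin (N + 1)) ℂ)) (X j)) =
          IsScalarTower.toAlgHom ℂ _ _ := by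
        ext j; simp
      rw [this]; rfl
    rw [e2, Localization.mk_pow, ← Localization.mk_one_eq_algebraMap, Localization.mk_mul,
      one_pow, one_mul, smul_eq_mul, mul_one,
      mul_one]
    rfl
  rw [key, ← RingHom.comp_apply, ← AlgHom.coe_toRingHom]
  congr 1
  refine MvPolynomial.ringHom_ext (fun c => ?_) fun j => ?_
  · simp only [RingHom.comp_apply, coe_eval₂Hom, eval₂_C, AlgHom.coe_toRingHom, aeval_C, ι]
    exact hθ _ c rfl
  · simp [y, hr]

end ProjectivePoints

end ToricNeighborly

namespace ToricNeighborly

open CategoryTheory AlgebraicGeometry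

/-! ### Morphisms from affine schemes to projective space -/

section ProjectivePoints

open MvPolynomial

variable {N : ℕ} {R : Type} [CommRing R] [Algebra ℂ R]

theorem isUnit_aeval_X {r : Fin (N + 1) → R} {l : Fin (N + 1)} (h : IsUnit (r l)) :
    IsUnit (aeval r (X l : MvPolynomial (Fin (N + 1)) ℂ)) := by rwa [aeval_X]

/-- The morphism with homogeneous coordinates `r`, where the coordinate with index `l` is a unit. -/
noncomputable def projPointX (r : Fin (N + 1) → R) (l : Fin (N + 1)) (h : IsUnit (r l)) :
    Spec (CommRingCat.of R) ⟶ Proj (homogCoord N) :=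
  projPoint r (X_mem_homogCoord l) one_pos (isUnit_aeval_X h)

/-- A morphism over `ℂ` from an affine scheme to `ℙ^N` whose image lies in `D₊(X l)` has homogeneous
coordinates. -/
theorem exists_eq_projPointX (ψ : Spec (CommRingCat.of R) ⟶ Proj (homogCoord N))
    (hψ : ψ ≫ (projectiveSpace N).hom = Spec.map (CommRingCat.ofHom (algebraMap ℂ R)))
    (l : Fin (N + 1)) (hl : ∀ x, ψ x ∈ Proj.basicOpen (homogCoord N) (X l)) :
    ∃ (r : Fin (N + 1) → R) (_ : r l = 1) (h : IsUnit (r l)), ψ = projPointX r l h := by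
  let j := Proj.awayι (homogCoord N) (X l) (X_mem_homogCoord l) one_pos
  have hr : Set.range ψ ⊆ Set.range j := by
    rintro _ ⟨x, rfl⟩
    have := hl x
    rw [← Proj.opensRange_awayι (homogCoord N) (X l) (X_mem_homogCoord l) one_pos] at this
    exact this
  obtain ⟨θ, hθ⟩ := Spec.map_surjective (IsOpenImmersion.lift j ψ hr)
  have hfac : Spec.map θ ≫ j = ψ := by rw [hθ, IsOpenImmersion.lift_fac]
  have hθc : θ.hom.comp ((HomogeneousLocalization.fromZeroRingHom _ _).comp
      (algebraMap ℂ (homogCoord N 0))) = algebraMap ℂ R := by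
    have h1 : (Spec.map θ ≫ j) ≫ (projectiveSpace N).hom =
        Spec.map (CommRingCat.ofHom (algebraMap ℂ R)) := by rw [hfac, hψ]
    change (_ ≫ _) ≫ (_ ≫ _) = _ at h1
    rw [Category.assoc, Proj.awayι_toSpecZero_assoc, ← Spec.map_comp, ← Spec.map_comp] at h1
    exact congrArg CommRingCat.Hom.hom (Spec.map_injective h1)
  obtain ⟨r, hr1, hu, hrθ⟩ := eq_evalAway l θ.hom (fun c c' hc => by
    rw [← hθc]
    simp only [RingHom.comp_apply]
    congr 2
    exact Subtype.ext hc)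
  refine ⟨r, hr1, by simp [hr1], ?_⟩
  rw [← hfac, projPointX, projPoint, ← hrθ]
  rfl

/-- Equal morphisms have proportional homogeneous coordinates. -/
theorem mul_eq_mul_of_projPointX_eq {r r' : Fin (N + 1) → R} {l l' : Fin (N + 1)}
    {h : IsUnit (r l)} {h' : IsUnit (r' l')} (heq : projPointX r l h = projPointX r' l' h')
    (k : Fin (N + 1)) : r k * r' l = r' k * r l := by
  have hu : IsUnit (r' l) := by
    by_contra hn
    obtain ⟨m, hm, hmem⟩ := exists_max_ideal_of_mem_nonunits hn
    let x : Spec (CommRingCat.of R) := ⟨m, hm.isPrime⟩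
    have h1 := projPoint_mem_basicOpen r (X_mem_homogCoord l) one_pos (isUnit_aeval_X h)
      (X_mem_homogCoord l) one_pos x
    have h2 := projPoint_mem_basicOpen r' (X_mem_homogCoord l') one_pos (isUnit_aeval_X h')
      (X_mem_homogCoord l) one_pos x
    rw [aeval_X] at h1 h2
    have h3 : r l ∉ x.asIdeal := fun hc => hm.ne_top (Ideal.eq_top_of_isUnit_mem _ hc h)
    have h4 := h1.mpr h3
    change projPointX r l h x ∈ _ at h4
    rw [heq] at h4
    exact h2.mp h4 hmem
  have heq2 : projPointX r l h = projPointX r' l hu := by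
    rw [heq]
    exact projPoint_eq _ _ _ _ _ _ _
  have h5 : evalAway r (X l) (isUnit_aeval_X h) = evalAway r' (X l) (isUnit_aeval_X hu) := by
    have := (cancel_mono (Proj.awayι (homogCoord N) (X l) (X_mem_homogCoord l) one_pos)).mp heq2
    exact congrArg CommRingCat.Hom.hom (Spec.map_injective this)
  have hk : (X k : MvPolynomial (Fin (N + 1)) ℂ) ∈ homogCoord N (1 • 1) := by
    simpa using X_mem_homogCoord k
  have e1 := evalAway_mk r (isUnit_aeval_X h) (X_mem_homogCoord l) 1 (X k) hk
  have e2 := evalAway_mk r' (isUnit_aeval_X hu) (X_mem_homogCoord l) 1 (X k) hk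
  rw [← h5] at e2
  simp only [pow_one, aeval_X] at e1 e2
  rw [← e1, ← e2]
  ring

theorem projPointX_eq (r : Fin (N + 1) → R) {l l' : Fin (N + 1)} (h : IsUnit (r l))
    (h' : IsUnit (r l')) : projPointX r l h = projPointX r l' h' :=
  projPoint_eq _ _ _ _ _ _ _

theorem projPointX_congr {r r' : Fin (N + 1) → R} {l l' : Fin (N + 1)} {h : IsUnit (r l)}
    {h' : IsUnit (r' l')} {u : R} (heq : ∀ k, r' k = u * r k) (hu : IsUnit u) :
    projPointX r l h = projPointX r' l' h' := by
  obtain rfl : r' = fun k => u * r k := funext heq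
  have h2 : IsUnit ((fun k => u * r k) l) := hu.mul h
  rw [projPointX_eq (fun k => u * r k) h' h2]
  exact (projPoint_smul r _ _ _ _).symm

theorem Spec_map_projPointX {R' : Type} [CommRing R'] [Algebra ℂ R'] (φ : R →ₐ[ℂ] R')
    (r : Fin (N + 1) → R) {l : Fin (N + 1)} (h : IsUnit (r l)) (h' : IsUnit (φ (r l))) :
    Spec.map (CommRingCat.ofHom φ.toRingHom) ≫ projPointX r l h =
      projPointX (fun j => φ (r j)) l h' :=
  Spec_map_projPoint φ r _ _ _ _

theorem projPointX_mem_basicOpen (r : Fin (N + 1) → R) {l : Fin (N + 1)} (h : IsUnit (r l))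
    {g : MvPolynomial (Fin (N + 1)) ℂ} {m : ℕ} (hg : g ∈ homogCoord N m) (hm : 0 < m)
    (x : Spec (CommRingCat.of R)) :
    projPointX r l h x ∈ Proj.basicOpen (homogCoord N) g ↔ aeval r g ∉ x.asIdeal :=
  projPoint_mem_basicOpen _ _ _ _ hg hm x

theorem projPointX_comp_hom (r : Fin (N + 1) → R) {l : Fin (N + 1)} (h : IsUnit (r l)) :
    projPointX r l h ≫ (projectiveSpace N).hom =
      Spec.map (CommRingCat.ofHom (algebraMap ℂ R)) :=
  projPoint_comp_hom _ _ _ _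

/-- The morphism with homogeneous coordinates `r` is a closed immersion into `D₊(X l)` if the
quotients of the coordinates generate the algebra. -/
theorem exists_isClosedImmersion_comp_awayι (r : Fin (N + 1) → R) {l : Fin (N + 1)}
    (h : IsUnit (r l)) (h1 : r l = 1) (hr : Algebra.adjoin ℂ (Set.range r) = ⊤) :
    ∃ f : Spec (CommRingCat.of R) ⟶ Spec (CommRingCat.of
        (HomogeneousLocalization.Away (homogCoord N) (X l : MvPolynomial (Fin (N + 1)) ℂ))),
      IsClosedImmersion f ∧
        f ≫ Proj.awayι (homogCoord N) (X l) (X_mem_homogCoord l) one_pos = projPointX r l h := by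
  refine ⟨Spec.map (CommRingCat.ofHom (evalAway r (X l) (isUnit_aeval_X h))), ?_, rfl⟩
  refine IsClosedImmersion.spec_of_surjective _ ?_
  have hc : ∀ c : ℂ, algebraMap ℂ R c ∈ (evalAway r (X l) (isUnit_aeval_X h)).range := fun c => by
    refine ⟨HomogeneousLocalization.Away.mk _ (X_mem_homogCoord l) 0 (C c) ?_, ?_⟩
    · rw [zero_smul]; exact (mem_homogeneousSubmodule 0 _).mpr (isHomogeneous_C _ c)
    · have := evalAway_mk r (isUnit_aeval_X h) (X_mem_homogCoord l) 0 (C c)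
        (by rw [zero_smul]; exact (mem_homogeneousSubmodule 0 _).mpr (isHomogeneous_C _ c))
      simpa using this
  let B : Subalgebra ℂ R :=
    { (evalAway r (X l) (isUnit_aeval_X h)).range.toSubsemiring with algebraMap_mem' := hc }
  have hB : B = ⊤ := by
    rw [eq_top_iff, ← hr]
    refine Algebra.adjoin_le ?_
    rintro _ ⟨k, rfl⟩
    have hk : (X k : MvPolynomial (Fin (N + 1)) ℂ) ∈ homogCoord N (1 • 1) := by
      simpa using X_mem_homogCoord k
    refine ⟨HomogeneousLocalization.Away.mk _ (X_mem_homogCoord l) 1 (X k) hk, ?_⟩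
    have := evalAway_mk r (isUnit_aeval_X h) (X_mem_homogCoord l) 1 (X k) hk
    simpa [h1] using this
  intro y
  have : y ∈ B := by rw [hB]; trivial
  exact this

end ProjectivePoints

end ToricNeighborly

namespace ToricNeighborly

/-! ### Unimodular cones -/

section Cones

variable {n : ℕ} {V : Type}

/-- The pairing of a lattice covector with a real vector. -/
def pair (m : Fin n → ℤ) (x : Fin n → ℝ) : ℝ := ∑ i, (m i : ℝ) * x i

theorem pair_toReal (m u : Fin n → ℤ) : pair m (toReal u) = ((m ⬝ᵥ u : ℤ) : ℝ) := by
  simp [pair, toReal, dotProduct]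

theorem pair_add (m : Fin n → ℤ) (x y : Fin n → ℝ) : pair m (x + y) = pair m x + pair m y := by
  simp [pair, mul_add, Finset.sum_add_distrib]

theorem pair_smul (m : Fin n → ℤ) (c : ℝ) (x : Fin n → ℝ) : pair m (c • x) = c * pair m x := by
  simp only [pair, Pi.smul_apply, smul_eq_mul, Finset.mul_sum]
  exact Finset.sum_congr rfl fun i _ => by ring

theorem pair_neg (m : Fin n → ℤ) (x : Fin n → ℝ) : pair m (-x) = -pair m x := by
  simp [pair]

theorem pair_sum (m : Fin n → ℤ) (s : Finset V) (f : V → Fin n → ℝ) :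
    pair m (∑ v ∈ s, f v) = ∑ v ∈ s, pair m (f v) := by
  classical
  induction s using Finset.induction_on with
  | empty => simp [pair]
  | insert a s ha ih => rw [Finset.sum_insert ha, Finset.sum_insert ha, pair_add, ih]

theorem mem_coneOf {ℓ : V → Fin n → ℤ} {s : Finset V} {x : Fin n → ℝ} :
    x ∈ coneOf (ℓ '' (s : Set V)) ↔
      ∃ c : V → ℝ, (∀ v, 0 ≤ c v) ∧ x = ∑ v ∈ s, c v • toReal (ℓ v) := by
  rw [coneOf, PointedCone.hull, ← Set.image_comp, Submodule.mem_span_image_finset_iff_exists_fun']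
  constructor
  · rintro ⟨c, hc⟩
    exact ⟨fun v => c v, fun v => (c v).2, hc.symm⟩
  · rintro ⟨c, hc0, hc⟩
    exact ⟨fun v => ⟨c v, hc0 v⟩, hc.symm⟩

theorem toReal_mem_coneOf {S : Set (Fin n → ℤ)} {u : Fin n → ℤ} (h : u ∈ S) :
    toReal u ∈ coneOf S := Submodule.subset_span ⟨u, h, rfl⟩

theorem coneOf_mono {S S' : Set (Fin n → ℤ)} (h : S ⊆ S') : coneOf S ≤ coneOf S' :=
  Submodule.span_mono (Set.image_mono h)

theorem mem_dualMonoid_coneOf {ℓ : V → Fin n → ℤ} {s : Finset V} {m : Fin n → ℤ} :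
    m ∈ dualMonoid (coneOf (ℓ '' (s : Set V))) ↔ ∀ v ∈ s, 0 ≤ m ⬝ᵥ ℓ v := by
  constructor
  · intro h v hv
    have := h (toReal (ℓ v)) (toReal_mem_coneOf ⟨v, hv, rfl⟩)
    change 0 ≤ pair m _ at this
    rw [pair_toReal] at this
    exact_mod_cast this
  · intro h x hx
    obtain ⟨c, hc, rfl⟩ := mem_coneOf.mp hx
    change 0 ≤ pair m _
    rw [pair_sum]
    refine Finset.sum_nonneg fun v hv => ?_
    rw [pair_smul, pair_toReal]
    exact mul_nonneg (hc v) (by exact_mod_cast h v hv)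

/-- Every face of a finitely generated cone is spanned by some of the generators. -/
theorem exists_of_isFaceOf_coneOf {ℓ : V → Fin n → ℤ} {s : Finset V}
    {τ : PointedCone ℝ (Fin n → ℝ)} (hτ : τ.IsFaceOf (coneOf (ℓ '' (s : Set V)))) :
    ∃ s' ⊆ s, τ = coneOf (ℓ '' (s' : Set V)) := by
  classical
  refine ⟨s.filter fun v => toReal (ℓ v) ∈ τ, Finset.filter_subset _ _, le_antisymm ?_ ?_⟩
  · intro x hx
    have hxs := hτ.le hx
    obtain ⟨c, hc, hxc⟩ := mem_coneOf.mp hxs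
    rw [mem_coneOf]
    refine ⟨c, hc, ?_⟩
    rw [hxc]
    symm
    refine Finset.sum_subset (Finset.filter_subset _ _) fun v hv hvn => ?_
    rcases (hc v).eq_or_lt with h0 | h0
    · rw [← h0, zero_smul]
    · exfalso
      refine hvn (Finset.mem_filter.mpr ⟨hv, ?_⟩)
      have hy : ∑ w ∈ s.erase v, c w • toReal (ℓ w) ∈ coneOf (ℓ '' (s : Set V)) := by
        refine Submodule.sum_mem _ fun w hw => ?_
        exact Submodule.smul_mem _ (⟨c w, hc w⟩ : {c : ℝ // 0 ≤ c})
          (toReal_mem_coneOf ⟨w, Finset.mem_of_mem_erase hw, rfl⟩)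
      refine hτ.mem_of_smul_add_mem (toReal_mem_coneOf ⟨v, hv, rfl⟩) hy h0 ?_
      rw [Finset.add_sum_erase s (fun w => c w • toReal (ℓ w)) hv, ← hxc]
      exact hx
  · refine Submodule.span_le.mpr ?_
    rintro _ ⟨_, ⟨v, hv, rfl⟩, rfl⟩
    exact (Finset.mem_filter.mp hv).2

/-- `d` is the dual basis of the vectors `ℓ v`, `v ∈ t`, which then form a basis of the lattice. -/
structure IsDualBasis [DecidableEq V] (ℓ : V → Fin n → ℤ) (t : Finset V) (d : V → Fin n → ℤ) :
    Prop where
  card_eq : t.card = n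
  dot_eq : ∀ v ∈ t, ∀ w ∈ t, d v ⬝ᵥ ℓ w = if v = w then 1 else 0

variable [DecidableEq V] {ℓ d : V → Fin n → ℤ} {t : Finset V}

theorem IsDualBasis.sum_mul (h : IsDualBasis ℓ t d) (i j : Fin n) :
    ∑ v ∈ t, ℓ v i * d v j = if i = j then 1 else 0 := by
  have e : t ≃ Fin n := t.equivFinOfCardEq h.card_eq
  let D : Matrix (Fin n) (Fin n) ℤ := fun a i => d (e.symm a) i
  let L : Matrix (Fin n) (Fin n) ℤ := fun i a => ℓ (e.symm a) i
  have h1 : D * L = 1 := by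
    ext a b
    have := h.dot_eq (e.symm a) (e.symm a).2 (e.symm b) (e.symm b).2
    rw [Matrix.mul_apply, Matrix.one_apply]
    change d (e.symm a) ⬝ᵥ ℓ (e.symm b) = _
    rw [this]
    simp
  have h2 : L * D = 1 := mul_eq_one_comm.mp h1
  have h3 := congrFun (congrFun h2 i) j
  rw [Matrix.mul_apply, Matrix.one_apply] at h3
  rw [← h3, ← Finset.sum_coe_sort t, ← e.symm.sum_comp]

/-- The expansion of a real vector in the basis `ℓ v`. -/
theorem IsDualBasis.eq_sum (h : IsDualBasis ℓ t d) (x : Fin n → ℝ) :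
    x = ∑ v ∈ t, pair (d v) x • toReal (ℓ v) := by
  ext i
  rw [Finset.sum_apply]
  simp only [Pi.smul_apply, smul_eq_mul, pair, toReal, Finset.sum_mul]
  rw [Finset.sum_comm]
  have : ∀ j, ∑ v ∈ t, (d v j : ℝ) * x j * (ℓ v i : ℝ) = (if i = j then 1 else 0) * x j := by
    intro j
    have h1 : ((∑ v ∈ t, ℓ v i * d v j : ℤ) : ℝ) = ((if i = j then 1 else 0 : ℤ) : ℝ) := by
      rw [h.sum_mul]
    push_cast at h1
    rw [← h1, Finset.sum_mul]
    exact Finset.sum_congr rfl fun v _ => by ring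
  simp [this]

/-- The expansion of a lattice vector in the basis `ℓ v`. -/
theorem IsDualBasis.eq_sum_int (h : IsDualBasis ℓ t d) (u : Fin n → ℤ) :
    u = ∑ v ∈ t, (d v ⬝ᵥ u) • ℓ v := by
  ext i
  rw [Finset.sum_apply]
  simp only [Pi.smul_apply, smul_eq_mul, dotProduct, Finset.sum_mul]
  rw [Finset.sum_comm]
  have : ∀ j, ∑ v ∈ t, d v j * u j * ℓ v i = (if i = j then 1 else 0) * u j := by
    intro j
    rw [← h.sum_mul, Finset.sum_mul]
    exact Finset.sum_congr rfl fun v _ => by ring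
  simp [this]

/-- The expansion of a lattice covector in the dual basis. -/
theorem IsDualBasis.eq_sum_dual (h : IsDualBasis ℓ t d) (m : Fin n → ℤ) :
    m = ∑ v ∈ t, (m ⬝ᵥ ℓ v) • d v := by
  ext i
  rw [Finset.sum_apply]
  simp only [Pi.smul_apply, smul_eq_mul, dotProduct, Finset.sum_mul]
  rw [Finset.sum_comm]
  have : ∀ j, ∑ v ∈ t, m j * ℓ v j * d v i = m j * (if j = i then 1 else 0) := by
    intro j
    rw [← h.sum_mul, Finset.mul_sum]
    exact Finset.sum_congr rfl fun v _ => by ring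
  simp [this]

theorem IsDualBasis.pair_sum_smul (h : IsDualBasis ℓ t d) {s : Finset V} (hs : s ⊆ t)
    (c : V → ℝ) {v : V} (hv : v ∈ t) :
    pair (d v) (∑ w ∈ s, c w • toReal (ℓ w)) = if v ∈ s then c v else 0 := by
  rw [pair_sum]
  have : ∀ w ∈ s, pair (d v) (c w • toReal (ℓ w)) = if v = w then c w else 0 := by
    intro w hw
    rw [pair_smul, pair_toReal, h.dot_eq v hv w (hs hw)]
    split <;> simp
  rw [Finset.sum_congr rfl this, Finset.sum_ite_eq]

theorem IsDualBasis.mem_coneOf_iff (h : IsDualBasis ℓ t d) {s : Finset V} (hs : s ⊆ t)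
    {x : Fin n → ℝ} :
    x ∈ coneOf (ℓ '' (s : Set V)) ↔
      (∀ v ∈ t, 0 ≤ pair (d v) x) ∧ ∀ v ∈ t, v ∉ s → pair (d v) x = 0 := by
  rw [mem_coneOf]
  constructor
  · rintro ⟨c, hc, rfl⟩
    refine ⟨fun v hv => ?_, fun v hv hvs => ?_⟩
    · rw [h.pair_sum_smul hs c hv]
      split
      · exact hc v
      · exact le_rfl
    · rw [h.pair_sum_smul hs c hv, if_neg hvs]
  · rintro ⟨h1, h2⟩
    refine ⟨fun v => if v ∈ s then pair (d v) x else 0, fun v => ?_, ?_⟩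
    · simp only
      split
      · exact h1 v (hs ‹_›)
      · exact le_rfl
    · conv_lhs => rw [h.eq_sum x]
      symm
      refine (Finset.sum_congr rfl fun v hv => by simp [hv]).trans (Finset.sum_subset hs ?_)
      intro v hv hvs
      rw [h2 v hv hvs, zero_smul]

/-- The subcone spanned by some of the generators of a unimodular cone is a face. -/
theorem IsDualBasis.isFaceOf (h : IsDualBasis ℓ t d) {s s' : Finset V} (hs : s ⊆ t)
    (hs' : s' ⊆ s) :
    (coneOf (ℓ '' (s' : Set V))).IsFaceOf (coneOf (ℓ '' (s : Set V))) := by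
  refine ⟨coneOf_mono (Set.image_mono (Finset.coe_subset.mpr hs')), ?_⟩
  intro x y a hx hy ha hxy
  rw [h.mem_coneOf_iff hs] at hx hy
  rw [h.mem_coneOf_iff (hs'.trans hs)] at hxy ⊢
  refine ⟨hx.1, fun v hv hvs => ?_⟩
  have h1 := hxy.2 v hv hvs
  rw [pair_add, pair_smul] at h1
  have h2 := hx.1 v hv
  have h3 := hy.1 v hv
  have h4 : a * pair (d v) x = 0 := by nlinarith [mul_nonneg ha.le h2]
  exact (mul_eq_zero.mp h4).resolve_left ha.ne'

theorem IsDualBasis.ne_zero (h : IsDualBasis ℓ t d) {v : V} (hv : v ∈ t) : toReal (ℓ v) ≠ 0 := by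
  intro h0
  have h1 := pair_toReal (d v) (ℓ v)
  rw [h0, h.dot_eq v hv v hv] at h1
  simp [pair] at h1

theorem IsDualBasis.salient (h : IsDualBasis ℓ t d) {s : Finset V} (hs : s ⊆ t) {x : Fin n → ℝ}
    (hx : x ∈ coneOf (ℓ '' (s : Set V))) (hx' : -x ∈ coneOf (ℓ '' (s : Set V))) : x = 0 := by
  rw [h.mem_coneOf_iff hs] at hx hx'
  rw [h.eq_sum x]
  refine Finset.sum_eq_zero fun v hv => ?_
  have h1 := hx.1 v hv
  have h2 := hx'.1 v hv
  rw [pair_neg] at h2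
  rw [show pair (d v) x = 0 by linarith, zero_smul]

/-- A basis of the lattice has a dual basis. -/
theorem exists_isDualBasis (hli : LinearIndependent ℤ (fun v : t => ℓ v))
    (hsp : Submodule.span ℤ (ℓ '' (t : Set V)) = ⊤) : ∃ d, IsDualBasis ℓ t d := by
  have hsp' : ⊤ ≤ Submodule.span ℤ (Set.range fun v : t => ℓ v) := by
    rw [← hsp]
    refine Submodule.span_mono ?_
    rintro _ ⟨v, hv, rfl⟩
    exact ⟨⟨v, hv⟩, rfl⟩
  let b := Module.Basis.mk hli hsp'
  have hcoord : ∀ (v : t) (u : Fin n → ℤ),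
      (fun i => b.coord v (Pi.single i 1)) ⬝ᵥ u = b.coord v u := by
    intro v u
    conv_rhs => rw [pi_eq_sum_univ' u]
    rw [map_sum]
    simp only [map_smul, smul_eq_mul, dotProduct]
    refine Finset.sum_congr rfl fun i _ => ?_
    rw [mul_comm]
  refine ⟨fun v => if hv : v ∈ t then fun i => b.coord ⟨v, hv⟩ (Pi.single i 1) else 0, ?_, ?_⟩
  · have h1 := Module.finrank_eq_card_basis b
    simpa using h1.symm
  · intro v hv w hw
    simp only [hv, dif_pos]
    rw [hcoord ⟨v, hv⟩ (ℓ w)]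
    have : ℓ w = b ⟨w, hw⟩ := by simp [b]
    rw [this, Module.Basis.coord_apply, Module.Basis.repr_self, Finsupp.single_apply]
    simp [eq_comm]

theorem IsDualBasis.linearIndependent (h : IsDualBasis ℓ t d) :
    LinearIndependent ℤ (fun v : t => ℓ v) := by
  rw [Fintype.linearIndependent_iff]
  intro g hg v
  have h1 : d v ⬝ᵥ ∑ w : t, g w • ℓ w = 0 := by rw [hg, dotProduct_zero]
  rw [dotProduct_sum] at h1
  have h2 : ∀ w : t, d v ⬝ᵥ (g w • ℓ w) = if v = w then g w else 0 := by
    intro w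
    rw [dotProduct_smul, h.dot_eq v v.2 w w.2]
    simp
  rw [Finset.sum_congr rfl fun w _ => h2 w] at h1
  simpa using h1

theorem IsDualBasis.span_eq_top (h : IsDualBasis ℓ t d) :
    Submodule.span ℤ (ℓ '' (t : Set V)) = ⊤ := by
  rw [eq_top_iff]
  intro u _
  rw [h.eq_sum_int u]
  exact Submodule.sum_mem _ fun v hv => Submodule.smul_mem _ _ (Submodule.subset_span ⟨v, hv, rfl⟩)

end Cones

end ToricNeighborly

namespace ToricNeighborly

/-! ### Unimodular fans -/

section UnimodularFans

variable {n : ℕ} {V : Type} [DecidableEq V]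

/-- `T` is the set of facets of the pure complex `K`. -/
structure HasFacets (K : AbstractSimplicialComplex V) (T : Finset (Finset V)) : Prop where
  nonempty : T.Nonempty
  nonempty_of_mem : ∀ t ∈ T, t.Nonempty
  mem_faces_iff : ∀ s : Finset V, s.Nonempty → (s ∈ K.faces ↔ ∃ t ∈ T, s ⊆ t)
  antichain : ∀ s ∈ T, ∀ t ∈ T, s ⊆ t → s = t

omit [DecidableEq V] in
theorem HasFacets.isFacet_iff {K : AbstractSimplicialComplex V} {T : Finset (Finset V)}
    (h : HasFacets K T) (s : Finset V) : IsFacet K s ↔ s ∈ T := by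
  constructor
  · rintro ⟨hs, hmax⟩
    obtain ⟨t, ht, hst⟩ := (h.mem_faces_iff s (K.isRelLowerSet_faces hs).1).mp hs
    have := hmax t ((h.mem_faces_iff t (h.nonempty_of_mem t ht)).mpr ⟨t, ht, le_rfl⟩) hst
    exact this ▸ ht
  · intro hs
    refine ⟨(h.mem_faces_iff s (h.nonempty_of_mem s hs)).mpr ⟨s, hs, le_rfl⟩, fun t ht hst => ?_⟩
    obtain ⟨t', ht', htt'⟩ := (h.mem_faces_iff t (K.isRelLowerSet_faces ht).1).mp ht
    have := h.antichain s hs t' ht' (hst.trans htt')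
    exact Finset.Subset.antisymm hst (this ▸ htt')

omit [DecidableEq V] in
theorem HasFacets.exists_mem {K : AbstractSimplicialComplex V} {T : Finset (Finset V)}
    (h : HasFacets K T) (v : V) : ∃ t ∈ T, v ∈ t := by
  obtain ⟨t, ht, hvt⟩ := (h.mem_faces_iff {v} (Finset.singleton_nonempty v)).mp (K.singleton_mem v)
  exact ⟨t, ht, hvt (Finset.mem_singleton_self v)⟩

/-- The vectors `ℓ v` of each member of `T` form a basis of the lattice, and the cones over the
members of `T` meet in the cones over the intersections. -/
structure IsUnimodularFan (T : Finset (Finset V)) (ℓ : V → Fin n → ℤ) : Prop where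
  nonempty : T.Nonempty
  exists_dual : ∀ t ∈ T, ∃ d, IsDualBasis ℓ t d
  inter : ∀ s ∈ T, ∀ t ∈ T,
    coneOf (ℓ '' (s : Set V)) ⊓ coneOf (ℓ '' (t : Set V)) ≤
      coneOf (ℓ '' ((s ∩ t : Finset V) : Set V))

variable {T : Finset (Finset V)} {ℓ : V → Fin n → ℤ}

theorem IsUnimodularFan.inf_eq (h : IsUnimodularFan T ℓ) {s t s' t' : Finset V} (hs : s ∈ T)
    (ht : t ∈ T) (hs' : s' ⊆ s) (ht' : t' ⊆ t) :
    coneOf (ℓ '' (s' : Set V)) ⊓ coneOf (ℓ '' (t' : Set V)) =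
      coneOf (ℓ '' ((s' ∩ t' : Finset V) : Set V)) := by
  refine le_antisymm ?_ (le_inf (coneOf_mono (Set.image_mono ?_)) (coneOf_mono (Set.image_mono ?_)))
  · rintro x ⟨hx1, hx2⟩
    have hx1 : x ∈ coneOf (ℓ '' (s' : Set V)) := hx1
    have hx2 : x ∈ coneOf (ℓ '' (t' : Set V)) := hx2
    have hx : x ∈ coneOf (ℓ '' ((s ∩ t : Finset V) : Set V)) :=
      h.inter s hs t ht ⟨coneOf_mono (Set.image_mono (Finset.coe_subset.mpr hs')) hx1,
        coneOf_mono (Set.image_mono (Finset.coe_subset.mpr ht')) hx2⟩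
    obtain ⟨d, hd⟩ := h.exists_dual s hs
    obtain ⟨e, he⟩ := h.exists_dual t ht
    -- the coefficients with respect to `s` and to `t` agree, as both are those of `s ∩ t`
    have hcoeff : ∀ v ∈ s ∩ t, pair (d v) x = pair (e v) x := by
      obtain ⟨c, hc, rfl⟩ := mem_coneOf.mp hx
      intro v hv
      rw [hd.pair_sum_smul Finset.inter_subset_left c (Finset.mem_inter.mp hv).1,
        he.pair_sum_smul Finset.inter_subset_right c (Finset.mem_inter.mp hv).2]
    have hdx := (hd.mem_coneOf_iff Finset.inter_subset_left).mp hx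
    refine (hd.mem_coneOf_iff (Finset.inter_subset_left.trans hs')).mpr ⟨hdx.1, fun v hv hvn => ?_⟩
    by_cases hvt : v ∈ t
    · by_cases hvs' : v ∈ s'
      · have hvt' : v ∉ t' := fun hvt' => hvn (Finset.mem_inter.mpr ⟨hvs', hvt'⟩)
        rw [hcoeff v (Finset.mem_inter.mpr ⟨hv, hvt⟩)]
        exact ((he.mem_coneOf_iff ht').mp hx2).2 v hvt hvt'
      · exact ((hd.mem_coneOf_iff hs').mp hx1).2 v hv hvs'
    · exact hdx.2 v hv fun hc => hvt (Finset.mem_inter.mp hc).2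
  · exact Finset.coe_subset.mpr Finset.inter_subset_left
  · exact Finset.coe_subset.mpr Finset.inter_subset_right

theorem IsUnimodularFan.mem_of_toReal_mem (h : IsUnimodularFan T ℓ) {s t t' : Finset V}
    (ht : t ∈ T) (hs : s ⊆ t) (ht' : t' ∈ T) {v : V} (hv : v ∈ t')
    (hmem : toReal (ℓ v) ∈ coneOf (ℓ '' (s : Set V))) : v ∈ s := by
  by_contra hvs
  have h1 := h.inf_eq ht' ht (Finset.singleton_subset_iff.mpr hv) hs
  have h2 : ({v} : Finset V) ∩ s = ∅ := by simp [hvs]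
  have h3 : toReal (ℓ v) ∈ coneOf (ℓ '' (({v} : Finset V) : Set V)) ⊓ coneOf (ℓ '' (s : Set V)) :=
    ⟨toReal_mem_coneOf ⟨v, by simp, rfl⟩, hmem⟩
  rw [h1, h2] at h3
  obtain ⟨d, hd⟩ := h.exists_dual t' ht'
  refine hd.ne_zero hv ?_
  simpa [coneOf] using h3

theorem IsUnimodularFan.subset_of_le (h : IsUnimodularFan T ℓ) {s t s' t' : Finset V}
    (ht : t ∈ T) (hs : s ⊆ t) (ht' : t' ∈ T) (hs' : s' ⊆ t')
    (hle : coneOf (ℓ '' (s' : Set V)) ≤ coneOf (ℓ '' (s : Set V))) : s' ⊆ s := fun v hv =>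
  h.mem_of_toReal_mem ht hs ht' (hs' hv) (hle (toReal_mem_coneOf ⟨v, hv, rfl⟩))

omit [DecidableEq V] in
theorem span_coneOf (s : Set V) : Submodule.span ℝ (coneOf (ℓ '' s) : Set (Fin n → ℝ)) =
    Submodule.span ℝ ((fun v => toReal (ℓ v)) '' s) := by
  rw [coneOf, ← Set.image_comp]
  refine le_antisymm (Submodule.span_le.mpr ?_) (Submodule.span_mono Submodule.subset_span)
  exact PointedCone.hull_le_span ℝ _

theorem IsDualBasis.linearIndependent_real {t : Finset V} {d : V → Fin n → ℤ}
    (h : IsDualBasis ℓ t d) : LinearIndependent ℝ (fun v : t => toReal (ℓ v)) := by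
  rw [Fintype.linearIndependent_iff]
  intro g hg v
  have h1 := h.pair_sum_smul subset_rfl (fun w => if hw : w ∈ t then g ⟨w, hw⟩ else 0) v.2
  have h2 : ∑ w ∈ t, (if hw : w ∈ t then g ⟨w, hw⟩ else 0) • toReal (ℓ w) = 0 := by
    rw [← Finset.sum_coe_sort, ← hg]
    exact Finset.sum_congr rfl fun w _ => by simp
  rw [h2] at h1
  simpa [pair] using h1.symm

theorem IsDualBasis.finrank_coneOf {t s : Finset V} {d : V → Fin n → ℤ}
    (h : IsDualBasis ℓ t d) (hs : s ⊆ t) :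
    Module.finrank ℝ (Submodule.span ℝ (coneOf (ℓ '' (s : Set V)) : Set (Fin n → ℝ))) = s.card := by
  rw [span_coneOf]
  have h1 : LinearIndependent ℝ (fun v : s => toReal (ℓ v)) :=
    h.linearIndependent_real.comp (fun v : s => (⟨v, hs v.2⟩ : t)) fun a b hab =>
      Subtype.ext (congrArg (fun x : t => (x : V)) hab)
  have h2 := finrank_span_eq_card h1
  rw [Set.image_eq_range]
  simpa using h2

/-- The lattice basis given by a member of a unimodular fan, indexed by `Fin n`. -/
theorem IsDualBasis.exists_basis {t s : Finset V} {d : V → Fin n → ℤ} (h : IsDualBasis ℓ t d)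
    (hs : s ⊆ t) :
    ∃ (b : Module.Basis (Fin n) ℤ (Fin n → ℤ)) (s' : Set (Fin n)), b '' s' = ℓ '' (s : Set V) := by
  let e : t ≃ Fin n := t.equivFinOfCardEq h.card_eq
  have hsp : ⊤ ≤ Submodule.span ℤ (Set.range fun v : t => ℓ v) := by
    rw [← h.span_eq_top, Set.image_eq_range]
    rfl
  refine ⟨(Module.Basis.mk h.linearIndependent hsp).reindex e, {i | (e.symm i : V) ∈ s}, ?_⟩
  ext u
  simp only [Set.mem_image, Set.mem_ofPred_eq, Module.Basis.reindex_apply, Module.Basis.mk_apply]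
  constructor
  · rintro ⟨i, hi, rfl⟩
    exact ⟨_, hi, rfl⟩
  · rintro ⟨v, hv, rfl⟩
    exact ⟨e ⟨v, hs hv⟩, by simpa using hv, by simp⟩

/-- The fan whose cones are spanned by the subsets of the members of `T`. -/
def IsUnimodularFan.fan (h : IsUnimodularFan T ℓ) : Fan n where
  cones := {σ | ∃ t ∈ T, ∃ s ⊆ t, σ = coneOf (ℓ '' (s : Set V))}
  finite := by
    refine ((T.biUnion Finset.powerset).finite_toSet.image
      fun s : Finset V => coneOf (ℓ '' (s : Set V))).subset ?_
    rintro _ ⟨t, ht, s, hs, rfl⟩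
    exact ⟨s, Finset.mem_biUnion.mpr ⟨t, ht, Finset.mem_powerset.mpr hs⟩, rfl⟩
  nonempty := by
    obtain ⟨t, ht⟩ := h.nonempty
    exact ⟨_, t, ht, t, subset_rfl, rfl⟩
  rational := by
    rintro _ ⟨t, ht, s, hs, rfl⟩
    exact ⟨_, s.finite_toSet.image ℓ, rfl⟩
  strongly_convex := by
    rintro _ ⟨t, ht, s, hs, rfl⟩ x hx hx'
    obtain ⟨d, hd⟩ := h.exists_dual t ht
    exact hd.salient hs hx hx'
  face_mem := by
    rintro _ ⟨t, ht, s, hs, rfl⟩ τ hτ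
    obtain ⟨s', hs', rfl⟩ := exists_of_isFaceOf_coneOf hτ
    exact ⟨t, ht, s', hs'.trans hs, rfl⟩
  inf_isFaceOf := by
    rintro _ ⟨t, ht, s, hs, rfl⟩ _ ⟨t', ht', s', hs', rfl⟩
    obtain ⟨d, hd⟩ := h.exists_dual t ht
    obtain ⟨d', hd'⟩ := h.exists_dual t' ht'
    rw [h.inf_eq ht ht' hs hs']
    exact ⟨hd.isFaceOf hs Finset.inter_subset_left, hd'.isFaceOf hs' Finset.inter_subset_right⟩

theorem IsUnimodularFan.isFanOf (h : IsUnimodularFan T ℓ) {K : AbstractSimplicialComplex V}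
    (hK : HasFacets K T) (hcomplete : ∀ x, ∃ t ∈ T, x ∈ coneOf (ℓ '' (t : Set V))) :
    IsFanOf K ℓ h.fan where
  characteristic s hs := by
    obtain ⟨d, hd⟩ := h.exists_dual s ((hK.isFacet_iff s).mp hs)
    exact ⟨hd.linearIndependent, hd.span_eq_top⟩
  complete x := by
    obtain ⟨t, ht, hx⟩ := hcomplete x
    exact ⟨_, ⟨t, ht, t, subset_rfl, rfl⟩, hx⟩
  nonsingular := by
    rintro _ ⟨t, ht, s, hs, rfl⟩
    obtain ⟨d, hd⟩ := h.exists_dual t ht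
    obtain ⟨b, s', hb⟩ := hd.exists_basis hs
    exact ⟨b, s', by rw [hb]⟩
  underlying := by
    have hsing : ∀ v, coneOf {ℓ v} = coneOf (ℓ '' (({v} : Finset V) : Set V)) := fun v => by simp
    refine ⟨⟨?_, ?_, ?_⟩, fun s hs => ?_⟩
    · intro v _
      obtain ⟨t, ht, hv⟩ := hK.exists_mem v
      obtain ⟨d, hd⟩ := h.exists_dual t ht
      have hvt := Finset.singleton_subset_iff.mpr hv
      simp only [hsing]
      exact ⟨⟨t, ht, {v}, hvt, rfl⟩, by rw [hd.finrank_coneOf hvt, Finset.card_singleton]⟩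
    · intro v _ w _ hvw
      obtain ⟨t, ht, hv⟩ := hK.exists_mem v
      obtain ⟨t', ht', hw⟩ := hK.exists_mem w
      simp only [hsing] at hvw
      have := h.subset_of_le ht' (Finset.singleton_subset_iff.mpr hw) ht
        (Finset.singleton_subset_iff.mpr hv) hvw.le
      simpa using this
    · rintro _ ⟨⟨t, ht, s, hs, rfl⟩, hrank⟩
      obtain ⟨d, hd⟩ := h.exists_dual t ht
      rw [hd.finrank_coneOf hs] at hrank
      obtain ⟨v, rfl⟩ := Finset.card_eq_one.mp hrank
      exact ⟨v, trivial, hsing v⟩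
    · rw [hK.mem_faces_iff s hs]
      constructor
      · rintro ⟨t, ht, hst⟩
        exact ⟨t, ht, s, hst, rfl⟩
      · rintro ⟨t, ht, s', hs', heq⟩
        refine ⟨t, ht, fun v hv => hs' ?_⟩
        obtain ⟨t', ht', hvt'⟩ := hK.exists_mem v
        exact h.mem_of_toReal_mem ht hs' ht' hvt' (heq ▸ toReal_mem_coneOf ⟨v, hv, rfl⟩)

theorem coneOf_singleton_mem_rays {F : Fan n} {W : Type} [DecidableEq W] {u : W → Fin n → ℤ}
    {t s : Finset W} {d : W → Fin n → ℤ} (hd : IsDualBasis u t d) (hs : s ⊆ t)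
    (hmem : coneOf (u '' (s : Set W)) ∈ F.cones) {w : W} (hw : w ∈ s) : coneOf {u w} ∈ F.rays := by
  have hsing : coneOf {u w} = coneOf (u '' (({w} : Finset W) : Set W)) := by simp
  rw [hsing]
  have hws := Finset.singleton_subset_iff.mpr hw
  exact ⟨F.face_mem _ hmem _ (hd.isFaceOf hs hws),
    by rw [hd.finrank_coneOf (hws.trans hs), Finset.card_singleton]⟩

/-- A non-singular fan with underlying complex `K` is a unimodular fan over the facets of `K`. -/
theorem IsFanOf.isUnimodularFan {K : AbstractSimplicialComplex V} {F : Fan n}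
    (hF : IsFanOf K ℓ F) (hK : HasFacets K T) : IsUnimodularFan T ℓ where
  nonempty := hK.nonempty
  exists_dual t ht := by
    obtain ⟨h1, h2⟩ := hF.characteristic t ((hK.isFacet_iff t).mpr ht)
    exact exists_isDualBasis h1 h2
  inter s hs t ht := by
    have hmem : ∀ t ∈ T, coneOf (ℓ '' (t : Set V)) ∈ F.cones := fun t ht =>
      (hF.underlying.2 t (hK.nonempty_of_mem t ht)).mp
        ((hK.isFacet_iff t).mpr ht).1
    have hdual : ∀ t ∈ T, ∃ d, IsDualBasis ℓ t d := fun t ht => by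
      obtain ⟨h1, h2⟩ := hF.characteristic t ((hK.isFacet_iff t).mpr ht)
      exact exists_isDualBasis h1 h2
    obtain ⟨d, hd⟩ := hdual s hs
    obtain ⟨e, he⟩ := hdual t ht
    have hface := F.inf_isFaceOf _ (hmem s hs) _ (hmem t ht)
    obtain ⟨s', hs', hs'eq⟩ := exists_of_isFaceOf_coneOf hface.1
    obtain ⟨t', ht', ht'eq⟩ := exists_of_isFaceOf_coneOf hface.2
    rw [hs'eq]
    refine coneOf_mono (Set.image_mono (Finset.coe_subset.mpr fun v hv => ?_))
    refine Finset.mem_inter.mpr ⟨hs' hv, ?_⟩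
    -- the ray of `v` is a face of the cone over `t'`, so it is the ray of some vertex of `t'`
    have h1 : (coneOf (ℓ '' (({v} : Finset V) : Set V))).IsFaceOf (coneOf (ℓ '' (t' : Set V))) := by
      rw [← ht'eq, hs'eq]
      exact hd.isFaceOf hs' (Finset.singleton_subset_iff.mpr hv)
    obtain ⟨t'', ht'', heq⟩ := exists_of_isFaceOf_coneOf h1
    have hcard : t''.card = 1 := by
      rw [← he.finrank_coneOf (ht''.trans ht'), ← heq,
        hd.finrank_coneOf (Finset.singleton_subset_iff.mpr (hs' hv)), Finset.card_singleton]
    obtain ⟨w, rfl⟩ := Finset.card_eq_one.mp hcard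
    have hvw : v = w := hF.underlying.1.2.1 (Set.mem_univ v) (Set.mem_univ w) (by simpa using heq)
    rw [hvw]
    exact ht' (ht'' (Finset.mem_singleton_self w))

/-- The cones of a non-singular fan with underlying complex `K` are the cones over the faces of
`K` (including the empty face). -/
theorem IsFanOf.exists_eq_coneOf {K : AbstractSimplicialComplex V} {F : Fan n}
    (hF : IsFanOf K ℓ F) (hK : HasFacets K T) {σ : PointedCone ℝ (Fin n → ℝ)} (hσ : σ ∈ F.cones) :
    ∃ t ∈ T, ∃ s ⊆ t, σ = coneOf (ℓ '' (s : Set V)) := by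
  classical
  obtain ⟨b, s0, rfl⟩ := hF.nonsingular σ hσ
  obtain ⟨d, hd⟩ : ∃ d, IsDualBasis b (Finset.univ : Finset (Fin n)) d := by
    refine exists_isDualBasis ?_ ?_
    · exact b.linearIndependent.comp _ Subtype.val_injective
    · simp [b.span_eq]
  have hray : ∀ i ∈ s0, ∃ v, coneOf {ℓ v} = coneOf {b i} := by
    intro i hi
    have := coneOf_singleton_mem_rays hd (Finset.subset_univ s0.toFinset)
      (by simpa using hσ) (by simpa using hi)
    obtain ⟨v, -, hv⟩ := hF.underlying.1.2.2 this
    exact ⟨v, hv⟩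
  choose f hf using hray
  let s : Finset V := Finset.univ.image fun i : s0 => f i i.2
  have hs : coneOf (b '' s0) = coneOf (ℓ '' (s : Set V)) := by
    refine le_antisymm (Submodule.span_le.mpr ?_) (Submodule.span_le.mpr ?_)
    · rintro _ ⟨_, ⟨i, hi, rfl⟩, rfl⟩
      have h1 : toReal (b i) ∈ coneOf {b i} := toReal_mem_coneOf rfl
      rw [← hf i hi] at h1
      refine coneOf_mono ?_ h1
      rw [Set.singleton_subset_iff]
      exact ⟨f i hi, by simpa [s] using ⟨i, hi, rfl⟩, rfl⟩
    · rintro _ ⟨_, ⟨v, hv, rfl⟩, rfl⟩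
      obtain ⟨⟨i, hi⟩, -, rfl⟩ := Finset.mem_image.mp (Finset.mem_coe.mp hv)
      have h1 : toReal (ℓ (f i hi)) ∈ coneOf {ℓ (f i hi)} := toReal_mem_coneOf rfl
      rw [hf i hi] at h1
      refine coneOf_mono ?_ h1
      rw [Set.singleton_subset_iff]
      exact ⟨i, hi, rfl⟩
  rcases s.eq_empty_or_nonempty with h0 | h0
  · obtain ⟨t, ht⟩ := hK.nonempty
    exact ⟨t, ht, ∅, Finset.empty_subset t, by rw [hs, h0]⟩
  · obtain ⟨t, ht, hst⟩ := (hK.mem_faces_iff s h0).mp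
      ((hF.underlying.2 s h0).mpr (hs ▸ hσ))
    exact ⟨t, ht, s, hst, hs⟩

theorem IsFanOf.coneOf_mem {K : AbstractSimplicialComplex V} {F : Fan n}
    (hF : IsFanOf K ℓ F) (hK : HasFacets K T) {s t : Finset V} (ht : t ∈ T) (hs : s ⊆ t) :
    coneOf (ℓ '' (s : Set V)) ∈ F.cones := by
  obtain ⟨d, hd⟩ := (hF.isUnimodularFan hK).exists_dual t ht
  exact F.face_mem _ ((hF.underlying.2 t (hK.nonempty_of_mem t ht)).mp
    ((hK.isFacet_iff t).mpr ht).1) _ (hd.isFaceOf subset_rfl hs)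

end UnimodularFans

end ToricNeighborly

namespace ToricNeighborly

/-! ### Completeness from the facet adjacencies -/

section Completeness

open Filter Topology

variable {n : ℕ} {V : Type} [DecidableEq V]

/-- The functionals `d v`, `v ∈ t`, are positive multiples of the dual basis of the vectors `u v`
of `t`, and across each wall `t \ {v}` there is another member of `T`, on the far side. -/
structure HasNeighbors (T : Finset (Finset V)) (u : V → Fin n → ℝ) (t : Finset V)
    (d : V → Module.Dual ℝ (Fin n → ℝ)) : Prop where
  card_eq : t.card = n
  pos : ∀ v ∈ t, 0 < d v (u v)
  eq_zero : ∀ v ∈ t, ∀ w ∈ t, v ≠ w → d v (u w) = 0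
  neighbor : ∀ v ∈ t, ∃ v' ∉ t, insert v' (t.erase v) ∈ T ∧ d v (u v') < 0

variable {T : Finset (Finset V)} {u : V → Fin n → ℝ} {t : Finset V}
  {d : V → Module.Dual ℝ (Fin n → ℝ)}

theorem HasNeighbors.apply_sum (h : HasNeighbors T u t d) (c : V → ℝ) {v : V} (hv : v ∈ t) :
    d v (∑ w ∈ t, c w • u w) = c v * d v (u v) := by
  rw [map_sum, Finset.sum_eq_single_of_mem v hv]
  · simp
  · intro w hw hwv
    simp [h.eq_zero v hv w hw hwv.symm]

theorem HasNeighbors.eq_sum (h : HasNeighbors T u t d) (x : Fin n → ℝ) :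
    x = ∑ v ∈ t, (d v x / d v (u v)) • u v := by
  have hli : LinearIndependent ℝ (fun v : t => u v) := by
    rw [Fintype.linearIndependent_iff]
    intro g hg v
    have h1 := h.apply_sum (fun w => if hw : w ∈ t then g ⟨w, hw⟩ else 0) v.2
    have h2 : ∑ w ∈ t, (if hw : w ∈ t then g ⟨w, hw⟩ else 0) • u w = 0 := by
      rw [← Finset.sum_coe_sort, ← hg]
      exact Finset.sum_congr rfl fun w _ => by simp
    rw [h2] at h1
    simpa [(h.pos v v.2).ne'] using h1
  have hsp : Submodule.span ℝ (Set.range fun v : t => u v) = ⊤ :=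
    hli.span_eq_top_of_card_eq_finrank' (by simp [h.card_eq])
  have hx : x ∈ Submodule.span ℝ (Set.range fun v : t => u v) := hsp ▸ Submodule.mem_top
  obtain ⟨c, hc⟩ := (Submodule.mem_span_range_iff_exists_fun ℝ).mp hx
  have h1 : x = ∑ w ∈ t, (if hw : w ∈ t then c ⟨w, hw⟩ else 0) • u w := by
    rw [← Finset.sum_coe_sort, ← hc]
    exact Finset.sum_congr rfl fun w _ => by simp
  conv_lhs => rw [h1]
  refine Finset.sum_congr rfl fun v hv => ?_
  conv_rhs => rw [h1, h.apply_sum _ hv]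
  rw [mul_div_cancel_right₀ _ (h.pos v hv).ne']

theorem HasNeighbors.exists_nonneg_iff (h : HasNeighbors T u t d) (x : Fin n → ℝ) :
    (∃ c : V → ℝ, (∀ v, 0 ≤ c v) ∧ x = ∑ v ∈ t, c v • u v) ↔ ∀ v ∈ t, 0 ≤ d v x := by
  constructor
  · rintro ⟨c, hc, rfl⟩ v hv
    rw [h.apply_sum c hv]
    exact mul_nonneg (hc v) (h.pos v hv).le
  · intro hx
    refine ⟨fun v => if v ∈ t then d v x / d v (u v) else 0, fun v => ?_, ?_⟩
    · simp only
      split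
      · exact div_nonneg (hx v ‹_›) (h.pos v ‹_›).le
      · exact le_rfl
    · conv_lhs => rw [h.eq_sum x]
      exact Finset.sum_congr rfl fun v hv => by simp [hv]

theorem eventually_add_mul_nonneg {a b : ℝ} (h : 0 < a ∨ (0 ≤ a ∧ 0 ≤ b)) :
    ∀ᶠ ε in 𝓝[>] (0 : ℝ), 0 ≤ a + ε * b := by
  rcases h with h | ⟨h1, h2⟩
  · have : Tendsto (fun ε : ℝ => a + ε * b) (𝓝[>] 0) (𝓝 (a + 0 * b)) :=
      ((continuous_const.add (continuous_id.mul continuous_const)).tendsto 0).mono_left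
        nhdsWithin_le_nhds
    have h3 := this.eventually (lt_mem_nhds (by simpa using h : 0 < a + 0 * b))
    exact h3.mono fun _ => le_of_lt
  · filter_upwards [self_mem_nhdsWithin] with ε hε
    have hε : 0 < ε := hε
    positivity

/-- A point of the cone over `t`, on at most one wall of it, can be moved a little in any given
direction inside the cone over `t` or inside a neighboring cone. -/
theorem HasNeighbors.eventually_mem (h : HasNeighbors T u t d) (ht : t ∈ T) {x : Fin n → ℝ}
    (hx : ∀ v ∈ t, 0 ≤ d v x) (hx' : ∀ v ∈ t, ∀ w ∈ t, v ≠ w → ¬ (d v x = 0 ∧ d w x = 0))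
    (δ : Fin n → ℝ) :
    ∀ᶠ ε in 𝓝[>] (0 : ℝ), ∃ t ∈ T, ∃ c : V → ℝ, (∀ v, 0 ≤ c v) ∧
      x + ε • δ = ∑ v ∈ t, c v • u v := by
  by_cases hδ : ∀ v ∈ t, d v x = 0 → 0 ≤ d v δ
  · have h1 : ∀ᶠ ε in 𝓝[>] (0 : ℝ), ∀ v ∈ t, 0 ≤ d v x + ε * d v δ := by
      rw [Filter.eventually_all_finset]
      intro v hv
      refine eventually_add_mul_nonneg ?_
      rcases (hx v hv).eq_or_lt with h0 | h0
      · exact Or.inr ⟨hx v hv, hδ v hv h0.symm⟩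
      · exact Or.inl h0
    filter_upwards [h1] with ε hε
    exact ⟨t, ht, (h.exists_nonneg_iff _).mpr fun v hv => by simpa using hε v hv⟩
  · push Not at hδ
    obtain ⟨v, hv, hv0, hvδ⟩ := hδ
    obtain ⟨v', hv't, ht', hneg⟩ := h.neighbor v hv
    have hrat : 0 < d v δ / d v (u v') := div_pos_of_neg_of_neg hvδ hneg
    -- `δ'` is the component of `δ` along the wall
    set δ' := δ - (d v δ / d v (u v')) • u v' with hδ'
    have hδ'0 : d v δ' = 0 := by
      simp only [hδ', map_sub, map_smul, smul_eq_mul]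
      rw [div_mul_cancel₀ _ hneg.ne, sub_self]
    have h1 : ∀ᶠ ε in 𝓝[>] (0 : ℝ), ∀ w ∈ t.erase v, 0 ≤ d w x + ε * d w δ' := by
      rw [Filter.eventually_all_finset]
      intro w hw
      obtain ⟨hwv, hwt⟩ := Finset.mem_erase.mp hw
      refine eventually_add_mul_nonneg (Or.inl ((hx w hwt).lt_of_ne fun h0 => ?_))
      exact hx' v hv w hwt hwv.symm ⟨hv0, h0.symm⟩
    filter_upwards [h1, self_mem_nhdsWithin] with ε hε hε0
    have hε0 : 0 < ε := hε0
    refine ⟨_, ht', fun w => if w = v' then ε * (d v δ / d v (u v')) else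
      if w ∈ t.erase v then d w (x + ε • δ') / d w (u w) else 0, fun w => ?_, ?_⟩
    · simp only
      split
      · positivity
      · split
        · refine div_nonneg ?_ (h.pos w (Finset.mem_of_mem_erase ‹_›)).le
          simpa using hε w ‹_›
        · exact le_rfl
    · have hv'e : v' ∉ t.erase v := fun hh => hv't (Finset.mem_of_mem_erase hh)
      rw [Finset.sum_insert hv'e]
      have h2 : ∑ w ∈ t.erase v, (if w = v' then ε * (d v δ / d v (u v')) else
          if w ∈ t.erase v then d w (x + ε • δ') / d w (u w) else 0) • u w = x + ε • δ' := by
        conv_rhs => rw [h.eq_sum (x + ε • δ')]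
        rw [← Finset.add_sum_erase t _ hv]
        have h3 : d v (x + ε • δ') = 0 := by simp [hv0, hδ'0]
        rw [h3, zero_div, zero_smul, zero_add]
        refine Finset.sum_congr rfl fun w hw => ?_
        rw [if_neg (fun hh : w = v' => hv'e (hh ▸ hw)), if_pos hw]
      rw [h2]
      simp only [if_true, hδ']
      module

/-- Cones that continue each other across every wall cover the space. A segment from an interior
point of one of the cones to a generic point meets the walls one at a time, and so never leaves the
union of the cones. -/
theorem exists_mem_cone (hT : T.Nonempty) (h : ∀ t ∈ T, ∃ d, HasNeighbors T u t d)
    (y : Fin n → ℝ) : ∃ t ∈ T, ∃ c : V → ℝ, (∀ v, 0 ≤ c v) ∧ y = ∑ v ∈ t, c v • u v := by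
  choose! d hd using h
  let C : Set (Fin n → ℝ) := {y | ∃ t ∈ T, ∃ c : V → ℝ, (∀ v, 0 ≤ c v) ∧ y = ∑ v ∈ t, c v • u v}
  have hC : C = ⋃ t ∈ T, ⋂ v ∈ t, {y | 0 ≤ d t v y} := by
    ext y
    simp only [C, Set.mem_ofPred_eq, Set.mem_iUnion, Set.mem_iInter, exists_prop]
    exact exists_congr fun t => and_congr_right fun ht => (hd t ht).exists_nonneg_iff y
  have hCclosed : IsClosed C := by
    rw [hC]
    refine Set.Finite.isClosed_biUnion T.finite_toSet fun t _ => ?_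
    refine isClosed_biInter fun v _ => isClosed_le continuous_const ?_
    exact LinearMap.continuous_of_finiteDimensional _
  by_contra hy
  change y ∉ C at hy
  obtain ⟨t₀, ht₀⟩ := hT
  let x := ∑ v ∈ t₀, (1 : ℝ) • u v
  have hx : ∀ v ∈ t₀, 0 < d t₀ v x := fun v hv => by
    rw [(hd t₀ ht₀).apply_sum (fun _ => 1) hv, one_mul]
    exact (hd t₀ ht₀).pos v hv
  -- a point `y` off the kernel of `g` makes the segment from `x` to `y` avoid a codimension-two
  -- face of the cone over `t`
  have hg : ∀ t ∈ T, ∀ v ∈ t, ∀ w ∈ t, v ≠ w → ∃ g : Module.Dual ℝ (Fin n → ℝ), g ≠ 0 ∧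
      ∀ y, g y ≠ 0 → ∀ s : ℝ, 0 < s →
        ¬ (d t v (x + s • (y - x)) = 0 ∧ d t w (x + s • (y - x)) = 0) := by
    intro t ht v hv w hw hvw
    by_cases h0 : d t v x = 0 ∧ d t w x = 0
    · refine ⟨d t v, fun hh => ?_, fun y hy s hs hh => hy ?_⟩
      · simpa [hh] using (hd t ht).pos v hv
      · have := hh.1
        simp only [map_add, map_smul, map_sub, h0.1, smul_eq_mul] at this
        simpa [hs.ne'] using this
    · refine ⟨d t w x • d t v - d t v x • d t w, fun hh => h0 ⟨?_, ?_⟩, fun y hy s hs hh => hy ?_⟩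
      · have := DFunLike.congr_fun hh (u w)
        simpa [(hd t ht).eq_zero v hv w hw hvw, ((hd t ht).pos w hw).ne'] using this
      · have := DFunLike.congr_fun hh (u v)
        simpa [(hd t ht).eq_zero w hw v hv hvw.symm, ((hd t ht).pos v hv).ne'] using this
      · obtain ⟨h1, h2⟩ := hh
        simp only [map_add, map_smul, map_sub, smul_eq_mul] at h1 h2
        simp only [LinearMap.sub_apply, LinearMap.smul_apply, smul_eq_mul]
        refine (mul_eq_zero.mp (?_ : s * _ = 0)).resolve_left hs.ne'
        linear_combination (d t w x) * h1 - (d t v x) * h2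
  choose! g hg0 hg using hg
  obtain ⟨y', hy'C, hy'⟩ : ∃ y' ∉ C, ∀ t ∈ T, ∀ v ∈ t, ∀ w ∈ t, v ≠ w → g t v w y' ≠ 0 := by
    by_contra hcon
    push Not at hcon
    have hsub : Cᶜ ⊆ ⋃ t ∈ T, ⋃ v ∈ t, ⋃ w ∈ t, ⋃ (_ : v ≠ w),
        ((LinearMap.ker (g t v w) : Submodule ℝ (Fin n → ℝ)) : Set (Fin n → ℝ)) := by
      intro z hz
      obtain ⟨t, ht, v, hv, w, hw, hvw, h0⟩ := hcon z hz
      simp only [Set.mem_iUnion]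
      exact ⟨t, ht, v, hv, w, hw, hvw, h0⟩
    have hnull : MeasureTheory.volume (⋃ t ∈ T, ⋃ v ∈ t, ⋃ w ∈ t, ⋃ (_ : v ≠ w),
        ((LinearMap.ker (g t v w) : Submodule ℝ (Fin n → ℝ)) : Set (Fin n → ℝ))) = 0 := by
      refine (MeasureTheory.measure_biUnion_null_iff T.countable_toSet).mpr fun t ht => ?_
      refine (MeasureTheory.measure_biUnion_null_iff t.countable_toSet).mpr fun v hv => ?_
      refine (MeasureTheory.measure_biUnion_null_iff t.countable_toSet).mpr fun w hw => ?_
      refine MeasureTheory.measure_iUnion_null_iff.mpr fun hvw => ?_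
      refine MeasureTheory.Measure.addHaar_submodule _ _ fun hk => ?_
      exact hg0 t ht v hv w hw hvw (LinearMap.ker_eq_top.mp hk)
    have hpos := hCclosed.isOpen_compl.measure_pos MeasureTheory.volume ⟨y, hy⟩
    exact hpos.ne' (le_antisymm (hnull ▸ MeasureTheory.measure_mono hsub) bot_le)
  have hcont : Continuous fun s : ℝ => x + s • (y' - x) := by fun_prop
  have hseg : Set.Icc (0 : ℝ) 1 ⊆ {s | x + s • (y' - x) ∈ C} := by
    refine IsClosed.Icc_subset_of_forall_exists_gt
      ((hCclosed.preimage hcont).inter isClosed_Icc) ?_ ?_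
    · exact ⟨t₀, ht₀, fun _ => 1, fun _ => zero_le_one, by simp [x]⟩
    · rintro s ⟨hs, hs0, hs1⟩ s' hs'
      have hmove : ∀ᶠ ε in 𝓝[>] (0 : ℝ), (x + s • (y' - x)) + ε • (y' - x) ∈ C := by
        rcases hs0.eq_or_lt with rfl | hs0
        · refine (hd t₀ ht₀).eventually_mem ht₀ ?_ ?_ _
          · intro v hv
            simpa using (hx v hv).le
          · rintro v hv w hw - ⟨h1, -⟩
            exact (hx v hv).ne' (by simpa using h1)
        · obtain ⟨t, ht, hc⟩ := hs
          refine (hd t ht).eventually_mem ht (((hd t ht).exists_nonneg_iff _).mp hc) ?_ _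
          intro v hv w hw hvw
          exact hg t ht v hv w hw hvw y' (hy' t ht v hv w hw hvw) s hs0
      have hlt : ∀ᶠ ε in 𝓝[>] (0 : ℝ), ε < s' - s :=
        nhdsWithin_le_nhds (Iio_mem_nhds (sub_pos.mpr hs'))
      obtain ⟨ε, ⟨hε, hε'⟩, hε0⟩ := ((hmove.and hlt).and self_mem_nhdsWithin).exists
      have hε0 : 0 < ε := hε0
      refine ⟨s + ε, ?_, by linarith, by linarith⟩
      change x + (s + ε) • (y' - x) ∈ C
      rwa [add_smul, ← add_assoc]
  have := hseg (Set.right_mem_Icc.mpr zero_le_one)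
  change x + (1 : ℝ) • (y' - x) ∈ C at this
  rw [one_smul, add_sub_cancel] at this
  exact hy'C this

end Completeness

end ToricNeighborly

namespace ToricNeighborly
open CategoryTheory AlgebraicGeometry

/-! ### Gluing the affine toric varieties -/

section Gluing

open Limits

variable {n : ℕ} {V : Type}

theorem isLocalization_away_mapDomain {G : Type} [AddCommGroup G] {M M' : AddSubmonoid G}
    (h : M ≤ M') (m : M) (hneg : -(m : G) ∈ M') (hm : ∀ x ∈ M', ∃ k : ℕ, x + k • (m : G) ∈ M) :
    let := (AddMonoidAlgebra.mapDomainRingHom ℂ (AddSubmonoid.inclusion h)).toAlgebra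
    IsLocalization.Away (AddMonoidAlgebra.single m (1 : ℂ)) (AddMonoidAlgebra ℂ M') := by
  let := (AddMonoidAlgebra.mapDomainRingHom ℂ (AddSubmonoid.inclusion h)).toAlgebra
  have hmap : ∀ x : AddMonoidAlgebra ℂ M, algebraMap _ (AddMonoidAlgebra ℂ M') x =
      AddMonoidAlgebra.mapDomain (AddSubmonoid.inclusion h) x := fun x => rfl
  refine IsLocalization.Away.mk _ ?_ ?_ ?_
  · refine IsUnit.of_mul_eq_one (AddMonoidAlgebra.single ⟨-(m : G), hneg⟩ 1) ?_
    rw [hmap, AddMonoidAlgebra.mapDomain_single, AddMonoidAlgebra.single_mul_single,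
      AddMonoidAlgebra.one_def, one_mul]
    congr 1
    ext
    simp
  · intro s
    have hpow : ∀ k, algebraMap _ (AddMonoidAlgebra ℂ M') (AddMonoidAlgebra.single m (1 : ℂ)) ^ k =
        algebraMap _ (AddMonoidAlgebra ℂ M') (AddMonoidAlgebra.single m (1 : ℂ) ^ k) := fun k =>
      (map_pow _ _ _).symm
    induction s using AddMonoidAlgebra.induction_linear with
    | zero => exact ⟨0, 0, by simp⟩
    | add x y hx hy =>
      obtain ⟨k, a, ha⟩ := hx
      obtain ⟨k', a', ha'⟩ := hy
      refine ⟨k + k', a * AddMonoidAlgebra.single m 1 ^ k' +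
        a' * AddMonoidAlgebra.single m 1 ^ k, ?_⟩
      rw [map_add, map_mul, map_mul, ← ha, ← ha', ← hpow, ← hpow]
      ring
    | single x r =>
      obtain ⟨k, hk⟩ := hm x x.2
      refine ⟨k, AddMonoidAlgebra.single ⟨_, hk⟩ r, ?_⟩
      rw [hpow, AddMonoidAlgebra.single_pow, hmap, hmap, AddMonoidAlgebra.mapDomain_single,
        AddMonoidAlgebra.mapDomain_single, AddMonoidAlgebra.single_mul_single, one_pow, mul_one]
      rfl
  · intro a b hab
    rw [hmap, hmap] at hab
    exact ⟨0, by rw [AddMonoidAlgebra.mapDomain_injective (AddSubmonoid.inclusion_injective h) hab]⟩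

/-- Passing to a face of a cone inverts the monomial of a supporting covector. -/
theorem isLocalization_away_single {ℓ : V → Fin n → ℤ} {s s' : Finset V}
    (h : coneOf (ℓ '' (s' : Set V)) ≤ coneOf (ℓ '' (s : Set V)))
    (m : dualMonoid (coneOf (ℓ '' (s : Set V))))
    (h0 : ∀ v ∈ s', (m : Fin n → ℤ) ⬝ᵥ ℓ v = 0)
    (hpos : ∀ v ∈ s, v ∉ s' → 0 < (m : Fin n → ℤ) ⬝ᵥ ℓ v) :
    let _ := (AddMonoidAlgebra.mapDomainRingHom ℂ
      (AddSubmonoid.inclusion (dualMonoid_anti h))).toAlgebra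
    IsLocalization.Away (AddMonoidAlgebra.single m (1 : ℂ))
      (coordRing (coneOf (ℓ '' (s' : Set V)))) := by
  classical
  refine isLocalization_away_mapDomain (dualMonoid_anti h) m ?_ ?_
  · rw [mem_dualMonoid_coneOf]
    intro v hv
    rw [neg_dotProduct, h0 v hv, neg_zero]
  · intro x hx
    rw [mem_dualMonoid_coneOf] at hx
    refine ⟨∑ v ∈ s, (x ⬝ᵥ ℓ v).natAbs, mem_dualMonoid_coneOf.mpr fun v hv => ?_⟩
    have h1 : (x ⬝ᵥ ℓ v).natAbs ≤ ∑ v ∈ s, (x ⬝ᵥ ℓ v).natAbs :=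
      Finset.single_le_sum (f := fun v => (x ⬝ᵥ ℓ v).natAbs) (fun _ _ => Nat.zero_le _) hv
    rw [add_dotProduct, smul_dotProduct]
    by_cases hvs : v ∈ s'
    · rw [h0 v hvs]
      simpa using hx v hvs
    · have h2 := hpos v hv hvs
      have h3 : -(x ⬝ᵥ ℓ v) ≤ ((∑ v ∈ s, (x ⬝ᵥ ℓ v).natAbs : ℕ) : ℤ) := by omega
      rw [nsmul_eq_mul]
      nlinarith [Int.natCast_nonneg (∑ v ∈ s, (x ⬝ᵥ ℓ v).natAbs)]

/-- The inclusion of the affine toric variety of a face is an open immersion onto the locus where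
the monomial of a supporting covector is invertible. -/
theorem isOpenImmersion_affineToricMap {ℓ : V → Fin n → ℤ} {s s' : Finset V}
    (h : coneOf (ℓ '' (s' : Set V)) ≤ coneOf (ℓ '' (s : Set V)))
    (m : dualMonoid (coneOf (ℓ '' (s : Set V))))
    (h0 : ∀ v ∈ s', (m : Fin n → ℤ) ⬝ᵥ ℓ v = 0)
    (hpos : ∀ v ∈ s, v ∉ s' → 0 < (m : Fin n → ℤ) ⬝ᵥ ℓ v) :
    IsOpenImmersion (affineToricMap h) ∧ Set.range (affineToricMap h) =
      (PrimeSpectrum.basicOpen (AddMonoidAlgebra.single m (1 : ℂ)) :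
        Set (PrimeSpectrum (coordRing (coneOf (ℓ '' (s : Set V)))))) := by
  have hloc := isLocalization_away_single h m h0 hpos
  let _ := (AddMonoidAlgebra.mapDomainRingHom ℂ
    (AddSubmonoid.inclusion (dualMonoid_anti h))).toAlgebra
  exact ⟨IsOpenImmersion.of_isLocalization (AddMonoidAlgebra.single m (1 : ℂ)),
    PrimeSpectrum.localization_away_comap_range _ (AddMonoidAlgebra.single m (1 : ℂ))⟩

theorem affineToricMap_refl (σ : PointedCone ℝ (Fin n → ℝ)) (h : σ ≤ σ) :
    affineToricMap h = 𝟙 _ := by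
  rw [affineToricMap, ← Spec.map_id]
  congr 1
  refine CommRingCat.hom_ext (AddMonoidAlgebra.ringHom_ext (fun r => ?_) fun m => ?_) <;>
    exact AddMonoidAlgebra.mapDomain_single

theorem affineToricMap_comp {σ τ ρ : PointedCone ℝ (Fin n → ℝ)} (h : τ ≤ σ) (h' : ρ ≤ τ) :
    affineToricMap h' ≫ affineToricMap h = affineToricMap (h'.trans h) := by
  rw [affineToricMap, affineToricMap, affineToricMap, ← Spec.map_comp]
  congr 1
  refine CommRingCat.hom_ext (AddMonoidAlgebra.ringHom_ext (fun r => by simp) fun m => ?_)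
  simp only [CommRingCat.hom_comp, CommRingCat.hom_ofHom, RingHom.comp_apply,
    AddMonoidAlgebra.mapDomainRingHom_apply, AddMonoidAlgebra.mapDomain_single]
  rfl

theorem affineToricMap_str {σ τ : PointedCone ℝ (Fin n → ℝ)} (h : τ ≤ σ) :
    affineToricMap h ≫ affineToricStr σ = affineToricStr τ := by
  rw [affineToricMap, affineToricStr, affineToricStr, ← Spec.map_comp]
  congr 1
  ext x : 2
  change AddMonoidAlgebra.mapDomain _ (algebraMap ℂ _ x) = algebraMap ℂ _ x
  rw [AddMonoidAlgebra.coe_algebraMap, AddMonoidAlgebra.coe_algebraMap]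
  exact AddMonoidAlgebra.mapDomain_single

theorem range_affineToricMap_congr {σ τ τ' : PointedCone ℝ (Fin n → ℝ)} (e : τ = τ') (h : τ ≤ σ)
    (h' : τ' ≤ σ) : Set.range (affineToricMap h) = Set.range (affineToricMap h') := by
  subst e
  rfl

theorem hom_apply_hom_apply {X Y Z : Scheme.{0}} {f : X ⟶ Y} {g : Y ⟶ Z} {h : X ⟶ Z}
    (e : f ≫ g = h) (x : X) : g (f x) = h x := by
  rw [← e, Scheme.Hom.comp_apply]

/-- The diagram of the affine toric varieties of the cones of a fan. -/
noncomputable def affineToricFunctor (F : Fan n) : F.cones ⥤ Scheme.{0} where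
  obj σ := affineToric σ.1
  map f := affineToricMap f.le
  map_id σ := affineToricMap_refl σ.1 _
  map_comp _ _ := (affineToricMap_comp _ _).symm

variable [DecidableEq V]

theorem IsDualBasis.exists_supporting {ℓ d : V → Fin n → ℤ} {t s : Finset V}
    (h : IsDualBasis ℓ t d) (hs : s ⊆ t) :
    ∃ m : Fin n → ℤ, (∀ v ∈ s, m ⬝ᵥ ℓ v = 0) ∧ ∀ v ∈ t, v ∉ s → m ⬝ᵥ ℓ v = 1 := by
  have key : ∀ v ∈ t, (∑ w ∈ t \ s, d w) ⬝ᵥ ℓ v = if v ∈ s then 0 else 1 := by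
    intro v hv
    rw [sum_dotProduct, Finset.sum_congr rfl fun w hw =>
      h.dot_eq w (Finset.mem_sdiff.mp hw).1 v hv, Finset.sum_ite_eq']
    simp [hv]
  refine ⟨∑ w ∈ t \ s, d w, fun v hv => ?_, fun v hv hvs => ?_⟩
  · rw [key v (hs hv), if_pos hv]
  · rw [key v hv, if_neg hvs]

variable {T : Finset (Finset V)} {ℓ : V → Fin n → ℤ}

/-- Data exhibiting a cone of a unimodular fan as a face of another one. -/
theorem IsUnimodularFan.exists_supporting (h : IsUnimodularFan T ℓ)
    {σ τ : PointedCone ℝ (Fin n → ℝ)} (hσ : ∃ t ∈ T, ∃ s ⊆ t, σ = coneOf (ℓ '' (s : Set V)))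
    (hτ : ∃ t ∈ T, ∃ s ⊆ t, τ = coneOf (ℓ '' (s : Set V))) (hle : τ ≤ σ) :
    ∃ m : dualMonoid σ, IsOpenImmersion (affineToricMap hle) ∧ Set.range (affineToricMap hle) =
      (PrimeSpectrum.basicOpen (AddMonoidAlgebra.single m (1 : ℂ)) :
        Set (PrimeSpectrum (coordRing σ))) := by
  obtain ⟨t, ht, s, hs, rfl⟩ := hσ
  obtain ⟨t', ht', s', hs', rfl⟩ := hτ
  have hss := h.subset_of_le ht hs ht' hs' hle
  obtain ⟨d, hd⟩ := h.exists_dual t ht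
  obtain ⟨m, hm0, hm1⟩ := hd.exists_supporting (hss.trans hs)
  refine ⟨⟨m, mem_dualMonoid_coneOf.mpr fun v hv => ?_⟩,
    isOpenImmersion_affineToricMap hle _ hm0 fun v hv hvs => by simp [hm1 v (hs hv) hvs]⟩
  by_cases hvs : v ∈ s'
  · rw [hm0 v hvs]
  · rw [hm1 v (hs hv) hvs]
    exact zero_le_one

/-- The affine toric varieties of two faces of a cone meet in that of the common face. -/
theorem IsUnimodularFan.range_inter_range (h : IsUnimodularFan T ℓ)
    {σ τ ρ : PointedCone ℝ (Fin n → ℝ)} (hσ : ∃ t ∈ T, ∃ s ⊆ t, σ = coneOf (ℓ '' (s : Set V)))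
    (hτ : ∃ t ∈ T, ∃ s ⊆ t, τ = coneOf (ℓ '' (s : Set V)))
    (hρ : ∃ t ∈ T, ∃ s ⊆ t, ρ = coneOf (ℓ '' (s : Set V))) (hle : τ ≤ σ) (hle' : ρ ≤ σ) :
    Set.range (affineToricMap hle) ∩ Set.range (affineToricMap hle') =
      Set.range (affineToricMap (inf_le_left.trans hle : τ ⊓ ρ ≤ σ)) := by
  obtain ⟨t, ht, s, hs, rfl⟩ := hσ
  obtain ⟨t₁, ht₁, s₁, hs₁, rfl⟩ := hτ
  obtain ⟨t₂, ht₂, s₂, hs₂, rfl⟩ := hρ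
  have hss₁ := h.subset_of_le ht hs ht₁ hs₁ hle
  have hss₂ := h.subset_of_le ht hs ht₂ hs₂ hle'
  obtain ⟨d, hd⟩ := h.exists_dual t ht
  obtain ⟨m₁, h10, h11⟩ := hd.exists_supporting (hss₁.trans hs)
  obtain ⟨m₂, h20, h21⟩ := hd.exists_supporting (hss₂.trans hs)
  have hmem : ∀ {s' : Finset V} {m : Fin n → ℤ}, (∀ v ∈ s', m ⬝ᵥ ℓ v = 0) →
      (∀ v ∈ t, v ∉ s' → m ⬝ᵥ ℓ v = 1) → ∀ v ∈ s, 0 ≤ m ⬝ᵥ ℓ v := by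
    intro s' m h0 h1 v hv
    by_cases hvs : v ∈ s'
    · rw [h0 v hvs]
    · rw [h1 v (hs hv) hvs]
      exact zero_le_one
  let M₁ : dualMonoid (coneOf (ℓ '' (s : Set V))) := ⟨m₁, mem_dualMonoid_coneOf.mpr (hmem h10 h11)⟩
  let M₂ : dualMonoid (coneOf (ℓ '' (s : Set V))) := ⟨m₂, mem_dualMonoid_coneOf.mpr (hmem h20 h21)⟩
  have hinf := h.inf_eq ht₁ ht₂ hs₁ hs₂
  have h3 := (isOpenImmersion_affineToricMap
    (hinf ▸ inf_le_left.trans hle) (M₁ + M₂)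
    (fun v hv => by
      simp only [AddSubmonoid.coe_add, add_dotProduct, M₁, M₂]
      rw [h10 v (Finset.mem_inter.mp hv).1, h20 v (Finset.mem_inter.mp hv).2, add_zero])
    (fun v hv hvn => by
      simp only [AddSubmonoid.coe_add, add_dotProduct, M₁, M₂]
      by_cases hv1 : v ∈ s₁
      · have hv2 : v ∉ s₂ := fun hv2 => hvn (Finset.mem_inter.mpr ⟨hv1, hv2⟩)
        rw [h10 v hv1, h21 v (hs hv) hv2]
        norm_num
      · rw [h11 v (hs hv) hv1]
        have := hmem h20 h21 v hv
        omega)).2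
  have h4 : Set.range (affineToricMap (inf_le_left.trans hle : coneOf (ℓ '' (s₁ : Set V)) ⊓
      coneOf (ℓ '' (s₂ : Set V)) ≤ coneOf (ℓ '' (s : Set V)))) =
      Set.range (affineToricMap (hinf ▸ inf_le_left.trans hle :
        coneOf (ℓ '' ((s₁ ∩ s₂ : Finset V) : Set V)) ≤ coneOf (ℓ '' (s : Set V)))) := by
    exact range_affineToricMap_congr hinf _ _
  rw [h4, h3, (isOpenImmersion_affineToricMap hle M₁ h10 fun v hv hvs => by
      simp [M₁, h11 v (hs hv) hvs]).2,
    (isOpenImmersion_affineToricMap hle' M₂ h20 fun v hv hvs => by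
      simp [M₂, h21 v (hs hv) hvs]).2,
    show AddMonoidAlgebra.single (M₁ + M₂) (1 : ℂ) = AddMonoidAlgebra.single M₁ 1 *
      AddMonoidAlgebra.single M₂ 1 by rw [AddMonoidAlgebra.single_mul_single, one_mul],
    PrimeSpectrum.basicOpen_mul]
  rfl

/-- The toric variety of a non-singular fan exists. -/
theorem IsFanOf.exists_isToricVarietyOf {K : AbstractSimplicialComplex V} {F : Fan n}
    (hF : IsFanOf K ℓ F) (hK : HasFacets K T) : ∃ X : Over specC, IsToricVarietyOf F X := by
  have hU := hF.isUnimodularFan hK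
  have hcone := fun σ : F.cones => hF.exists_eq_coneOf hK σ.2
  let G := affineToricFunctor F
  have hopen : ∀ {σ τ : F.cones} (f : σ ⟶ τ), IsOpenImmersion (G.map f) := fun {σ τ} f =>
    (hU.exists_supporting (hcone τ) (hcone σ) f.le).choose_spec.1
  have hinj : ∀ {σ τ : F.cones} (f : σ ⟶ τ), Function.Injective (G.map f) := fun f =>
    (G.map f).isOpenEmbedding.injective
  have hdir : (G ⋙ Scheme.forget).IsLocallyDirected := by
    constructor
    intro σ τ ρ f g x y hxy
    have hxy : G.map f x = G.map g y := hxy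
    have hmem : G.map f x ∈ Set.range (affineToricMap f.le) ∩ Set.range (affineToricMap g.le) :=
      ⟨⟨x, rfl⟩, ⟨y, hxy.symm⟩⟩
    rw [hU.range_inter_range (hcone ρ) (hcone σ) (hcone τ) f.le g.le] at hmem
    obtain ⟨z, hz⟩ := hmem
    have hl : F.inter σ τ ≤ σ := inf_le_left (a := σ.1)
    have hr : F.inter σ τ ≤ τ := inf_le_right (a := σ.1)
    refine ⟨F.inter σ τ, homOfLE hl, homOfLE hr, z, ?_, ?_⟩
    · refine hinj f ?_
      exact (hom_apply_hom_apply (G.map_comp (homOfLE hl) f).symm z).trans hz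
    · refine hinj g ?_
      exact (hom_apply_hom_apply (G.map_comp (homOfLE hr) g).symm z).trans (hz.trans hxy)
  let c : Cocone G := ⟨specC, { app := fun σ => affineToricStr σ.1
                                naturality := fun σ τ f => by
                                  exact (affineToricMap_str f.le).trans (Category.comp_id _).symm }⟩
  refine ⟨Over.mk (colimit.desc G c), ⟨?_⟩⟩
  exact
    { chart := fun σ => colimit.ι G σ
      isOpenImmersion := fun σ => show IsOpenImmersion (colimit.ι G σ) from inferInstance
      chart_over := fun σ => colimit.ι_desc c σ
      map_chart := fun σ τ hle => colimit.w G (homOfLE (show τ ≤ σ from hle))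
      cover := by
        refine Set.eq_univ_of_forall fun x => ?_
        obtain ⟨σ, y, hy⟩ := Scheme.IsLocallyDirected.ι_jointly_surjective G x
        exact Set.mem_iUnion.mpr ⟨σ, y, hy⟩
      inter := fun σ τ => by
        refine Set.Subset.antisymm ?_ ?_
        · rintro _ ⟨⟨x, rfl⟩, ⟨y, hy⟩⟩
          obtain ⟨ρ, f, g, z, hz, -⟩ :=
            (Scheme.IsLocallyDirected.ι_eq_ι_iff G).mp hy.symm
          have hle : ρ ≤ F.inter σ τ := 
            le_inf (show ρ.1 ≤ σ.1 from f.le) (show ρ.1 ≤ τ.1 from g.le)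
          refine ⟨G.map (homOfLE hle) z, ?_⟩
          rw [← hz]
          exact (hom_apply_hom_apply (colimit.w G _) z).trans
            (hom_apply_hom_apply (colimit.w G _) z).symm
        · rintro _ ⟨x, rfl⟩
          have hl : F.inter σ τ ≤ σ := inf_le_left (a := σ.1)
          have hr : F.inter σ τ ≤ τ := inf_le_right (a := σ.1)
          exact ⟨⟨G.map (homOfLE hl) x, hom_apply_hom_apply (colimit.w G _) x⟩,
            ⟨G.map (homOfLE hr) x, hom_apply_hom_apply (colimit.w G _) x⟩⟩ }

end Gluing

end ToricNeighborly

namespace ToricNeighborly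
open CategoryTheory AlgebraicGeometry

/-! ### Morphisms out of a toric variety -/

section Atlas

open Limits

variable {n : ℕ} {F : Fan n} {X : Over specC}

/-- Morphisms on two charts that agree on the chart of the common face agree on the overlap. -/
theorem ToricAtlas.pullback_fst_comp (A : ToricAtlas F X) (σ τ : F.cones) {Y : Scheme.{0}}
    (f : affineToric σ.1 ⟶ Y) (g : affineToric τ.1 ⟶ Y)
    (hfg : affineToricMap (inf_le_left : σ.1 ⊓ τ.1 ≤ σ.1) ≫ f =
      affineToricMap (inf_le_right : σ.1 ⊓ τ.1 ≤ τ.1) ≫ g) :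
    pullback.fst (A.chart σ) (A.chart τ) ≫ f = pullback.snd (A.chart σ) (A.chart τ) ≫ g := by
  have := A.isOpenImmersion
  have h1 : affineToricMap (inf_le_left : σ.1 ⊓ τ.1 ≤ σ.1) ≫ A.chart σ =
      A.chart (F.inter σ τ) := A.map_chart σ (F.inter σ τ) inf_le_left
  have h2 : affineToricMap (inf_le_right : σ.1 ⊓ τ.1 ≤ τ.1) ≫ A.chart τ =
      A.chart (F.inter σ τ) := A.map_chart τ (F.inter σ τ) inf_le_right
  let a : affineToric (σ.1 ⊓ τ.1) ⟶ pullback (A.chart σ) (A.chart τ) :=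
    pullback.lift (affineToricMap inf_le_left) (affineToricMap inf_le_right) (h1.trans h2.symm)
  have ha : a ≫ pullback.fst (A.chart σ) (A.chart τ) ≫ A.chart σ = A.chart (F.inter σ τ) := by
    rw [← Category.assoc, pullback.lift_fst, h1]
  have hopen : IsOpenImmersion (a ≫ pullback.fst (A.chart σ) (A.chart τ) ≫ A.chart σ) := by
    rw [ha]
    exact A.isOpenImmersion _
  have hopen' : IsOpenImmersion a := 
    IsOpenImmersion.of_comp a (pullback.fst (A.chart σ) (A.chart τ) ≫ A.chart σ)
  have hsurj : Function.Surjective a := by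
    intro y
    have hy : (pullback.fst (A.chart σ) (A.chart τ) ≫ A.chart σ) y ∈
        Set.range (A.chart σ) ∩ Set.range (A.chart τ) := by
      refine ⟨⟨_, (Scheme.Hom.comp_apply _ _ _).symm⟩, ?_⟩
      rw [pullback.condition]
      exact ⟨_, (Scheme.Hom.comp_apply _ _ _).symm⟩
    rw [A.inter] at hy
    obtain ⟨x, hx⟩ := hy
    refine ⟨x, (pullback.fst (A.chart σ) (A.chart τ) ≫ A.chart σ).isOpenEmbedding.injective ?_⟩
    rw [← hx, ← ha]
    exact (Scheme.Hom.comp_apply a _ x).symm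
  have hiso : IsIso a := by
    have : Epi a.base := (TopCat.epi_iff_surjective _).mpr hsurj
    exact IsOpenImmersion.isIso a
  rw [← cancel_epi a, ← Category.assoc, ← Category.assoc, pullback.lift_fst, pullback.lift_snd]
  exact hfg

/-- Morphisms on the charts of a family of cones that contains a cone above any cone of the fan
glue, if they are compatible. -/
theorem ToricAtlas.exists_glue (A : ToricAtlas F X) {I : Type} (c : I → F.cones)
    (hc : ∀ σ : F.cones, ∃ i, σ.1 ≤ (c i).1) {Y : Scheme.{0}} (f : ∀ i, affineToric (c i).1 ⟶ Y)
    (hf : ∀ i j, affineToricMap (inf_le_left : (c i).1 ⊓ (c j).1 ≤ (c i).1) ≫ f i =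
      affineToricMap (inf_le_right : (c i).1 ⊓ (c j).1 ≤ (c j).1) ≫ f j) :
    ∃ g : X.left ⟶ Y, (∀ i, A.chart (c i) ≫ g = f i) ∧
      ∀ g' : X.left ⟶ Y, (∀ i, A.chart (c i) ≫ g' = f i) → g' = g := by
  have := A.isOpenImmersion
  let 𝒰 : X.left.OpenCover := {
    I₀ := I, X := fun i => affineToric (c i).1, f := fun i => A.chart (c i),
    mem₀ := by
      rw [Scheme.presieve₀_mem_precoverage_iff]
      refine ⟨fun x => ?_, fun i => A.isOpenImmersion (c i)⟩
      have hx : x ∈ ⋃ σ : F.cones, Set.range (A.chart σ) := by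
        rw [A.cover]
        trivial
      obtain ⟨σ, y, hy⟩ := Set.mem_iUnion.mp hx
      obtain ⟨i, hi⟩ := hc σ
      exact ⟨i, affineToricMap hi y, (hom_apply_hom_apply (A.map_chart _ _ hi) y).trans hy⟩ }
  refine ⟨𝒰.glueMorphisms f fun i j => A.pullback_fst_comp _ _ _ _ (hf i j),
    fun i => 𝒰.ι_glueMorphisms f _ i, fun g' hg' => 𝒰.hom_ext _ _ fun i => ?_⟩
  exact (hg' i).trans (𝒰.ι_glueMorphisms f _ i).symm

theorem isClosedImmersion_morphismRestrict {X Y A B : Scheme.{0}} (f : X ⟶ Y) (U : Y.Opens)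
    (a : A ⟶ X) [IsOpenImmersion a] (b : B ⟶ Y) [IsOpenImmersion b] (g : A ⟶ B)
    [IsClosedImmersion g] (hcomm : a ≫ f = g ≫ b)
    (ha : Set.range a = ((f ⁻¹ᵁ U : X.Opens) : Set X)) (hb : Set.range b = (U : Set Y)) :
    IsClosedImmersion (f ∣_ U) := by
  let eA : A ≅ (f ⁻¹ᵁ U).toScheme := IsOpenImmersion.isoOfRangeEq a (f ⁻¹ᵁ U).ι (by simpa using ha)
  let eB : B ≅ U.toScheme := IsOpenImmersion.isoOfRangeEq b U.ι (by simpa using hb)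
  have h1 : eA.hom ≫ (f ∣_ U) = g ≫ eB.hom := by
    rw [← cancel_mono U.ι, Category.assoc, Category.assoc, morphismRestrict_ι,
      IsOpenImmersion.isoOfRangeEq_hom_fac, ← Category.assoc,
      IsOpenImmersion.isoOfRangeEq_hom_fac, hcomm]
  have h2 : (f ∣_ U) = eA.inv ≫ g ≫ eB.hom := by rw [← h1, Iso.inv_hom_id_assoc]
  rw [h2]
  infer_instance

end Atlas

end ToricNeighborly

namespace ToricNeighborly
open CategoryTheory AlgebraicGeometry

/-! ### Projectivity from a strictly concave support function -/

section Support

open MvPolynomial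

variable {n N : ℕ} {V : Type} [DecidableEq V]

/-- A piecewise linear function that is strictly concave: the covector `m t` gives its values `h v`
on the vectors of `t`, and exceeds `h v` on all other vectors. -/
def IsStrictSupport (T : Finset (Finset V)) (ℓ : V → Fin n → ℤ) (h : V → ℤ)
    (m : Finset V → Fin n → ℤ) : Prop :=
  ∀ t ∈ T, ∀ v, (v ∈ t → m t ⬝ᵥ ℓ v = h v) ∧ (v ∉ t → h v < m t ⬝ᵥ ℓ v)

theorem IsStrictSupport.le {T : Finset (Finset V)} {ℓ : V → Fin n → ℤ} {h : V → ℤ}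
    {m : Finset V → Fin n → ℤ} (H : IsStrictSupport T ℓ h m) {t : Finset V} (ht : t ∈ T) (v : V) :
    h v ≤ m t ⬝ᵥ ℓ v := by
  by_cases hv : v ∈ t
  · exact ((H t ht v).1 hv).ge
  · exact ((H t ht v).2 hv).le

/-- The monomials with exponents `p k - m` on an affine toric variety. -/
noncomputable def monomialCoord {σ : PointedCone ℝ (Fin n → ℝ)} {p : Fin (N + 1) → Fin n → ℤ}
    {m : Fin n → ℤ} (h : ∀ k, p k - m ∈ dualMonoid σ) (k : Fin (N + 1)) : coordRing σ :=
  AddMonoidAlgebra.single ⟨p k - m, h k⟩ 1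

theorem monomialCoord_eq_one {σ : PointedCone ℝ (Fin n → ℝ)} {p : Fin (N + 1) → Fin n → ℤ}
    {m : Fin n → ℤ} (h : ∀ k, p k - m ∈ dualMonoid σ) {k : Fin (N + 1)} (hk : p k = m) :
    monomialCoord h k = 1 := by
  rw [monomialCoord, AddMonoidAlgebra.one_def]
  congr 1
  ext
  simp [hk]

theorem isUnit_monomialCoord {σ : PointedCone ℝ (Fin n → ℝ)} {p : Fin (N + 1) → Fin n → ℤ}
    {m : Fin n → ℤ} (h : ∀ k, p k - m ∈ dualMonoid σ) {k : Fin (N + 1)} (hk : p k = m) :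
    IsUnit (monomialCoord h k) := by
  rw [monomialCoord_eq_one h hk]
  exact isUnit_one

theorem affineToricMap_projPointX {σ τ : PointedCone ℝ (Fin n → ℝ)} (hle : τ ≤ σ)
    {p : Fin (N + 1) → Fin n → ℤ} {m : Fin n → ℤ} (h : ∀ k, p k - m ∈ dualMonoid σ)
    {k : Fin (N + 1)} (hk : p k = m) :
    affineToricMap hle ≫ projPointX (monomialCoord h) k (isUnit_monomialCoord h hk) =
      projPointX (monomialCoord fun k => dualMonoid_anti hle (h k)) k
        (isUnit_monomialCoord _ hk) := by
  have hφ : ∀ k, AddMonoidAlgebra.mapDomainAlgHom ℂ ℂ (AddSubmonoid.inclusion (dualMonoid_anti hle))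
      (monomialCoord h k) = monomialCoord (fun k => dualMonoid_anti hle (h k)) k := fun k =>
    AddMonoidAlgebra.mapDomain_single
  have h1 := Spec_map_projPointX
    (AddMonoidAlgebra.mapDomainAlgHom ℂ ℂ (AddSubmonoid.inclusion (dualMonoid_anti hle)))
    (monomialCoord h) (isUnit_monomialCoord h hk) ((hφ k).symm ▸ isUnit_monomialCoord _ hk)
  simp only [hφ] at h1
  exact h1

theorem projPointX_monomialCoord_congr {σ : PointedCone ℝ (Fin n → ℝ)}
    {p : Fin (N + 1) → Fin n → ℤ} {m m' : Fin n → ℤ} (h : ∀ k, p k - m ∈ dualMonoid σ)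
    (h' : ∀ k, p k - m' ∈ dualMonoid σ) {k k' : Fin (N + 1)} (hk : p k = m) (hk' : p k' = m') :
    projPointX (monomialCoord h) k (isUnit_monomialCoord h hk) =
      projPointX (monomialCoord h') k' (isUnit_monomialCoord h' hk') := by
  have hmm : m - m' ∈ dualMonoid σ := hk ▸ h' k
  have hmm' : m' - m ∈ dualMonoid σ := hk' ▸ h k'
  refine projPointX_congr (u := AddMonoidAlgebra.single ⟨m - m', hmm⟩ 1) (fun k => ?_) ?_
  · rw [monomialCoord, monomialCoord, AddMonoidAlgebra.single_mul_single, one_mul]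
    congr 1
    ext
    simp
  · refine IsUnit.of_mul_eq_one (AddMonoidAlgebra.single ⟨m' - m, hmm'⟩ 1) ?_
    rw [AddMonoidAlgebra.single_mul_single, AddMonoidAlgebra.one_def, one_mul]
    congr 1
    ext
    simp

variable {T : Finset (Finset V)} {ℓ d : V → Fin n → ℤ} {t : Finset V}

/-- The dual basis generates the coordinate ring of a unimodular cone. -/
theorem IsDualBasis.adjoin_eq_top (hd : IsDualBasis ℓ t d)
    {B : Subalgebra ℂ (coordRing (coneOf (ℓ '' (t : Set V))))}
    (hB : ∀ v ∈ t, ∀ hv : d v ∈ dualMonoid (coneOf (ℓ '' (t : Set V))),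
      AddMonoidAlgebra.single ⟨d v, hv⟩ 1 ∈ B) : B = ⊤ := by
  have hdmem : ∀ v ∈ t, d v ∈ dualMonoid (coneOf (ℓ '' (t : Set V))) := fun v hv =>
    mem_dualMonoid_coneOf.mpr fun w hw => by
      rw [hd.dot_eq v hv w hw]
      split <;> simp
  -- the exponents of the monomials in `B` form a submonoid that contains the dual basis
  let S : AddSubmonoid (dualMonoid (coneOf (ℓ '' (t : Set V)))) :=
    { carrier := {x | AddMonoidAlgebra.single x (1 : ℂ) ∈ B}
      zero_mem' := B.one_mem
      add_mem' := fun {a b} ha hb => by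
        have := B.mul_mem ha hb
        rwa [AddMonoidAlgebra.single_mul_single, one_mul] at this }
  have hS : ∀ x, x ∈ S := by
    rintro ⟨x, hx⟩
    have hx' := mem_dualMonoid_coneOf.mp hx
    have h1 : (⟨x, hx⟩ : dualMonoid (coneOf (ℓ '' (t : Set V)))) =
        ∑ v : t, (x ⬝ᵥ ℓ v).toNat • ⟨d v, hdmem v v.2⟩ := by
      ext1
      rw [AddSubmonoid.coe_finsetSum]
      simp only [AddSubmonoidClass.coe_nsmul]
      rw [Finset.sum_coe_sort t fun v => (x ⬝ᵥ ℓ v).toNat • d v]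
      conv_lhs => rw [hd.eq_sum_dual x]
      refine Finset.sum_congr rfl fun v hv => ?_
      rw [← natCast_zsmul, Int.toNat_of_nonneg (hx' v hv)]
    rw [h1]
    exact sum_mem fun v _ => S.nsmul_mem (hB v v.2 _) _
  rw [eq_top_iff]
  rintro f -
  induction f using AddMonoidAlgebra.induction_linear with
  | zero => exact B.zero_mem
  | add x y hx hy => exact B.add_mem hx hy
  | single x r =>
    have := B.smul_mem (hS x) r
    rwa [AddMonoidAlgebra.smul_single, smul_eq_mul, mul_one] at this

end Support

end ToricNeighborly

namespace ToricNeighborly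
open CategoryTheory AlgebraicGeometry

section Projective

open MvPolynomial

variable {n : ℕ} {V : Type} [DecidableEq V] {T : Finset (Finset V)} {ℓ : V → Fin n → ℤ}
  {h : V → ℤ} {m : Finset V → Fin n → ℤ}

theorem iSup_basicOpen_X (N : ℕ) :
    ⨆ k, Proj.basicOpen (homogCoord N) (X k : MvPolynomial (Fin (N + 1)) ℂ) = ⊤ := by
  refine Proj.iSup_basicOpen_eq_top' _ _ (fun k => ⟨1, X_mem_homogCoord k⟩) ?_
  rw [eq_top_iff]
  rintro f -
  induction f using MvPolynomial.induction_on with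
  | C c =>
    exact Subalgebra.algebraMap_mem _ (⟨C c, (mem_homogeneousSubmodule 0 _).mpr
      (isHomogeneous_C _ c)⟩ : homogCoord N 0)
  | add f g hf hg => exact Subalgebra.add_mem _ hf hg
  | mul_X f k hf => exact Subalgebra.mul_mem _ hf (Algebra.subset_adjoin ⟨k, rfl⟩)

/-- Lattice points of the polytope of a strictly concave support function: its vertices `m t`, and
the neighbors of the vertices on the edges. A multiple of any of them is a sum of others and of a
vertex, which makes the corresponding monomials integral over the vertex monomials. -/
theorem IsStrictSupport.exists_points (hT : T.Nonempty) (H : IsStrictSupport T ℓ h m)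
    {d : Finset V → V → Fin n → ℤ} (hd : ∀ t ∈ T, IsDualBasis ℓ t (d t))
    (hadj : ∀ t ∈ T, ∀ v ∈ t, ∃ t' ∈ T, t.erase v ⊆ t' ∧ v ∉ t') :
    ∃ (N : ℕ) (p : Fin (N + 1) → Fin n → ℤ),
      (∀ k v, h v ≤ p k ⬝ᵥ ℓ v) ∧ (∀ t ∈ T, ∃ k, p k = m t) ∧
      (∀ t ∈ T, ∀ v ∈ t, ∃ k, p k = m t + d t v) ∧
      ∀ k, ∃ t ∈ T, ∃ (c : ℕ) (j : Fin (N + 1)), (c + 1) • p k = c • p j + m t := by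
  let I := T ⊕ (Σ t : T, (t : Finset V))
  let q : I → Fin n → ℤ := Sum.elim (fun t => m t) (fun x => m x.1 + d x.1 x.2)
  have hedge : ∀ t ∈ T, ∀ v ∈ t, ∃ t' ∈ T, ∃ c : ℕ, (c + 1) • (m t + d t v) = c • m t + m t' := by
    intro t ht v hv
    obtain ⟨t', ht', hsub, hvt'⟩ := hadj t ht v hv
    have h1 : m t' - m t = (m t' ⬝ᵥ ℓ v - h v) • d t v := by
      conv_lhs => rw [(hd t ht).eq_sum_dual (m t' - m t)]
      rw [Finset.sum_eq_single_of_mem v hv]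
      · rw [sub_dotProduct, (H t ht v).1 hv]
      · intro w hw hwv
        rw [sub_dotProduct, (H t ht w).1 hw,
          (H t' ht' w).1 (hsub (Finset.mem_erase.mpr ⟨hwv, hw⟩)), sub_self, zero_smul]
    obtain ⟨c, hc⟩ := Int.eq_ofNat_of_zero_le
      (show 0 ≤ m t' ⬝ᵥ ℓ v - h v - 1 by have := (H t' ht' v).2 hvt'; omega)
    refine ⟨t', ht', c, ?_⟩
    have h2 : m t' = m t + ((c : ℤ) + 1) • d t v := by
      rw [← sub_eq_iff_eq_add', h1, ← hc, sub_add_cancel]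
    rw [h2, ← natCast_zsmul, ← natCast_zsmul]
    push_cast
    module
  have hI : 0 < Fintype.card I := by
    obtain ⟨t, ht⟩ := hT
    exact Fintype.card_pos_iff.mpr ⟨Sum.inl ⟨t, ht⟩⟩
  obtain ⟨N, hN⟩ := Nat.exists_eq_succ_of_ne_zero hI.ne'
  let e : I ≃ Fin (N + 1) := Fintype.equivFinOfCardEq hN
  have hle : ∀ t ∈ T, ∀ v, h v ≤ m t ⬝ᵥ ℓ v := fun t ht v => H.le ht v
  refine ⟨N, fun k => q (e.symm k), fun k v => ?_, fun t ht => ⟨e (Sum.inl ⟨t, ht⟩), by simp [q]⟩,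
    fun t ht v hv => ⟨e (Sum.inr ⟨⟨t, ht⟩, ⟨v, hv⟩⟩), by simp [q]⟩, fun k => ?_⟩
  · simp only
    rcases e.symm k with ⟨t, ht⟩ | ⟨⟨t, ht⟩, ⟨w, hw⟩⟩
    · exact hle t ht v
    · obtain ⟨t', ht', c, hc⟩ := hedge t ht w hw
      have h3 := congrArg (fun x => x ⬝ᵥ ℓ v) hc
      rw [smul_dotProduct, add_dotProduct, add_dotProduct, smul_dotProduct, nsmul_eq_mul,
        nsmul_eq_mul] at h3
      push_cast at h3
      change h v ≤ (m t + d t w) ⬝ᵥ ℓ v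
      rw [add_dotProduct]
      nlinarith [hle t ht v, hle t' ht' v, Int.natCast_nonneg c]
  · simp only
    rcases e.symm k with ⟨t, ht⟩ | ⟨⟨t, ht⟩, ⟨w, hw⟩⟩
    · exact ⟨t, ht, 0, k, by simp [q]⟩
    · obtain ⟨t', ht', c, hc⟩ := hedge t ht w hw
      exact ⟨t', ht', c, e (Sum.inl ⟨t, ht⟩), by simpa [q] using hc⟩

omit [DecidableEq V] in
theorem sub_mem_dualMonoid_of_le {p u : Fin n → ℤ} {t : Finset V}
    (hp : ∀ v ∈ t, u ⬝ᵥ ℓ v ≤ p ⬝ᵥ ℓ v) : p - u ∈ dualMonoid (coneOf (ℓ '' (t : Set V))) :=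
  mem_dualMonoid_coneOf.mpr fun v hv => by
    rw [sub_dotProduct]
    have := hp v hv
    omega

/-- A toric manifold whose fan has a strictly concave support function is projective: the lattice
points of the polytope of the support function give homogeneous coordinates. -/
theorem IsFanOf.isProjective {K : AbstractSimplicialComplex V} {F : Fan n} {X : Over specC}
    (hF : IsFanOf K ℓ F) (hK : HasFacets K T)
    (hadj : ∀ t ∈ T, ∀ v ∈ t, ∃ t' ∈ T, t.erase v ⊆ t' ∧ v ∉ t')
    (H : IsStrictSupport T ℓ h m) (hX : IsToricVarietyOf F X) : IsProjective X := by
  obtain ⟨A⟩ := hX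
  choose! d hd using (hF.isUnimodularFan hK).exists_dual
  obtain ⟨N, p, hple, hpm, hpd, hprel⟩ := H.exists_points hK.nonempty hd hadj
  choose! κ hκ using hpm
  choose τ hτ a j hrel using hprel
  have hr : ∀ t ∈ T, ∀ k, p k - m t ∈ dualMonoid (coneOf (ℓ '' (t : Set V))) := fun t ht k =>
    sub_mem_dualMonoid_of_le fun v hv => by
      rw [(H t ht v).1 hv]
      exact hple k v
  let c : T → F.cones := fun t => ⟨_, hF.coneOf_mem hK t.2 subset_rfl⟩
  have hc : ∀ σ : F.cones, ∃ i, σ.1 ≤ (c i).1 := by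
    rintro ⟨σ, hσ⟩
    obtain ⟨t, ht, s, hs, rfl⟩ := hF.exists_eq_coneOf hK hσ
    exact ⟨⟨t, ht⟩, coneOf_mono (Set.image_mono (Finset.coe_subset.mpr hs))⟩
  let r : ∀ t : T, Fin (N + 1) → coordRing (coneOf (ℓ '' ((t : Finset V) : Set V))) := fun t =>
    monomialCoord (hr t t.2)
  let f : ∀ t : T, affineToric (c t).1 ⟶ Proj (homogCoord N) := fun t =>
    projPointX (r t) (κ t) (isUnit_monomialCoord (hr t t.2) (hκ t t.2))
  obtain ⟨g, hg, -⟩ := A.exists_glue c hc f fun s t => by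
    rw [affineToricMap_projPointX _ _ (hκ s s.2), affineToricMap_projPointX _ _ (hκ t t.2)]
    exact projPointX_monomialCoord_congr _ _ (hκ s s.2) (hκ t t.2)
  have hcover : ∀ x : X.left, ∃ (t : T) (y : affineToric (c t).1), A.chart (c t) y = x := by
    intro x
    have hx : x ∈ ⋃ σ : F.cones, Set.range (A.chart σ) := by
      rw [A.cover]
      trivial
    obtain ⟨σ, y, hy⟩ := Set.mem_iUnion.mp hx
    obtain ⟨t, ht⟩ := hc σ
    exact ⟨t, affineToricMap ht y, (hom_apply_hom_apply (A.map_chart _ _ ht) y).trans hy⟩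
  have hmem : ∀ (t : T) (y : affineToric (c t).1) {G : MvPolynomial (Fin (N + 1)) ℂ} {e : ℕ},
      G ∈ homogCoord N e → 0 < e →
      (g (A.chart (c t) y) ∈ Proj.basicOpen (homogCoord N) G ↔ aeval (r t) G ∉ y.asIdeal) := by
    intro t y G e hG he
    rw [hom_apply_hom_apply (hg t) y]
    exact projPointX_mem_basicOpen (r t) _ hG he y
  refine ⟨N, Over.homMk g ?_, ?_⟩
  · obtain ⟨g', -, huniq⟩ := A.exists_glue c hc (fun t => affineToricStr (c t).1) fun s t => by
      rw [affineToricMap_str, affineToricMap_str]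
    rw [huniq X.hom fun t => A.chart_over (c t)]
    refine huniq _ fun t => ?_
    exact (Category.assoc _ _ _).symm.trans
      ((congrArg (· ≫ (projectiveSpace N).hom) (hg t)).trans (projPointX_comp_hom _ _))
  have hXmem : ∀ k, (MvPolynomial.X k : MvPolynomial (Fin (N + 1)) ℂ) ∈ homogCoord N 1 :=
    X_mem_homogCoord
  -- the equation of the image of `X` that bounds the coordinate `k` by a vertex coordinate
  let G : Fin (N + 1) → MvPolynomial (Fin (N + 1)) ℂ := fun k =>
    MvPolynomial.X k ^ (a k + 1) - MvPolynomial.X (j k) ^ a k * MvPolynomial.X (κ (τ k))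
  have hG : ∀ k, G k ∈ homogCoord N (a k + 1) := by
    intro k
    refine Submodule.sub_mem _ ?_ ?_
    · simpa using SetLike.pow_mem_graded (a k + 1) (hXmem k)
    · simpa using SetLike.mul_mem_graded (SetLike.pow_mem_graded (a k) (hXmem (j k)))
        (hXmem (κ (τ k)))
  have hG0 : ∀ (t : T) k, aeval (r t) (G k) = 0 := by
    intro t k
    simp only [G, map_sub, map_mul, map_pow, aeval_X, r, monomialCoord,
      AddMonoidAlgebra.single_pow, AddMonoidAlgebra.single_mul_single, one_pow, one_mul]
    rw [sub_eq_zero]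
    congr 1
    ext1
    simp only [AddSubmonoidClass.coe_nsmul, AddSubmonoid.coe_add]
    rw [hκ _ (hτ k), smul_sub, smul_sub, hrel]
    module
  let U : T ⊕ Fin (N + 1) → (Proj (homogCoord N)).Opens := Sum.elim
    (fun t => Proj.basicOpen (homogCoord N) (MvPolynomial.X (κ t)))
    (fun k => Proj.basicOpen (homogCoord N) (G k))
  have hU : iSup U = ⊤ := by
    refine top_le_iff.mp fun x _ => ?_
    obtain ⟨k, hk⟩ := TopologicalSpace.Opens.mem_iSup.mp
      ((iSup_basicOpen_X N).ge (TopologicalSpace.Opens.mem_top x))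
    rw [TopologicalSpace.Opens.mem_iSup]
    by_cases hx : x ∈ Proj.basicOpen (homogCoord N) (G k)
    · exact ⟨Sum.inr k, hx⟩
    · refine ⟨Sum.inl ⟨τ k, hτ k⟩, fun h1 => hk ?_⟩
      rw [Proj.mem_basicOpen, not_not] at hx
      have h2 : (MvPolynomial.X k ^ (a k + 1) : MvPolynomial (Fin (N + 1)) ℂ) ∈
          x.asHomogeneousIdeal.toIdeal := by
        have h3 := Ideal.add_mem _ hx (Ideal.mul_mem_left _
          (MvPolynomial.X (j k) ^ a k) h1)
        rwa [sub_add_cancel] at h3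
      exact x.isPrime.mem_of_pow_mem _ h2
  refine IsZariskiLocalAtTarget.of_iSup_eq_top U hU ?_
  rintro (t | k)
  · obtain ⟨b, hb, hbf⟩ := exists_isClosedImmersion_comp_awayι (r t)
      (isUnit_monomialCoord (hr t t.2) (hκ t t.2)) (monomialCoord_eq_one (hr t t.2) (hκ t t.2)) (by
        refine (hd t t.2).adjoin_eq_top fun v hv hmem => Algebra.subset_adjoin ?_
        obtain ⟨k, hk⟩ := hpd t t.2 v hv
        refine ⟨k, ?_⟩
        simp only [r, monomialCoord]
        congr 1
        ext1
        simp [hk])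
    have := A.isOpenImmersion (c t)
    refine isClosedImmersion_morphismRestrict g _ (A.chart (c t))
      (Proj.awayι (homogCoord N) (MvPolynomial.X (κ t)) (hXmem _) one_pos) b ?_ ?_ ?_
    · rw [hg t]
      exact hbf.symm
    · refine Set.Subset.antisymm ?_ ?_
      · rintro _ ⟨y, rfl⟩
        refine (hmem t y (hXmem _) one_pos).mpr ?_
        rw [aeval_X, show r t (κ t) = 1 from monomialCoord_eq_one (hr t t.2) (hκ t t.2)]
        exact fun h1 => y.2.ne_top ((Ideal.eq_top_iff_one _).mpr h1)
      · intro x hx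
        obtain ⟨s, y, rfl⟩ := hcover x
        have hy := (hmem s y (hXmem _) one_pos).mp hx
        rw [aeval_X] at hy
        -- the vertex monomial of `t` vanishes on the chart of `s` exactly off the chart of `s ∩ t`
        have hle : coneOf (ℓ '' ((s.1 ∩ t.1 : Finset V) : Set V)) ≤ coneOf (ℓ '' (s.1 : Set V)) :=
          coneOf_mono (Set.image_mono (Finset.coe_subset.mpr Finset.inter_subset_left))
        have hle' : coneOf (ℓ '' ((s.1 ∩ t.1 : Finset V) : Set V)) ≤ coneOf (ℓ '' (t.1 : Set V)) :=
          coneOf_mono (Set.image_mono (Finset.coe_subset.mpr Finset.inter_subset_right))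
        have hrange := (isOpenImmersion_affineToricMap hle ⟨p (κ t) - m s, hr s s.2 _⟩
          (fun v hv => by
            obtain ⟨hvs, hvt⟩ := Finset.mem_inter.mp hv
            simp only [sub_dotProduct]
            rw [hκ t t.2, (H t t.2 v).1 hvt, (H s s.2 v).1 hvs, sub_self])
          (fun v hvs hvn => by
            have hvt : v ∉ t.1 := fun hvt => hvn (Finset.mem_inter.mpr ⟨hvs, hvt⟩)
            have h1 := (H t t.2 v).2 hvt
            simp only [sub_dotProduct]
            rw [hκ t t.2, (H s s.2 v).1 hvs]
            omega)).2
        have hy' : y ∈ Set.range (affineToricMap hle) := by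
          rw [hrange]
          exact hy
        obtain ⟨z, rfl⟩ := hy'
        let ρ : F.cones := ⟨coneOf (ℓ '' ((s.1 ∩ t.1 : Finset V) : Set V)),
            hF.coneOf_mem hK s.2 Finset.inter_subset_left⟩
        exact ⟨affineToricMap hle' z, (hom_apply_hom_apply (A.map_chart (c t) ρ hle') z).trans
          (hom_apply_hom_apply (A.map_chart (c s) ρ hle) z).symm⟩
    · rw [← Scheme.Hom.coe_opensRange, Proj.opensRange_awayι]
      rfl
  · have hempty : IsEmpty ((g ⁻¹ᵁ U (Sum.inr k) : X.left.Opens) : Set X.left) := by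
      refine ⟨fun ⟨x, hx⟩ => ?_⟩
      obtain ⟨t, y, rfl⟩ := hcover x
      refine (hmem t y (hG k) (Nat.succ_pos _)).mp hx ?_
      rw [hG0 t k]
      exact y.asIdeal.zero_mem
    have : IsEmpty (g ⁻¹ᵁ U (Sum.inr k)).toScheme := hempty
    change IsClosedImmersion (g ∣_ U (Sum.inr k))
    infer_instance

end Projective

end ToricNeighborly

namespace ToricNeighborly

/-! ### Coordinate rings of unimodular cones -/

section CoordinateRings

variable {n : ℕ} {V : Type} [DecidableEq V] {ℓ d : V → Fin n → ℤ} {t : Finset V}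

theorem IsDualBasis.mem_dualMonoid (hd : IsDualBasis ℓ t d) {v : V} (hv : v ∈ t) :
    d v ∈ dualMonoid (coneOf (ℓ '' (t : Set V))) :=
  mem_dualMonoid_coneOf.mpr fun w hw => by
    rw [hd.dot_eq v hv w hw]
    split <;> simp

/-- The monoid of a unimodular cone is free on the dual basis. -/
noncomputable def IsDualBasis.addEquiv (hd : IsDualBasis ℓ t d) :
    dualMonoid (coneOf (ℓ '' (t : Set V))) ≃+ (t →₀ ℕ) where
  toFun x := Finsupp.equivFunOnFinite.symm fun v => ((x : Fin n → ℤ) ⬝ᵥ ℓ v).toNat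
  invFun f := ∑ v : t, f v • ⟨d v, hd.mem_dualMonoid v.2⟩
  left_inv x := by
    ext1
    rw [AddSubmonoid.coe_finsetSum]
    conv_rhs => rw [hd.eq_sum_dual x, ← Finset.sum_coe_sort]
    refine Finset.sum_congr rfl fun v _ => ?_
    rw [AddSubmonoidClass.coe_nsmul, ← natCast_zsmul]
    congr 1
    exact Int.toNat_of_nonneg (mem_dualMonoid_coneOf.mp x.2 v v.2)
  right_inv f := by
    ext w
    have h1 : ((∑ v : t, f v • (⟨d v, hd.mem_dualMonoid v.2⟩ :
        dualMonoid (coneOf (ℓ '' (t : Set V)))) : dualMonoid (coneOf (ℓ '' (t : Set V)))) :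
          Fin n → ℤ) ⬝ᵥ ℓ w = f w := by
      rw [AddSubmonoid.coe_finsetSum, sum_dotProduct, Finset.sum_eq_single_of_mem w (by simp)]
      · rw [AddSubmonoidClass.coe_nsmul, smul_dotProduct, hd.dot_eq w w.2 w w.2]
        simp
      · intro v _ hvw
        rw [AddSubmonoidClass.coe_nsmul, smul_dotProduct, hd.dot_eq v v.2 w w.2,
          if_neg fun hc => hvw (Subtype.ext hc), smul_zero]
    exact (congrArg Int.toNat h1).trans (Int.toNat_natCast _)
  map_add' x y := by
    ext v
    have hx := mem_dualMonoid_coneOf.mp x.2 v v.2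
    have hy := mem_dualMonoid_coneOf.mp y.2 v v.2
    simp [add_dotProduct, Int.toNat_add hx hy]

/-- The coordinate ring of a unimodular cone is a polynomial ring. -/
noncomputable def IsDualBasis.algEquiv (hd : IsDualBasis ℓ t d) :
    coordRing (coneOf (ℓ '' (t : Set V))) ≃ₐ[ℂ] MvPolynomial t ℂ :=
  AddMonoidAlgebra.domCongr ℂ ℂ hd.addEquiv

theorem IsDualBasis.isDomain (hd : IsDualBasis ℓ t d) :
    IsDomain (coordRing (coneOf (ℓ '' (t : Set V)))) :=
  hd.algEquiv.toMulEquiv.isDomain _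

theorem IsDualBasis.isNoetherianRing (hd : IsDualBasis ℓ t d) :
    IsNoetherianRing (coordRing (coneOf (ℓ '' (t : Set V)))) :=
  isNoetherianRing_of_surjective _ _ hd.algEquiv.symm.toAlgHom.toRingHom
    hd.algEquiv.symm.surjective

theorem IsDualBasis.prime_single (hd : IsDualBasis ℓ t d) {v : V} (hv : v ∈ t) :
    Prime (AddMonoidAlgebra.single ⟨d v, hd.mem_dualMonoid hv⟩ 1 :
      coordRing (coneOf (ℓ '' (t : Set V)))) := by
  rw [← MulEquiv.prime_iff hd.algEquiv.toMulEquiv]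
  have h1 : hd.algEquiv (AddMonoidAlgebra.single ⟨d v, hd.mem_dualMonoid hv⟩ 1) =
      MvPolynomial.X ⟨v, hv⟩ := by
    rw [IsDualBasis.algEquiv, AddMonoidAlgebra.domCongr_single]
    refine congrArg (fun e => AddMonoidAlgebra.single e (1 : ℂ)) ?_
    ext w
    simp only [IsDualBasis.addEquiv, AddEquiv.coe_mk, Equiv.coe_fn_mk]
    change (d v ⬝ᵥ ℓ w).toNat = _
    rw [hd.dot_eq v hv w w.2, Finsupp.single_apply]
    simp only [Subtype.ext_iff]
    split <;> rfl
  change Prime (hd.algEquiv _)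
  rw [h1]
  exact MvPolynomial.X_prime

/-- The value of a function on the affine toric variety of a unimodular cone at its fixed point. -/
noncomputable def IsDualBasis.fixedPoint (hd : IsDualBasis ℓ t d) :
    coordRing (coneOf (ℓ '' (t : Set V))) →ₐ[ℂ] ℂ :=
  (MvPolynomial.aeval fun _ => (0 : ℂ)).comp hd.algEquiv.toAlgHom

theorem IsDualBasis.fixedPoint_apply (hd : IsDualBasis ℓ t d)
    (f : coordRing (coneOf (ℓ '' (t : Set V)))) : hd.fixedPoint f = f.coeff 0 := by
  change MvPolynomial.aeval (fun _ => (0 : ℂ)) (hd.algEquiv f) = _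
  rw [MvPolynomial.aeval_zero', MvPolynomial.constantCoeff_eq, Algebra.algebraMap_self,
    RingHom.id_apply]
  change (AddMonoidAlgebra.domCongr ℂ ℂ hd.addEquiv f).coeff 0 = _
  rw [AddMonoidAlgebra.coeff_domCongr, map_zero]

/-- In a factorial ring, if the fractions `g k / g l` are regular where `s` does not vanish, and the
`g k` have no common factor, then `g l` does not vanish either where `s` does not. Here the common
factors are excluded separately for the prime factors of `x` and away from the zeros of `x`. -/
theorem notMem_of_forall_mul_eq {A L : Type} [CommRing A] [IsDomain A]
    [UniqueFactorizationMonoid A] [CommRing L] [Algebra A L] (x : A) [IsLocalization.Away x L]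
    {κ : Type} {g : κ → A} (hL : ∀ q, (∀ k, q ∣ g k) → IsUnit (algebraMap A L q))
    (hx : ∀ q, Prime q → q ∣ x → ∃ k, ¬ q ∣ g k) (P : Ideal A) [P.IsPrime] {l : κ}
    (hl : g l ≠ 0) {s : A} (hs : s ∉ P) (h : ∀ k, ∃ a e, a * g l = s ^ e * g k) : g l ∉ P := by
  intro hmem
  obtain ⟨q, hq, hqP, hql⟩ : ∃ q, Prime q ∧ q ∈ P ∧ q ∣ g l := by
    obtain ⟨M, hM, u, hu⟩ := UniqueFactorizationMonoid.exists_prime_factors (g l) hl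
    have h1 : M.prod ∈ P := by
      rw [← hu] at hmem
      exact (Ideal.IsPrime.mem_or_mem inferInstance hmem).resolve_right fun hu' =>
        Ideal.IsPrime.ne_top inferInstance (Ideal.eq_top_of_isUnit_mem _ hu' u.isUnit)
    obtain ⟨q, hqM, hqP⟩ := (Ideal.IsPrime.multiset_prod_mem_iff_exists_mem inferInstance M).mp h1
    exact ⟨q, hM q hqM, hqP, (Multiset.dvd_prod hqM).trans ⟨u, hu.symm⟩⟩
  have hqg : ∀ k, q ∣ g k := by
    intro k
    obtain ⟨a, e, hae⟩ := h k
    have h2 : q ∣ s ^ e * g k := hae ▸ hql.mul_left a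
    refine (hq.dvd_or_dvd h2).resolve_left fun h3 => hs ?_
    exact Ideal.mem_of_dvd P (hq.dvd_of_dvd_pow h3) hqP
  obtain ⟨e, he⟩ := (IsLocalization.Away.algebraMap_isUnit_iff x).mp (hL q hqg)
  obtain ⟨k, hk⟩ := hx q hq (hq.dvd_of_dvd_pow he)
  exact hk (hqg k)

/-- Finitely many elements of the fraction field of a noetherian domain, not all zero, have a common
denominator for which the numerators have no common factor. -/
theorem exists_coprime_numerators {L K : Type} [CommRing L] [IsDomain L] [IsNoetherianRing L]
    [Field K] [Algebra L K] [IsFractionRing L K] {κ : Type} [Fintype κ] (r : κ → K) {k₀ : κ}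
    (h1 : r k₀ = 1) :
    ∃ g : κ → L, g k₀ ≠ 0 ∧ (∀ k, algebraMap L K (g k) = r k * algebraMap L K (g k₀)) ∧
      ∀ q, (∀ k, q ∣ g k) → IsUnit q := by
  let S : Set L := {b | b ≠ 0 ∧ ∃ g : κ → L, g k₀ = b ∧
    ∀ k, algebraMap L K (g k) = r k * algebraMap L K b}
  have hS : S.Nonempty := by
    obtain ⟨b, hb⟩ := IsLocalization.exist_integer_multiples_of_finite (nonZeroDivisors L) r
    choose g hg using hb
    have hb0 : (b : L) ≠ 0 := nonZeroDivisors.ne_zero b.2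
    refine ⟨g k₀, ?_, g, rfl, fun k => ?_⟩
    · intro h0
      have := hg k₀
      rw [h0, map_zero, h1, Algebra.smul_def, mul_one] at this
      exact hb0 ((IsFractionRing.to_map_eq_zero_iff (K := K)).mp this.symm)
    · rw [hg k, hg k₀, h1, Algebra.smul_def, Algebra.smul_def, mul_one, mul_comm]
  obtain ⟨b, ⟨hb0, g, rfl, hg⟩, hmin⟩ :=
    (WellFounded.wellFounded_iff_has_min.mp
      (wellFounded_dvdNotUnit (α := L))) S hS
  refine ⟨g, hb0, hg, fun q hq => ?_⟩
  by_contra hunit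
  choose g' hg' using hq
  have hq0 : q ≠ 0 := fun h0 => hb0 (by rw [hg' k₀, h0, zero_mul])
  have hg'0 : g' k₀ ≠ 0 := fun h0 => hb0 (by rw [hg' k₀, h0, mul_zero])
  refine hmin (g' k₀) ⟨hg'0, g', rfl, fun k => ?_⟩ ⟨hg'0, q, hunit, by rw [hg' k₀, mul_comm]⟩
  have h2 := hg k
  rw [hg' k, hg' k₀, map_mul, map_mul] at h2
  have h3 : algebraMap L K q ≠ 0 := fun h0 =>
    hq0 ((IsFractionRing.to_map_eq_zero_iff (K := K)).mp h0)
  refine mul_left_cancel₀ h3 ?_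
  rw [h2]
  ring

end CoordinateRings

end ToricNeighborly

namespace ToricNeighborly

/-! ### Laurent polynomials without common factor at a fixed point -/

section Torus

variable {n : ℕ} {V : Type} {ℓ d : V → Fin n → ℤ} {t : Finset V}

/-- The coordinate ring of the torus: its monoid consists of all covectors. -/
abbrev torusRing (ℓ : V → Fin n → ℤ) : Type := coordRing (coneOf (ℓ '' ((∅ : Finset V) : Set V)))

/-- A covector as an exponent of Laurent monomials. -/
def torusExp (ℓ : V → Fin n → ℤ) (u : Fin n → ℤ) :
    dualMonoid (coneOf (ℓ '' ((∅ : Finset V) : Set V))) :=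
  ⟨u, mem_dualMonoid_coneOf.mpr fun v hv => by simp at hv⟩

theorem coneOf_empty_le (ℓ : V → Fin n → ℤ) (t : Finset V) :
    coneOf (ℓ '' ((∅ : Finset V) : Set V)) ≤ coneOf (ℓ '' (t : Set V)) :=
  coneOf_mono (Set.image_mono (Finset.coe_subset.mpr (Finset.empty_subset t)))

/-- The restriction of functions to the torus. -/
noncomputable def toTorus (ℓ : V → Fin n → ℤ) (t : Finset V) :
    coordRing (coneOf (ℓ '' (t : Set V))) →ₐ[ℂ] torusRing ℓ where
  __ := AddMonoidAlgebra.mapDomainRingHom ℂ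
    (AddSubmonoid.inclusion (dualMonoid_anti (coneOf_empty_le ℓ t)))
  commutes' r := by
    change AddMonoidAlgebra.mapDomain _ (algebraMap ℂ _ r) = algebraMap ℂ _ r
    rw [AddMonoidAlgebra.coe_algebraMap, AddMonoidAlgebra.coe_algebraMap]
    exact AddMonoidAlgebra.mapDomain_single

theorem toTorus_single (p : dualMonoid (coneOf (ℓ '' (t : Set V)))) (r : ℂ) :
    toTorus ℓ t (AddMonoidAlgebra.single p r) = AddMonoidAlgebra.single (torusExp ℓ p) r :=
  AddMonoidAlgebra.mapDomain_single

theorem toTorus_injective (ℓ : V → Fin n → ℤ) (t : Finset V) :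
    Function.Injective (toTorus ℓ t) :=
  AddMonoidAlgebra.mapDomain_injective (AddSubmonoid.inclusion_injective _)

theorem coeff_toTorus (f : coordRing (coneOf (ℓ '' (t : Set V))))
    (p : dualMonoid (coneOf (ℓ '' (t : Set V)))) :
    (toTorus ℓ t f).coeff (torusExp ℓ p) = f.coeff p := by
  change (AddMonoidAlgebra.mapDomain _ f).coeff _ = _
  rw [AddMonoidAlgebra.coeff_mapDomain]
  exact Finsupp.mapDomain_apply (AddSubmonoid.inclusion_injective _) _ _

theorem isUnit_single_torusExp (u : Fin n → ℤ) :
    IsUnit (AddMonoidAlgebra.single (torusExp ℓ u) (1 : ℂ) : torusRing ℓ) := by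
  refine IsUnit.of_mul_eq_one (AddMonoidAlgebra.single (torusExp ℓ (-u)) 1) ?_
  rw [AddMonoidAlgebra.single_mul_single, one_mul, AddMonoidAlgebra.one_def]
  congr 1
  ext1
  exact add_neg_cancel u

/-- A Laurent polynomial is a monomial times a function on an affine chart as soon as its exponents
lie in the translated dual cone. -/
theorem exists_eq_single_mul_toTorus (g : torusRing ℓ) (m : Fin n → ℤ)
    (h : ∀ p, g.coeff p ≠ 0 → ∀ v ∈ t, m ⬝ᵥ ℓ v ≤ (p : Fin n → ℤ) ⬝ᵥ ℓ v) :
    ∃ g', g = AddMonoidAlgebra.single (torusExp ℓ m) 1 * toTorus ℓ t g' := by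
  rw [← g.sum_coeff_single, Finsupp.sum]
  have key : ∀ p ∈ g.coeff.support, ∃ q : dualMonoid (coneOf (ℓ '' (t : Set V))),
      AddMonoidAlgebra.single p (g.coeff p) =
        AddMonoidAlgebra.single (torusExp ℓ m) 1 *
          toTorus ℓ t (AddMonoidAlgebra.single q (g.coeff p)) := by
    intro p hp
    refine ⟨⟨p - m, sub_mem_dualMonoid_of_le (h p (Finsupp.mem_support_iff.mp hp))⟩, ?_⟩
    rw [toTorus_single, AddMonoidAlgebra.single_mul_single, one_mul]
    congr 1
    ext1
    exact (add_sub_cancel m (p : Fin n → ℤ)).symm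
  choose! q hq using key
  refine ⟨∑ p ∈ g.coeff.support, AddMonoidAlgebra.single (q p) (g.coeff p), ?_⟩
  rw [map_sum, Finset.mul_sum]
  exact Finset.sum_congr rfl hq

theorem coeff_single_mul_toTorus (g' : coordRing (coneOf (ℓ '' (t : Set V)))) (m : Fin n → ℤ)
    (p : dualMonoid (coneOf (ℓ '' (t : Set V)))) :
    (AddMonoidAlgebra.single (torusExp ℓ m) 1 * toTorus ℓ t g').coeff (torusExp ℓ (m + p)) =
      g'.coeff p := by
  have h1 : torusExp ℓ (m + p) = torusExp ℓ m + torusExp ℓ p := rfl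
  rw [h1, AddMonoidAlgebra.coeff_single_mul_add, one_mul, coeff_toTorus]

variable [DecidableEq V]

/-- Suppose that Laurent polynomials `g k` without common factor define, near the fixed point of a
chart, regular homogeneous coordinates. Then the one that does not vanish there has the vertex `m`
of the smallest translated dual cone that contains all exponents among its exponents, and the values
at the fixed point are the ratios of the coefficients at `m`. -/
theorem IsDualBasis.coeff_ne_zero (hd : IsDualBasis ℓ t d) {κ : Type} {g : κ → torusRing ℓ}
    (hcop : ∀ q, (∀ k, q ∣ g k) → IsUnit q) {m : Fin n → ℤ}
    (hle : ∀ k p, (g k).coeff p ≠ 0 → ∀ v ∈ t, m ⬝ᵥ ℓ v ≤ (p : Fin n → ℤ) ⬝ᵥ ℓ v)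
    (hmin : ∀ v ∈ t, ∃ k p, (g k).coeff p ≠ 0 ∧ (p : Fin n → ℤ) ⬝ᵥ ℓ v = m ⬝ᵥ ℓ v)
    {l : κ} (hl : g l ≠ 0) {s : coordRing (coneOf (ℓ '' (t : Set V)))} (hs : hd.fixedPoint s ≠ 0)
    {a : κ → coordRing (coneOf (ℓ '' (t : Set V)))} {e : κ → ℕ}
    (h : ∀ k, toTorus ℓ t (a k) * g l = toTorus ℓ t s ^ e k * g k) :
    (g l).coeff (torusExp ℓ m) ≠ 0 ∧ ∀ k, hd.fixedPoint (a k) * (g l).coeff (torusExp ℓ m) =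
      hd.fixedPoint s ^ e k * (g k).coeff (torusExp ℓ m) := by
  choose g' hg' using fun k => exists_eq_single_mul_toTorus (g k) m (hle k)
  have hcoeff : ∀ k (p : dualMonoid (coneOf (ℓ '' (t : Set V)))),
      (g k).coeff (torusExp ℓ (m + p)) = (g' k).coeff p := fun k p => by
    rw [hg' k, coeff_single_mul_toTorus]
  have hfix : ∀ k, (g k).coeff (torusExp ℓ m) = hd.fixedPoint (g' k) := fun k => by
    rw [hd.fixedPoint_apply, ← hcoeff, AddSubmonoid.coe_zero, add_zero]
  have hrel : ∀ k, a k * g' l = s ^ e k * g' k := by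
    intro k
    apply toTorus_injective ℓ t
    apply (isUnit_single_torusExp (ℓ := ℓ) m).mul_left_cancel
    have h1 := h k
    rw [hg' k, hg' l] at h1
    rw [map_mul, map_mul, map_pow]
    linear_combination h1
  have := hd.isDomain
  have : UniqueFactorizationMonoid (coordRing (coneOf (ℓ '' (t : Set V)))) :=
    hd.algEquiv.symm.toMulEquiv.uniqueFactorizationMonoid inferInstance
  let M : dualMonoid (coneOf (ℓ '' (t : Set V))) :=
    ∑ v : t, ⟨d v, hd.mem_dualMonoid v.2⟩
  have hM : (M : Fin n → ℤ) = ∑ v ∈ t, d v := by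
    rw [AddSubmonoid.coe_finsetSum]
    exact Finset.sum_coe_sort t d
  have hx : (AddMonoidAlgebra.single M 1 : coordRing (coneOf (ℓ '' (t : Set V)))) =
      ∏ v : t, AddMonoidAlgebra.single ⟨d v, hd.mem_dualMonoid v.2⟩ 1 := by
    have h1 := map_prod (AddMonoidAlgebra.of ℂ (dualMonoid (coneOf (ℓ '' (t : Set V)))))
      (fun v : t => Multiplicative.ofAdd ⟨d v, hd.mem_dualMonoid v.2⟩) Finset.univ
    exact h1
  let _ := (AddMonoidAlgebra.mapDomainRingHom ℂ
      (AddSubmonoid.inclusion (dualMonoid_anti (coneOf_empty_le ℓ t)))).toAlgebra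
  have hloc : IsLocalization.Away (AddMonoidAlgebra.single M (1 : ℂ)) (torusRing ℓ) := by
    refine isLocalization_away_single (coneOf_empty_le ℓ t) M (fun v hv => by simp at hv)
      fun v hv _ => ?_
    rw [hM, sum_dotProduct, Finset.sum_congr rfl fun w hw => hd.dot_eq w hw v hv,
      Finset.sum_ite_eq', if_pos hv]
    exact one_pos
  have hgl : g' l ≠ 0 := fun h0 => hl (by rw [hg' l, h0, map_zero, mul_zero])
  have hP : (RingHom.ker hd.fixedPoint).IsPrime := RingHom.ker_isPrime _
  have hne : g' l ∉ RingHom.ker hd.fixedPoint := by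
    refine notMem_of_forall_mul_eq (A := coordRing (coneOf (ℓ '' (t : Set V)))) (L := torusRing ℓ)
      (AddMonoidAlgebra.single M (1 : ℂ)) (g := g') ?_ ?_ (RingHom.ker hd.fixedPoint) hgl
      (s := s) hs fun k => ⟨a k, e k, hrel k⟩
    · intro q hq
      refine hcop _ fun k => ?_
      rw [hg' k]
      exact Dvd.dvd.mul_left (map_dvd (toTorus ℓ t) (hq k)) _
    · intro q hq hqx
      rw [hx] at hqx
      obtain ⟨v, -, hv⟩ := (Prime.dvd_finsetProd_iff hq _).mp hqx
      have hassoc := hq.associated_of_dvd (hd.prime_single v.2) hv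
      obtain ⟨k, p, hp, hpv⟩ := hmin v v.2
      refine ⟨k, fun hqk => ?_⟩
      obtain ⟨f, hf⟩ := hassoc.symm.dvd.trans hqk
      let p' : dualMonoid (coneOf (ℓ '' (t : Set V))) :=
        ⟨p - m, sub_mem_dualMonoid_of_le (hle k p hp)⟩
      have h1 : (g' k).coeff p' ≠ 0 := by
        rw [← hcoeff k p']
        convert hp
        exact Subtype.ext (add_sub_cancel m (p : Fin n → ℤ))
      rw [hf] at h1
      refine h1 (AddMonoidAlgebra.coeff_single_mul_of_forall_add_ne _ _ fun w hw => ?_)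
      have h2 := congrArg (fun y : dualMonoid (coneOf (ℓ '' (t : Set V))) =>
        (y : Fin n → ℤ) ⬝ᵥ ℓ v) hw
      simp only [AddSubmonoid.coe_add, add_dotProduct, p', sub_dotProduct, hpv] at h2
      rw [hd.dot_eq v v.2 v v.2, if_pos rfl] at h2
      have := mem_dualMonoid_coneOf.mp w.2 v v.2
      omega
  refine ⟨fun h0 => hne ?_, fun k => ?_⟩
  · rw [RingHom.mem_ker, ← hfix, h0]
  · have h1 := congrArg hd.fixedPoint (hrel k)
    rwa [map_mul, map_mul, map_pow, ← hfix, ← hfix] at h1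

end Torus

end ToricNeighborly

namespace ToricNeighborly
open CategoryTheory AlgebraicGeometry

/-! ### The support function of a projective embedding -/

section Support

open MvPolynomial

/-- A morphism from an affine scheme to `ℙ^N` is given near a `ℂ`-point by homogeneous coordinates,
with a common denominator cleared. -/
theorem exists_local_coordinates {N : ℕ} {A : Type} [CommRing A] [Algebra ℂ A]
    (ψ : Spec (CommRingCat.of A) ⟶ Proj (homogCoord N))
    (hψ : ψ ≫ (projectiveSpace N).hom = Spec.map (CommRingCat.ofHom (algebraMap ℂ A)))
    (ε : A →ₐ[ℂ] ℂ) :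
    ∃ (s : A) (a : Fin (N + 1) → A) (l : Fin (N + 1)), ε s ≠ 0 ∧
      ∀ (R : Type) [CommRing R] [Algebra ℂ R] (β : A →ₐ[ℂ] R), IsUnit (β s) →
        ∃ h : IsUnit (β (a l)),
          Spec.map (CommRingCat.ofHom β.toRingHom) ≫ ψ = projPointX (fun k => β (a k)) l h := by
  let x : Spec (CommRingCat.of A) := ⟨RingHom.ker ε, RingHom.ker_isPrime _⟩
  obtain ⟨l, hl⟩ := TopologicalSpace.Opens.mem_iSup.mp
      ((iSup_basicOpen_X N).ge (TopologicalSpace.Opens.mem_top (ψ x)))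
  obtain ⟨_, ⟨s, rfl⟩, hxs, hsub⟩ :=
    PrimeSpectrum.isTopologicalBasis_basic_opens.exists_subset_of_mem_open
      (show x ∈ (ψ ⁻¹ᵁ Proj.basicOpen (homogCoord N) (X l) : Set (Spec (CommRingCat.of A))) from hl)
      (ψ ⁻¹ᵁ Proj.basicOpen (homogCoord N) (X l)).2
  let B := Localization.Away s
  let γ : A →ₐ[ℂ] B := IsScalarTower.toAlgHom ℂ A B
  obtain ⟨r, hr1, hr, hψr⟩ := exists_eq_projPointX
    (Spec.map (CommRingCat.ofHom γ.toRingHom) ≫ ψ) (by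
      refine (Category.assoc _ _ _).trans ((congrArg (Spec.map _ ≫ ·) hψ).trans ?_)
      rw [← Spec.map_comp, ← CommRingCat.ofHom_comp]
      rfl) l (fun y => by
      have h1 : Spec.map (CommRingCat.ofHom γ.toRingHom) y ∈
          (PrimeSpectrum.basicOpen s : Set (PrimeSpectrum A)) := by
        rw [← PrimeSpectrum.localization_away_comap_range B s]
        exact ⟨y, rfl⟩
      exact hsub h1)
  obtain ⟨b, hb⟩ := IsLocalization.exist_integer_multiples_of_finite (Submonoid.powers s) r
  choose a ha using hb
  refine ⟨s, a, l, fun h0 => hxs (RingHom.mem_ker.mpr h0), fun R _ _ β hβ => ?_⟩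
  let β' : B →ₐ[ℂ] R := IsLocalization.liftAlgHom (M := Submonoid.powers s) (f := β) (by
    rintro ⟨_, e, rfl⟩
    rw [map_pow]
    exact hβ.pow e)
  have hβ' : ∀ y, β' (algebraMap A B y) = β y := fun y => IsLocalization.lift_eq _ y
  have hbu : IsUnit (β b) := by
    obtain ⟨e, he⟩ := b.2
    rw [← he, map_pow]
    exact hβ.pow e
  have hk : ∀ k, β (a k) = β b * β' (r k) := by
    intro k
    rw [← hβ' (a k), ha k, Algebra.smul_def, map_mul, hβ']
  have hcomp : Spec.map (CommRingCat.ofHom β.toRingHom) =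
      Spec.map (CommRingCat.ofHom β'.toRingHom) ≫ Spec.map (CommRingCat.ofHom γ.toRingHom) := by
    rw [← Spec.map_comp, ← CommRingCat.ofHom_comp]
    congr 2
    exact RingHom.ext fun y => (hβ' y).symm
  have hal : IsUnit (β (a l)) := by
    rw [hk, hr1, map_one, mul_one]
    exact hbu
  refine ⟨hal, ?_⟩
  rw [hcomp, Category.assoc, hψr, Spec_map_projPointX β' r hr (by
    rw [hr1, map_one]
    exact isUnit_one)]
  exact projPointX_congr hk hbu

/-- A morphism from a noetherian integral affine scheme to `ℙ^N` is given at the generic point by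
homogeneous coordinates without common factor. -/
theorem exists_generic_coordinates {N : ℕ} {L : Type} [CommRing L] [IsDomain L] [IsNoetherianRing L]
    [Algebra ℂ L] (ψ : Spec (CommRingCat.of L) ⟶ Proj (homogCoord N))
    (hψ : ψ ≫ (projectiveSpace N).hom = Spec.map (CommRingCat.ofHom (algebraMap ℂ L))) :
    ∃ (g : Fin (N + 1) → L) (k₀ : Fin (N + 1)), g k₀ ≠ 0 ∧ (∀ q, (∀ k, q ∣ g k) → IsUnit q) ∧
      ∃ h : IsUnit (algebraMap L (FractionRing L) (g k₀)),
        Spec.map (CommRingCat.ofHom (algebraMap L (FractionRing L))) ≫ ψ =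
          projPointX (fun k => algebraMap L (FractionRing L) (g k)) k₀ h := by
  let x : Spec (CommRingCat.of (FractionRing L)) := ⟨⊥, Ideal.isPrime_bot⟩
  have hx : ∀ y : Spec (CommRingCat.of (FractionRing L)), y = x := fun y =>
    PrimeSpectrum.ext ((Ideal.eq_bot_or_top y.asIdeal).resolve_right y.2.ne_top)
  let ψ' := Spec.map (CommRingCat.ofHom (algebraMap L (FractionRing L))) ≫ ψ
  obtain ⟨k₀, hk₀⟩ := TopologicalSpace.Opens.mem_iSup.mp
      ((iSup_basicOpen_X N).ge (TopologicalSpace.Opens.mem_top (ψ' x)))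
  obtain ⟨r, hr1, hr, hψr⟩ := exists_eq_projPointX ψ' (by
      refine (Category.assoc _ _ _).trans ((congrArg (Spec.map _ ≫ ·) hψ).trans ?_)
      rw [← Spec.map_comp, ← CommRingCat.ofHom_comp]) k₀ (fun y => by rw [hx y]; exact hk₀)
  obtain ⟨g, hg0, hg, hcop⟩ := exists_coprime_numerators (L := L) r hr1
  have hu : IsUnit (algebraMap L (FractionRing L) (g k₀)) :=
    isUnit_iff_ne_zero.mpr fun h0 =>
      hg0 ((IsFractionRing.to_map_eq_zero_iff (K := FractionRing L)).mp h0)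
  refine ⟨g, k₀, hg0, hcop, hu, hψr.trans ?_⟩
  exact projPointX_congr (fun k => (hg k).trans (mul_comm _ _)) hu

variable {n : ℕ} {V : Type} [DecidableEq V] {T : Finset (Finset V)} {ℓ : V → Fin n → ℤ}

/-- The fixed points of two different maximal charts are different. -/
theorem IsUnimodularFan.fixedPoint_notMem_range (hU : IsUnimodularFan T ℓ) {s t : Finset V}
    (hs : s ∈ T) (ht : t ∈ T) (hst : s ≠ t) {d : V → Fin n → ℤ} (hd : IsDualBasis ℓ s d)
    {τ : PointedCone ℝ (Fin n → ℝ)}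
    (hτ : τ = coneOf (ℓ '' (s : Set V)) ⊓ coneOf (ℓ '' (t : Set V)))
    (hle : τ ≤ coneOf (ℓ '' (s : Set V))) (x : specC) :
    Spec.map (CommRingCat.ofHom hd.fixedPoint.toRingHom) x ∉ Set.range (affineToricMap hle) := by
  obtain ⟨d', hd'⟩ := hU.exists_dual t ht
  rw [hU.inf_eq hs ht subset_rfl subset_rfl] at hτ
  subst hτ
  obtain ⟨m, h0, h1⟩ := hd.exists_supporting (Finset.inter_subset_left (s₁ := s) (s₂ := t))
  obtain ⟨v, hvs, hvt⟩ : ∃ v ∈ s, v ∉ t := by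
    by_contra! hc
    exact hst (Finset.eq_of_subset_of_card_le hc (by rw [hd.card_eq, hd'.card_eq]))
  have hvn : v ∉ s ∩ t := fun h => hvt (Finset.mem_inter.mp h).2
  have hm : m ∈ dualMonoid (coneOf (ℓ '' (s : Set V))) := mem_dualMonoid_coneOf.mpr fun w hw => by
    by_cases hws : w ∈ s ∩ t
    · rw [h0 w hws]
    · rw [h1 w hw hws]
      exact zero_le_one
  rw [(isOpenImmersion_affineToricMap hle ⟨m, hm⟩ h0 fun w hw hws => by
    rw [h1 w hw hws]; exact one_pos).2]
  have h2 : hd.fixedPoint (AddMonoidAlgebra.single ⟨m, hm⟩ 1) = 0 := by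
    rw [hd.fixedPoint_apply, AddMonoidAlgebra.coeff_single, Finsupp.single_apply, if_neg]
    intro hc
    have h3 := h1 v hvs hvn
    rw [show m = 0 from congrArg Subtype.val hc, zero_dotProduct] at h3
    exact zero_ne_one h3
  intro hmem
  refine hmem ?_
  change hd.fixedPoint (AddMonoidAlgebra.single ⟨m, hm⟩ 1) ∈ x.asIdeal
  rw [h2]
  exact x.asIdeal.zero_mem

/-- A projective embedding of a toric manifold yields an integral support function `h`, with the
linear function `m t` on the cone of `t`, that is concave and has different linear functions on
different maximal cones. -/
theorem IsFanOf.exists_support {K : AbstractSimplicialComplex V} {F : Fan n} {X : Over specC}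
    (hF : IsFanOf K ℓ F) (hK : HasFacets K T) (hX : IsToricVarietyOf F X) (hp : IsProjective X) :
    ∃ (h : V → ℤ) (m : Finset V → Fin n → ℤ), ∀ t ∈ T, (∀ v, h v ≤ m t ⬝ᵥ ℓ v) ∧
      (∀ v ∈ t, m t ⬝ᵥ ℓ v = h v) ∧ ∀ s ∈ T, m s = m t → s = t := by
  obtain ⟨A⟩ := hX
  obtain ⟨N, i, hi⟩ := hp
  have hU := hF.isUnimodularFan hK
  choose! d hd using hU.exists_dual
  obtain ⟨t₀, ht₀⟩ := hK.nonempty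
  let τ₀ : F.cones := ⟨_, hF.coneOf_mem hK ht₀ (Finset.empty_subset t₀)⟩
  let c : T → F.cones := fun t => ⟨_, hF.coneOf_mem hK t.2 subset_rfl⟩
  let ψ : ∀ σ : F.cones, affineToric σ.1 ⟶ Proj (homogCoord N) := fun σ => A.chart σ ≫ i.left
  have hψ : ∀ σ, ψ σ ≫ (projectiveSpace N).hom = affineToricStr σ.1 := fun σ =>
    (Category.assoc _ _ _).trans
      ((congrArg (A.chart σ ≫ ·) (Over.w i)).trans (A.chart_over σ))
  have hψτ : ∀ t : T, Spec.map (CommRingCat.ofHom (toTorus ℓ t.1).toRingHom) ≫ ψ (c t) = ψ τ₀ := by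
    intro t
    have h1 := A.map_chart (c t) τ₀ (coneOf_empty_le ℓ t)
    exact (Category.assoc _ _ _).symm.trans (congrArg (· ≫ i.left) h1)
  have hdom : IsDomain (torusRing ℓ) ∧ IsNoetherianRing (torusRing ℓ) := by
    obtain ⟨m, h0, h1⟩ := (hd t₀ ht₀).exists_supporting (Finset.empty_subset t₀)
    have := (hd t₀ ht₀).isDomain
    have := (hd t₀ ht₀).isNoetherianRing
    have hm : m ∈ dualMonoid (coneOf (ℓ '' (t₀ : Set V))) := mem_dualMonoid_coneOf.mpr
      fun w hw => by
        rw [h1 w hw (Finset.notMem_empty w)]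
        exact zero_le_one
    let _ := (AddMonoidAlgebra.mapDomainRingHom ℂ
      (AddSubmonoid.inclusion (dualMonoid_anti (coneOf_empty_le ℓ t₀)))).toAlgebra
    let x : coordRing (coneOf (ℓ '' (t₀ : Set V))) := AddMonoidAlgebra.single ⟨m, hm⟩ 1
    have hloc : IsLocalization.Away x (torusRing ℓ) :=
      isLocalization_away_single (coneOf_empty_le ℓ t₀) ⟨m, hm⟩ h0 fun w hw hws => by
        rw [h1 w hw hws]
        exact one_pos
    refine ⟨IsLocalization.Away.isDomain (x := x) _ ?_, ?_⟩
    · exact AddMonoidAlgebra.single_ne_zero.mpr one_ne_zero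
    · exact IsLocalization.isNoetherianRing
        (Submonoid.powers x) _ inferInstance
  obtain ⟨_, _⟩ := hdom
  obtain ⟨g, k₀, hk₀, hcop, hgu, hg⟩ := exists_generic_coordinates (ψ τ₀) (hψ τ₀)
  let E : Finset (Fin n → ℤ) :=
    Finset.univ.biUnion fun k => (g k).coeff.support.image Subtype.val
  have hE : ∀ u, u ∈ E ↔ ∃ k, (g k).coeff (torusExp ℓ u) ≠ 0 := by
    intro u
    simp only [E, Finset.mem_biUnion, Finset.mem_image, Finset.mem_univ, true_and,
      Finsupp.mem_support_iff]
    refine exists_congr fun k => ⟨?_, fun hk => ⟨_, hk, rfl⟩⟩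
    rintro ⟨p, hp, rfl⟩
    exact hp
  have hEne : E.Nonempty := by
    have h1 : (g k₀).coeff ≠ 0 := fun h0 => hk₀ (AddMonoidAlgebra.ext h0)
    obtain ⟨p, hp⟩ := Finsupp.support_nonempty_iff.mpr h1
    exact ⟨p, (hE p).mpr ⟨k₀, Finsupp.mem_support_iff.mp hp⟩⟩
  let h : V → ℤ := fun v => E.inf' hEne fun u => u ⬝ᵥ ℓ v
  let m : Finset V → Fin n → ℤ := fun t => ∑ v ∈ t, h v • d t v
  have hm : ∀ t ∈ T, ∀ v ∈ t, m t ⬝ᵥ ℓ v = h v := by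
    intro t ht v hv
    rw [sum_dotProduct, Finset.sum_eq_single_of_mem v hv fun w hw hwv => by
      rw [smul_dotProduct, (hd t ht).dot_eq w hw v hv, if_neg hwv, smul_zero],
      smul_dotProduct, (hd t ht).dot_eq v hv v hv, if_pos rfl, smul_eq_mul, mul_one]
  have hle : ∀ u ∈ E, ∀ v, h v ≤ u ⬝ᵥ ℓ v := fun u hu v =>
    Finset.inf'_le (fun u => u ⬝ᵥ ℓ v) hu
  -- near the fixed point of a chart, the coordinates `g k` take the values of the coefficients
  have key : ∀ t : T, ∃ (l : Fin (N + 1))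
      (hl : IsUnit ((g l).coeff (torusExp ℓ (m t)))),
      Spec.map (CommRingCat.ofHom (hd t t.2).fixedPoint.toRingHom) ≫ ψ (c t) =
        projPointX (fun k => (g k).coeff (torusExp ℓ (m t))) l hl := by
    intro t
    obtain ⟨s, a, l, hs, hloc⟩ := exists_local_coordinates (ψ (c t)) (hψ (c t))
      (hd t t.2).fixedPoint
    obtain ⟨hu, hfix⟩ := hloc ℂ (hd t t.2).fixedPoint (isUnit_iff_ne_zero.mpr hs)
    let η : torusRing ℓ →ₐ[ℂ] FractionRing (torusRing ℓ) :=
      IsScalarTower.toAlgHom ℂ (torusRing ℓ) (FractionRing (torusRing ℓ))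
    have hη : Function.Injective η :=
      IsFractionRing.injective (torusRing ℓ) (FractionRing (torusRing ℓ))
    have hs0 : η (toTorus ℓ t s) ≠ 0 := by
      rw [Ne, map_eq_zero_iff _ hη, map_eq_zero_iff _ (toTorus_injective ℓ t)]
      rintro rfl
      exact hs (map_zero _)
    obtain ⟨hu', hgen⟩ := hloc _ (η.comp (toTorus ℓ t)) (isUnit_iff_ne_zero.mpr hs0)
    have hcomp : Spec.map (CommRingCat.ofHom (η.comp (toTorus ℓ t)).toRingHom) ≫ ψ (c t) =
        projPointX (fun k => algebraMap _ (FractionRing (torusRing ℓ)) (g k)) k₀ hgu := by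
      rw [← hg, ← hψτ t, ← Category.assoc, ← Spec.map_comp, ← CommRingCat.ofHom_comp]
      rfl
    have hrel : ∀ k, toTorus ℓ t (a k) * g l = g k * toTorus ℓ t (a l) := fun k =>
      hη ((map_mul η _ _).trans ((mul_eq_mul_of_projPointX_eq (hgen.symm.trans hcomp) k).trans
        (map_mul η _ _).symm))
    have hl0 : g l ≠ 0 := by
      intro h0
      have h1 := hrel k₀
      rw [h0, mul_zero] at h1
      refine (mul_ne_zero hk₀ fun h2 => ?_) h1.symm
      exact (hu'.ne_zero) (by change η (toTorus ℓ t (a l)) = 0; rw [h2, map_zero])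
    obtain ⟨h1, h2⟩ := (hd t t.2).coeff_ne_zero hcop (m := m t) (fun k p hp v hv => by
        rw [hm t t.2 v hv]
        exact hle p ((hE p).mpr ⟨k, hp⟩) v)
      (fun v hv => by
        obtain ⟨u, hu, huv⟩ := Finset.exists_mem_eq_inf' hEne fun u => u ⬝ᵥ ℓ v
        obtain ⟨k, hk⟩ := (hE u).mp hu
        exact ⟨k, torusExp ℓ u, hk, by rw [hm t t.2 v hv]; exact huv.symm⟩)
      hl0 (s := a l) hu.ne_zero (a := a) (e := fun _ => 1) fun k => by
        rw [hrel k, pow_one, mul_comm]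
    refine ⟨l, isUnit_iff_ne_zero.mpr h1, hfix.trans ?_⟩
    refine projPointX_congr
      (u := (g l).coeff (torusExp ℓ (m t)) / (hd t t.2).fixedPoint (a l)) (fun k => ?_)
      (isUnit_iff_ne_zero.mpr (div_ne_zero h1 hu.ne_zero))
    have h3 := h2 k
    have h4 := hu.ne_zero
    rw [pow_one] at h3
    field_simp
    linear_combination -h3
  refine ⟨h, m, fun t ht => ⟨fun v => ?_, hm t ht, fun s hs hst => ?_⟩⟩
  · obtain ⟨l, hl, -⟩ := key ⟨t, ht⟩
    exact hle _ ((hE _).mpr ⟨l, hl.ne_zero⟩) v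
  · by_contra hne
    obtain ⟨l, hl, hkey⟩ := key ⟨t, ht⟩
    obtain ⟨l', hl', hkey'⟩ := key ⟨s, hs⟩
    have h1 : Spec.map (CommRingCat.ofHom (hd s hs).fixedPoint.toRingHom) ≫ ψ (c ⟨s, hs⟩) =
        Spec.map (CommRingCat.ofHom (hd t ht).fixedPoint.toRingHom) ≫ ψ (c ⟨t, ht⟩) := by
      rw [hkey, hkey']
      simp only [hst]
      exact projPointX_eq _ _ _
    have h2 : Spec.map (CommRingCat.ofHom (hd s hs).fixedPoint.toRingHom) ≫ A.chart (c ⟨s, hs⟩) =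
        Spec.map (CommRingCat.ofHom (hd t ht).fixedPoint.toRingHom) ≫ A.chart (c ⟨t, ht⟩) := by
      rw [← cancel_mono i.left, Category.assoc, Category.assoc]
      exact h1
    let x : specC := ⟨⊥, Ideal.isPrime_bot⟩
    have hmem : A.chart (c ⟨s, hs⟩)
        (Spec.map (CommRingCat.ofHom (hd s hs).fixedPoint.toRingHom) x) ∈
        Set.range (A.chart (F.inter (c ⟨s, hs⟩) (c ⟨t, ht⟩))) := by
      rw [← A.inter]
      exact ⟨⟨_, rfl⟩, ⟨_, ((hom_apply_hom_apply h2 x).trans (Scheme.Hom.comp_apply _ _ x)).symm⟩⟩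
    obtain ⟨y, hy⟩ := hmem
    have hle' : (F.inter (c ⟨s, hs⟩) (c ⟨t, ht⟩)).1 ≤ (c ⟨s, hs⟩).1 := inf_le_left
    refine hU.fixedPoint_notMem_range hs ht (Ne.intro hne) (hd s hs) rfl hle' x ⟨y, ?_⟩
    have := A.isOpenImmersion (c ⟨s, hs⟩)
    refine (A.chart (c ⟨s, hs⟩)).isOpenEmbedding.injective ?_
    exact (hom_apply_hom_apply (A.map_chart _ _ hle') y).trans hy

end Support

end ToricNeighborly

namespace ToricNeighborly

/-! ### Crossing the walls of a unimodular fan -/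

section Walls

variable {n : ℕ} {V : Type} [DecidableEq V] {T : Finset (Finset V)} {ℓ d : V → Fin n → ℤ}

/-- Each member `t` of `T` has, for each `v ∈ t`, a neighbor in `T` in which another vertex takes
the place of `v`. -/
def HasFlips (T : Finset (Finset V)) : Prop :=
  ∀ t ∈ T, ∀ v ∈ t, ∃ v' ∉ t, insert v' (t.erase v) ∈ T

/-- The pairing with a lattice covector as a linear form. -/
def pairDual (m : Fin n → ℤ) : Module.Dual ℝ (Fin n → ℝ) where
  toFun := pair m
  map_add' := pair_add m
  map_smul' := pair_smul m

/-- Across a wall, the new vector is minus the old one modulo the vectors of the wall: it is so up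
to sign since both cones are unimodular, and the other sign would make the cones overlap. -/
theorem IsUnimodularFan.dot_neighbor (hU : IsUnimodularFan T ℓ) {t : Finset V} (ht : t ∈ T)
    (hd : IsDualBasis ℓ t d) {v v' : V} (hv : v ∈ t) (hv' : v' ∉ t)
    (ht' : insert v' (t.erase v) ∈ T) : d v ⬝ᵥ ℓ v' = -1 := by
  obtain ⟨d', hd'⟩ := hU.exists_dual _ ht'
  have hv't' : v' ∈ insert v' (t.erase v) := Finset.mem_insert_self _ _
  have h1 : (d v ⬝ᵥ ℓ v') * (d' v' ⬝ᵥ ℓ v) = 1 := by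
    have h2 := hd'.dot_eq v' hv't' v' hv't'
    rw [if_pos rfl] at h2
    conv_lhs at h2 => rw [hd.eq_sum_int (ℓ v')]
    rwa [dotProduct_sum, Finset.sum_eq_single_of_mem v hv fun w hw hwv => by
      rw [dotProduct_smul, hd'.dot_eq v' hv't' w
        (Finset.mem_insert_of_mem (Finset.mem_erase.mpr ⟨hwv, hw⟩)),
        if_neg fun h : v' = w => hv' (h ▸ hw), smul_zero], dotProduct_smul, smul_eq_mul] at h2
  refine (Int.eq_one_or_neg_one_of_mul_eq_one h1).resolve_left fun hc => ?_
  let N : ℤ := ∑ w ∈ t, |d w ⬝ᵥ ℓ v'|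
  have hN : 0 ≤ N := Finset.sum_nonneg fun _ _ => abs_nonneg _
  let y : Fin n → ℝ := toReal (ℓ v') + ∑ w ∈ t.erase v, (N : ℝ) • toReal (ℓ w)
  have hy : ∀ w ∈ t, pair (d w) y = ((d w ⬝ᵥ ℓ v' + if w = v then 0 else N : ℤ) : ℝ) := by
    intro w hw
    rw [pair_add, pair_toReal, hd.pair_sum_smul (Finset.erase_subset _ _) (fun _ => (N : ℝ)) hw]
    push_cast
    congr 1
    by_cases h : w = v <;> simp [h, hw]
  have hy1 : y ∈ coneOf (ℓ '' (t : Set V)) := by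
    refine (hd.mem_coneOf_iff subset_rfl).mpr ⟨fun w hw => ?_, fun w hw h => absurd hw h⟩
    rw [hy w hw]
    have h3 : -N ≤ d w ⬝ᵥ ℓ v' := (neg_le_neg (Finset.single_le_sum
      (f := fun w => |d w ⬝ᵥ ℓ v'|) (fun _ _ => abs_nonneg _) hw)).trans (neg_abs_le _)
    by_cases h : w = v
    · subst h
      rw [hc]
      simp
    · rw [if_neg h]
      exact_mod_cast (by omega : 0 ≤ d w ⬝ᵥ ℓ v' + N)
  have hy2 : y ∈ coneOf (ℓ '' ((insert v' (t.erase v) : Finset V) : Set V)) := by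
    refine Submodule.add_mem _ (toReal_mem_coneOf ⟨v', hv't', rfl⟩) (Submodule.sum_mem _ ?_)
    intro w hw
    exact Submodule.smul_mem _ (⟨(N : ℝ), by exact_mod_cast hN⟩ : {c : ℝ // 0 ≤ c})
      (toReal_mem_coneOf ⟨w, Finset.mem_insert_of_mem hw, rfl⟩)
  have h4 := ((hd.mem_coneOf_iff Finset.inter_subset_left).mp
    (hU.inter t ht _ ht' ⟨hy1, hy2⟩)).2 v hv (by
      simp only [Finset.mem_inter, Finset.mem_insert, Finset.mem_erase, ne_eq, not_true_eq_false,
        false_and, or_false, not_and]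
      exact fun _ h => hv' (h ▸ hv))
  rw [hy v hv, hc] at h4
  simp at h4

/-- The cones of a unimodular fan without boundary cover the space. -/
theorem IsUnimodularFan.exists_mem_coneOf (hU : IsUnimodularFan T ℓ) (hT : HasFlips T)
    (x : Fin n → ℝ) : ∃ t ∈ T, x ∈ coneOf (ℓ '' (t : Set V)) := by
  obtain ⟨t, ht, c, hc, hx⟩ := exists_mem_cone (u := fun v => toReal (ℓ v)) hU.nonempty
    (fun t ht => by
      obtain ⟨d, hd⟩ := hU.exists_dual t ht
      refine ⟨fun v => pairDual (d v), hd.card_eq, fun v hv => ?_, fun v hv w hw hvw => ?_,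
        fun v hv => ?_⟩
      · change 0 < pair (d v) _
        rw [pair_toReal, hd.dot_eq v hv v hv, if_pos rfl]
        simp
      · change pair (d v) _ = 0
        rw [pair_toReal, hd.dot_eq v hv w hw, if_neg hvw]
        simp
      · obtain ⟨v', hv', ht'⟩ := hT t ht v hv
        refine ⟨v', hv', ht', ?_⟩
        change pair (d v) _ < 0
        rw [pair_toReal, hU.dot_neighbor ht hd hv hv' ht']
        simp) x
  exact ⟨t, ht, mem_coneOf.mpr ⟨c, hc, hx⟩⟩

/-- The determinant of the vectors of a cone, in order, changes its sign when a wall is crossed. -/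
theorem IsUnimodularFan.det_update (hU : IsUnimodularFan T ℓ) {e : Fin n → V}
    (he : Function.Injective e) (ht : Finset.univ.image e ∈ T) {i : Fin n} {v' : V}
    (hv' : ∀ j, e j ≠ v') (ht' : Finset.univ.image (Function.update e i v') ∈ T) :
    Matrix.det (.of fun j => ℓ (Function.update e i v' j)) =
      -Matrix.det (.of fun j => ℓ (e j)) := by
  obtain ⟨d, hd⟩ := hU.exists_dual _ ht
  have hmem : ∀ j, e j ∈ Finset.univ.image e := fun j =>
    Finset.mem_image_of_mem e (Finset.mem_univ j)
  have himage : Finset.univ.image (Function.update e i v') =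
      insert v' ((Finset.univ.image e).erase (e i)) := by
    ext w
    simp only [Finset.mem_image, Finset.mem_univ, true_and, Finset.mem_insert, Finset.mem_erase]
    constructor
    · rintro ⟨j, rfl⟩
      rcases eq_or_ne j i with rfl | hj
      · exact Or.inl (Function.update_self _ _ _)
      · rw [Function.update_of_ne hj]
        exact Or.inr ⟨fun h => hj (he h), j, rfl⟩
    · rintro (rfl | ⟨hw, j, rfl⟩)
      · exact ⟨i, Function.update_self _ _ _⟩
      · exact ⟨j, Function.update_of_ne (fun h : j = i => hw (congrArg e h)) _ _⟩
  have h1 := hU.dot_neighbor ht hd (hmem i) (v' := v') (by simpa using hv') (himage ▸ ht')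
  let A : Matrix (Fin n) (Fin n) ℤ := .of fun j => ℓ (e j)
  have h2 : (.of fun j => ℓ (Function.update e i v' j)) =
      A.updateRow i (∑ k, (d (e k) ⬝ᵥ ℓ v') • A k) := by
    have h3 : ∑ k, (d (e k) ⬝ᵥ ℓ v') • A k = ℓ v' := by
      conv_rhs => rw [hd.eq_sum_int (ℓ v'), Finset.sum_image fun _ _ _ _ h => he h]
      rfl
    rw [h3]
    ext j k
    rcases eq_or_ne j i with rfl | hj
    · rw [Matrix.of_apply, Function.update_self, Matrix.updateRow_self]
    · rw [Matrix.of_apply, Function.update_of_ne hj, Matrix.updateRow_ne hj]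
      rfl
  rw [h2, Matrix.det_updateRow_sum, h1]
  simp [A]

/-- A walk through ordered facets that exchanges one vertex at a time. -/
structure IsWalk (T : Finset (Finset V)) (N : ℕ) (e : ℕ → Fin n → V) : Prop where
  injective : ∀ k ≤ N, Function.Injective (e k)
  image_mem : ∀ k ≤ N, Finset.univ.image (e k) ∈ T
  step : ∀ k < N, ∃ i v', (∀ j, e k j ≠ v') ∧ e (k + 1) = Function.update (e k) i v'

theorem IsUnimodularFan.det_walk (hU : IsUnimodularFan T ℓ) {N : ℕ} {e : ℕ → Fin n → V}
    (he : IsWalk T N e) {k : ℕ} (hk : k ≤ N) :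
    Matrix.det (.of fun j => ℓ (e k j)) = (-1) ^ k * Matrix.det (.of fun j => ℓ (e 0 j)) := by
  induction k with
  | zero => simp
  | succ k ih =>
    obtain ⟨i, v', hv', hstep⟩ := he.step k hk
    have h1 := he.image_mem (k + 1) hk
    rw [hstep] at h1 ⊢
    rw [hU.det_update (he.injective k (by omega)) (he.image_mem k (by omega)) hv' h1,
      ih (by omega)]
    ring

/-- In the basis of the first facet of a walk, all determinants along the walk are known. -/
theorem IsUnimodularFan.exists_normal_form (hU : IsUnimodularFan T ℓ) {N : ℕ} {e : ℕ → Fin n → V}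
    (he : IsWalk T N e) : ∃ (g : GL (Fin n) ℤ) (x : V → Fin n → ℤ),
      (∀ v, ℓ v = (g : Matrix (Fin n) (Fin n) ℤ).mulVec (x v)) ∧
      (∀ i, x (e 0 i) = Pi.single i 1) ∧
      ∀ k ≤ N, Matrix.det (.of fun j => x (e k j)) = (-1) ^ k := by
  obtain ⟨d, hd⟩ := hU.exists_dual _ (he.image_mem 0 (Nat.zero_le _))
  have hinj := he.injective 0 (Nat.zero_le _)
  have hmem : ∀ j, e 0 j ∈ Finset.univ.image (e 0) := fun j =>
    Finset.mem_image_of_mem _ (Finset.mem_univ j)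
  let G : Matrix (Fin n) (Fin n) ℤ := .of fun i j => ℓ (e 0 j) i
  let D : Matrix (Fin n) (Fin n) ℤ := .of fun j i => d (e 0 j) i
  have hDG : D * G = 1 := by
    ext i j
    have h1 := hd.dot_eq _ (hmem i) _ (hmem j)
    rw [Matrix.one_apply]
    simp only [hinj.eq_iff] at h1
    exact h1
  have hGD : G * D = 1 := mul_eq_one_comm.mp hDG
  let x : V → Fin n → ℤ := fun v i => d (e 0 i) ⬝ᵥ ℓ v
  have hx : ∀ v, ℓ v = G.mulVec (x v) := by
    intro v
    have h1 : x v = D.mulVec (ℓ v) := rfl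
    rw [h1, Matrix.mulVec_mulVec, hGD, Matrix.one_mulVec]
  have hdet : ∀ k, Matrix.det (.of fun j => ℓ (e k j)) =
      Matrix.det (.of fun j => x (e k j)) * G.det := by
    intro k
    rw [← Matrix.det_transpose G, ← Matrix.det_mul]
    congr 1
    ext j i
    rw [Matrix.of_apply, hx, Matrix.mulVec, dotProduct_comm]
    rfl
  have hx0 : ∀ i, x (e 0 i) = Pi.single i 1 := by
    intro i
    ext j
    have h1 := hd.dot_eq _ (hmem j) _ (hmem i)
    simp only [hinj.eq_iff] at h1
    rw [Pi.single_apply]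
    exact h1
  have hG : G.det ≠ 0 := by
    intro h0
    have h1 := congrArg Matrix.det hDG
    rw [Matrix.det_mul, h0, mul_zero, Matrix.det_one] at h1
    exact zero_ne_one h1
  refine ⟨⟨G, D, hGD, hDG⟩, x, hx, hx0, fun k hk => mul_right_cancel₀ hG ?_⟩
  rw [← hdet k, hU.det_walk he hk]
  congr 1
  exact Matrix.det_transpose G

end Walls

end ToricNeighborly

namespace ToricNeighborly

/-! ### Separation of cones -/

section Separation

variable {n N : ℕ} {V : Type} {ℓ : V → Fin n → ℤ}

theorem mem_coneOf_of_pair_eq_zero {f : Fin n → ℤ} {A A' : Finset V}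
    (hA : ∀ v ∈ A, 0 ≤ f ⬝ᵥ ℓ v) (hA' : ∀ v ∈ A, f ⬝ᵥ ℓ v = 0 → v ∈ A') {x : Fin n → ℝ}
    (hx : x ∈ coneOf (ℓ '' (A : Set V))) (h0 : pair f x ≤ 0) : x ∈ coneOf (ℓ '' (A' : Set V)) := by
  obtain ⟨c, hc, rfl⟩ := mem_coneOf.mp hx
  have hnn : ∀ v ∈ A, 0 ≤ pair f (c v • toReal (ℓ v)) := fun v hv => by
    rw [pair_smul, pair_toReal]
    exact mul_nonneg (hc v) (by exact_mod_cast hA v hv)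
  rw [pair_sum] at h0
  have h1 := (Finset.sum_eq_zero_iff_of_nonneg hnn).mp (le_antisymm h0 (Finset.sum_nonneg hnn))
  refine Submodule.sum_mem _ fun v hv => ?_
  have h2 := h1 v hv
  rw [pair_smul, pair_toReal] at h2
  rcases mul_eq_zero.mp h2 with h3 | h3
  · rw [h3, zero_smul]
    exact Submodule.zero_mem _
  · exact Submodule.smul_mem _ (⟨c v, hc v⟩ : {c : ℝ // 0 ≤ c})
      (toReal_mem_coneOf ⟨v, hA' v hv (by exact_mod_cast h3), rfl⟩)

theorem mem_coneOf_of_separated {f : Fin n → ℤ} {A B A' B' : Finset V}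
    (hA : ∀ v ∈ A, 0 ≤ f ⬝ᵥ ℓ v) (hB : ∀ v ∈ B, f ⬝ᵥ ℓ v ≤ 0)
    (hA' : ∀ v ∈ A, f ⬝ᵥ ℓ v = 0 → v ∈ A') (hB' : ∀ v ∈ B, f ⬝ᵥ ℓ v = 0 → v ∈ B')
    {x : Fin n → ℝ} (hxA : x ∈ coneOf (ℓ '' (A : Set V))) (hxB : x ∈ coneOf (ℓ '' (B : Set V))) :
    x ∈ coneOf (ℓ '' (A' : Set V)) ∧ x ∈ coneOf (ℓ '' (B' : Set V)) := by
  have h1 : ∀ {g : Fin n → ℤ} {C : Finset V}, (∀ v ∈ C, 0 ≤ g ⬝ᵥ ℓ v) →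
      x ∈ coneOf (ℓ '' (C : Set V)) → 0 ≤ pair g x := fun hg hx =>
    mem_dualMonoid_coneOf.mpr hg x hx
  have hB0 : ∀ v ∈ B, 0 ≤ (-f) ⬝ᵥ ℓ v := fun v hv => by
    rw [neg_dotProduct]
    exact neg_nonneg.mpr (hB v hv)
  have hneg : pair (-f) x = -pair f x := by simp [pair]
  have h2 := h1 hA hxA
  have h3 := h1 hB0 hxB
  rw [hneg] at h3
  refine ⟨mem_coneOf_of_pair_eq_zero hA hA' hxA (by linarith),
    mem_coneOf_of_pair_eq_zero hB0 (fun v hv h0 => hB' v hv ?_) hxB (by linarith)⟩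
  rwa [neg_dotProduct, neg_eq_zero] at h0

/-- The set of the positions of the digits `1` of a number. -/
def bitSet (N a : ℕ) : Finset (Fin N) := Finset.univ.filter fun v => a.testBit v

theorem mem_bitSet {a : ℕ} {v : Fin N} : v ∈ bitSet N a ↔ a.testBit v = true := by
  simp [bitSet]

/-- The set on which a function on `{0, …, N - 1}` is positive, as a number. -/
def positiveBits (f : Fin N → ℤ) : ℕ :=
  (List.finRange N).foldr (fun v a => bif decide (0 < f v) then a ||| 1 <<< (v : ℕ) else a) 0

theorem testBit_positiveBits' (f : Fin N → ℤ) (i : ℕ) :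
    (positiveBits f).testBit i = true ↔ ∃ v : Fin N, (v : ℕ) = i ∧ 0 < f v := by
  have key : ∀ L : List (Fin N),
      (L.foldr (fun v a => bif decide (0 < f v) then a ||| 1 <<< (v : ℕ) else a) 0).testBit i = true
        ↔ ∃ v ∈ L, (v : ℕ) = i ∧ 0 < f v := by
    intro L
    induction L with
    | nil => simp
    | cons w L ih =>
      rw [List.foldr_cons, List.exists_mem_cons_iff, ← ih]
      by_cases hw : 0 < f w
      · rw [decide_eq_true hw, cond_true, Nat.testBit_or, Nat.one_shiftLeft, Nat.testBit_two_pow,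
          Bool.or_eq_true, decide_eq_true_iff, or_comm, and_iff_left hw]
      · rw [decide_eq_false hw, cond_false, or_iff_right fun h => hw h.2]
  exact (key (List.finRange N)).trans (by simp)

theorem testBit_positiveBits (f : Fin N → ℤ) (v : Fin N) :
    (positiveBits f).testBit v = decide (0 < f v) := by
  rw [Bool.eq_iff_iff, testBit_positiveBits', decide_eq_true_iff]
  exact ⟨fun ⟨w, hw, h⟩ => Fin.ext hw ▸ h, fun h => ⟨v, rfl, h⟩⟩

/-- A set as a number. -/
def bits (s : Finset (Fin N)) : ℕ := positiveBits fun v => if v ∈ s then 1 else 0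

theorem testBit_bits (s : Finset (Fin N)) (i : ℕ) :
    (bits s).testBit i = true ↔ ∃ v ∈ s, ((v : Fin N) : ℕ) = i := by
  rw [bits, testBit_positiveBits']
  refine exists_congr fun v => ?_
  by_cases hv : v ∈ s <;> simp [hv]

theorem bitSet_bits (s : Finset (Fin N)) : bitSet N (bits s) = s := by
  ext v
  rw [mem_bitSet, testBit_bits]
  exact ⟨fun ⟨w, hw, h⟩ => Fin.ext h ▸ hw, fun h => ⟨v, h, rfl⟩⟩

theorem bits_lt (s : Finset (Fin N)) : bits s < 2 ^ N := by
  refine Nat.lt_pow_two_of_testBit _ fun i hi => ?_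
  by_contra hc
  obtain ⟨v, -, rfl⟩ := (testBit_bits s i).mp (by simpa using hc)
  exact absurd v.2 (by omega)

theorem bits_land_eq_iff {s t : Finset (Fin N)} : bits s &&& bits t = bits s ↔ s ⊆ t := by
  constructor
  · intro h v hv
    have h1 := (testBit_bits s v).mpr ⟨v, hv, rfl⟩
    rw [← h, Nat.testBit_and, Bool.and_eq_true] at h1
    obtain ⟨w, hw, h2⟩ := (testBit_bits t v).mp h1.2
    exact Fin.ext h2 ▸ hw
  · intro h
    refine Nat.eq_of_testBit_eq fun i => ?_
    rw [Nat.testBit_and, Bool.eq_iff_iff, Bool.and_eq_true, and_iff_left_iff_imp]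
    intro hi
    obtain ⟨v, hv, hvi⟩ := (testBit_bits s i).mp hi
    exact (testBit_bits t i).mpr ⟨v, h hv, hvi⟩

theorem bitSet_xor_xor {a : ℕ} {v v' : Fin N} (hv : v ∈ bitSet N a) (hv' : v' ∉ bitSet N a) :
    bitSet N (a ^^^ 2 ^ (v : ℕ) ^^^ 2 ^ (v' : ℕ)) = insert v' ((bitSet N a).erase v) := by
  have hne : v ≠ v' := fun h => hv' (h ▸ hv)
  ext w
  rw [Finset.mem_insert, Finset.mem_erase]
  rw [mem_bitSet] at hv hv' ⊢
  rw [Nat.testBit_xor, Nat.testBit_xor, Nat.testBit_two_pow, Nat.testBit_two_pow, mem_bitSet]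
  rcases eq_or_ne w v with rfl | h1
  · simp [hv, hne, Fin.val_inj, hne.symm]
  · rcases eq_or_ne w v' with rfl | h2
    · simp [hv', hne, Fin.val_inj]
    · simp [h1, h2, Fin.val_inj, h1.symm, h2.symm]

/-- The value of `f` at `a`, where reduction evaluates `a` first. -/
def withValue {α : Type} (a : ℕ) (f : ℕ → α) : α :=
  match a with
  | 0 => f 0
  | k + 1 => f (k + 1)

theorem withValue_eq {α : Type} (a : ℕ) (f : ℕ → α) : withValue a f = f a := by
  cases a <;> rfl

/-- A test for two cones, given by the sets `a` and `b` of their generators, is applied after weak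
separation by a hyperplane, given by the sets of the generators on either side: if the hyperplane
separates the cones, they are replaced by their faces in the hyperplane. -/
def testSeparated (f : ℕ × ℕ × ℕ) (test : ℕ → ℕ → Bool) (a b : ℕ) : Bool :=
  bif Nat.beq (Nat.land f.1 b) 0 && Nat.beq (Nat.land f.2.1 a) 0 then
    withValue (Nat.xor a (Nat.land a f.1)) fun a' =>
      withValue (Nat.xor b (Nat.land b f.2.1)) fun b' => test a' b'
  else bif Nat.beq (Nat.land f.2.1 b) 0 && Nat.beq (Nat.land f.1 a) 0 then
    withValue (Nat.xor a (Nat.land a f.2.1)) fun a' =>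
      withValue (Nat.xor b (Nat.land b f.1)) fun b' => test a' b'
  else test a b

theorem testSeparated_eq (f : ℕ × ℕ × ℕ) (test : ℕ → ℕ → Bool) (a b : ℕ) :
    testSeparated f test a b =
      if Nat.beq (f.1 &&& b) 0 && Nat.beq (f.2.1 &&& a) 0 then
        test (a ^^^ (a &&& f.1)) (b ^^^ (b &&& f.2.1))
      else if Nat.beq (f.2.1 &&& b) 0 && Nat.beq (f.1 &&& a) 0 then
        test (a ^^^ (a &&& f.2.1)) (b ^^^ (b &&& f.1))
      else test a b := by
  simp only [testSeparated, withValue_eq, cond_eq_ite]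
  rfl

/-- Successive separation by the given hyperplanes reduces two cones to the same face. -/
def isSeparated (M : List (ℕ × ℕ × ℕ)) : ℕ → ℕ → Bool := M.foldr testSeparated Nat.beq

theorem land_beq_zero_iff {a b : ℕ} :
    Nat.beq (a &&& b) 0 = true ↔ ∀ i, a.testBit i = true → b.testBit i = false := by
  rw [Nat.beq_eq]
  constructor
  · intro h i hi
    have h1 := congrArg (Nat.testBit · i) h
    simpa [hi] using h1
  · intro h
    refine Nat.eq_of_testBit_eq fun i => ?_
    rw [Nat.testBit_and, Nat.zero_testBit]
    by_cases hi : a.testBit i = true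
    · simp [h i hi]
    · simp [hi]

theorem mem_bitSet_xor_land {a b : ℕ} {v : Fin N} :
    v ∈ bitSet N (a ^^^ (a &&& b)) ↔ v ∈ bitSet N a ∧ b.testBit v = false := by
  rw [mem_bitSet, mem_bitSet, Nat.testBit_xor, Nat.testBit_and]
  cases a.testBit v <;> cases b.testBit v <;> simp

variable {ℓ : Fin N → Fin n → ℤ}

/-- The hyperplanes with the given normals: the sets of the generators on the positive side, on the
negative side, and at distance at most one. -/
def hyperplaneBits (ℓ : Fin N → Fin n → ℤ) (W : List (Fin n → ℤ)) : List (ℕ × ℕ × ℕ) :=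
  W.map fun f => (positiveBits fun v => f ⬝ᵥ ℓ v, positiveBits fun v => -(f ⬝ᵥ ℓ v),
    positiveBits fun v => 2 - ((f ⬝ᵥ ℓ v).natAbs : ℤ))

theorem coneOf_inf_le_of_isSeparated {W : List (Fin n → ℤ)} {a b : ℕ}
    (h : isSeparated (hyperplaneBits ℓ W) a b = true) :
    coneOf (ℓ '' (bitSet N a : Set (Fin N))) ⊓ coneOf (ℓ '' (bitSet N b : Set (Fin N))) ≤
      coneOf (ℓ '' ((bitSet N a ∩ bitSet N b : Finset (Fin N)) : Set (Fin N))) := by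
  have himp : ∀ {a b : ℕ}, Nat.beq (a &&& b) 0 = true → ∀ v ∈ bitSet N b, a.testBit v = false := by
    intro a b h v hv
    by_contra hc
    have h1 := land_beq_zero_iff.mp h v (by simpa using hc)
    rw [mem_bitSet.mp hv] at h1
    exact Bool.noConfusion h1
  have hmono : ∀ {a a' b b' : ℕ}, coneOf (ℓ '' ((bitSet N (a ^^^ (a &&& a')) ∩
      bitSet N (b ^^^ (b &&& b')) : Finset (Fin N)) : Set (Fin N))) ≤
      coneOf (ℓ '' ((bitSet N a ∩ bitSet N b : Finset (Fin N)) : Set (Fin N))) := fun {_ _ _ _} =>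
    coneOf_mono (Set.image_mono (Finset.coe_subset.mpr (Finset.inter_subset_inter
      (fun v hv => (mem_bitSet_xor_land.mp hv).1) (fun v hv => (mem_bitSet_xor_land.mp hv).1))))
  induction W generalizing a b with
  | nil =>
    obtain rfl : a = b := Nat.beq_eq.mp h
    rw [Finset.inter_self]
    exact inf_le_left
  | cons f W ih =>
    have hpos : ∀ {v : Fin N}, (positiveBits fun v => f ⬝ᵥ ℓ v).testBit v = false ↔
        f ⬝ᵥ ℓ v ≤ 0 := fun {v} => by
      rw [testBit_positiveBits, decide_eq_false_iff_not, not_lt]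
    have hneg : ∀ {v : Fin N}, (positiveBits fun v => -(f ⬝ᵥ ℓ v)).testBit v = false ↔
        0 ≤ f ⬝ᵥ ℓ v := fun {v} => by
      rw [testBit_positiveBits, decide_eq_false_iff_not, not_lt, neg_nonpos]
    rw [hyperplaneBits, List.map_cons, isSeparated, List.foldr_cons, testSeparated_eq] at h
    rintro y ⟨hy1, hy2⟩
    split_ifs at h with h1 h2
    · rw [Bool.and_eq_true] at h1
      exact hmono (ih h (mem_coneOf_of_separated (fun v hv => hneg.mp (himp h1.2 v hv))
        (fun v hv => hpos.mp (himp h1.1 v hv))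
        (fun v hv h0 => mem_bitSet_xor_land.mpr ⟨hv, hpos.mpr h0.le⟩)
        (fun v hv h0 => mem_bitSet_xor_land.mpr ⟨hv, hneg.mpr h0.ge⟩) hy1 hy2))
    · rw [Bool.and_eq_true] at h2
      exact hmono (ih h (mem_coneOf_of_separated (fun v hv => hneg.mp (himp h2.1 v hv))
        (fun v hv => hpos.mp (himp h2.2 v hv))
        (fun v hv h0 => mem_bitSet_xor_land.mpr ⟨hv, hpos.mpr h0.le⟩)
        (fun v hv h0 => mem_bitSet_xor_land.mpr ⟨hv, hneg.mpr h0.ge⟩) hy2 hy1).symm)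
    · exact ih h ⟨hy1, hy2⟩

/-- A set of vectors is a lattice basis if each of them is separated from the others by a hyperplane
at lattice distance one. -/
theorem exists_isDualBasis_of_hyperplaneBits {W : List (Fin n → ℤ)} {a : ℕ}
    (hcard : (bitSet N a).card = n)
    (h : ∀ v : Fin N, a.testBit v = true → ∃ f ∈ hyperplaneBits ℓ W,
      Nat.land (Nat.lor f.1 f.2.1) a = 2 ^ (v : ℕ) ∧ f.2.2.testBit v = true) :
    ∃ d, IsDualBasis ℓ (bitSet N a) d := by
  have key : ∀ v ∈ bitSet N a, ∃ d : Fin n → ℤ, ∀ w ∈ bitSet N a,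
      d ⬝ᵥ ℓ w = if v = w then 1 else 0 := by
    intro v hv
    obtain ⟨_, hf, h1, h2⟩ := h v (mem_bitSet.mp hv)
    obtain ⟨f, -, rfl⟩ := List.mem_map.mp hf
    rw [testBit_positiveBits, decide_eq_true_iff] at h2
    have h3 : ∀ w : Fin N, ((0 < f ⬝ᵥ ℓ w ∨ 0 < -(f ⬝ᵥ ℓ w)) ∧ w ∈ bitSet N a) ↔ v = w := by
      intro w
      have h4 := congrArg (Nat.testBit · (w : ℕ)) h1
      change (((positiveBits fun v => f ⬝ᵥ ℓ v) ||| (positiveBits fun v => -(f ⬝ᵥ ℓ v))) &&&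
        a).testBit
        w = _ at h4
      rw [Nat.testBit_and, Nat.testBit_or, testBit_positiveBits, testBit_positiveBits,
        Nat.testBit_two_pow, Bool.eq_iff_iff, Bool.and_eq_true, Bool.or_eq_true, decide_eq_true_iff,
        decide_eq_true_iff, decide_eq_true_iff, Fin.val_inj, ← mem_bitSet] at h4
      exact h4
    have h5 : f ⬝ᵥ ℓ v = 1 ∨ f ⬝ᵥ ℓ v = -1 := by
      have h6 := ((h3 v).mpr rfl).1
      omega
    have h7 : ∀ w ∈ bitSet N a, v ≠ w → f ⬝ᵥ ℓ w = 0 := by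
      intro w hw hvw
      have h8 := mt (h3 w).mp hvw
      rw [not_and'] at h8
      have h9 := h8 hw
      omega
    rcases h5 with h5 | h5
    · refine ⟨f, fun w hw => ?_⟩
      split_ifs with hvw
      · rw [← hvw, h5]
      · exact h7 w hw hvw
    · refine ⟨-f, fun w hw => ?_⟩
      rw [neg_dotProduct]
      split_ifs with hvw
      · rw [← hvw, h5, neg_neg]
      · rw [h7 w hw hvw, neg_zero]
  choose! d hd using key
  exact ⟨d, hcard, hd⟩

end Separation

end ToricNeighborly

namespace ToricNeighborly

/-! ### The two complexes -/

section Complexes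

variable {n N : ℕ}

/-- The vertex sets of a list of ordered facets. -/
def walkFacets (L : List (Fin n → Fin N)) : Finset (Finset (Fin N)) :=
  (L.map fun e => Finset.univ.image e).toFinset

theorem mem_walkFacets {L : List (Fin n → Fin N)} {t : Finset (Fin N)} :
    t ∈ walkFacets L ↔ ∃ e ∈ L, Finset.univ.image e = t := by
  simp [walkFacets]

/-- A walk through all facets of `K27`, which are ordered so that consecutive ones differ in one
entry. -/
def walk27 : List (Fin 5 → Fin 9) :=
  [![0, 4, 5, 6, 8], ![3, 4, 5, 6, 8], ![3, 1, 5, 6, 8], ![2, 1, 5, 6, 8], ![2, 0, 5, 6, 8],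
    ![2, 0, 1, 6, 8], ![7, 0, 1, 6, 8], ![7, 3, 1, 6, 8], ![7, 3, 4, 6, 8], ![7, 0, 4, 6, 8],
    ![7, 0, 4, 6, 3], ![7, 0, 1, 6, 3], ![2, 0, 1, 6, 3], ![2, 5, 1, 6, 3], ![2, 5, 4, 6, 3],
    ![2, 0, 4, 6, 3], ![2, 0, 4, 6, 5], ![2, 0, 4, 8, 5], ![2, 0, 4, 8, 7], ![2, 0, 1, 8, 7],
    ![2, 5, 1, 8, 7], ![3, 5, 1, 8, 7], ![3, 5, 4, 8, 7], ![2, 5, 4, 8, 7], ![2, 5, 4, 1, 7],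
    ![3, 5, 4, 1, 7], ![3, 5, 4, 1, 2], ![3, 0, 4, 1, 2], ![7, 0, 4, 1, 2], ![7, 0, 4, 1, 3]]

/-- A walk through all facets of `K28`. -/
def walk28 : List (Fin 5 → Fin 9) :=
  [![0, 1, 2, 5, 8], ![6, 1, 2, 5, 8], ![6, 7, 2, 5, 8], ![0, 7, 2, 5, 8], ![0, 7, 6, 5, 8],
    ![0, 3, 6, 5, 8], ![1, 3, 6, 5, 8], ![1, 3, 0, 5, 8], ![1, 3, 0, 5, 2], ![1, 3, 6, 5, 2],
    ![4, 3, 6, 5, 2], ![4, 7, 6, 5, 2], ![4, 7, 0, 5, 2], ![4, 3, 0, 5, 2], ![4, 3, 0, 5, 6],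
    ![4, 7, 0, 5, 6], ![4, 7, 0, 3, 6], ![8, 7, 0, 3, 6], ![8, 7, 1, 3, 6], ![8, 7, 1, 2, 6],
    ![4, 7, 1, 2, 6], ![4, 3, 1, 2, 6], ![4, 3, 1, 7, 6], ![4, 3, 1, 7, 8], ![4, 2, 1, 7, 8],
    ![4, 2, 0, 7, 8], ![4, 3, 0, 7, 8], ![4, 3, 0, 1, 8], ![4, 2, 0, 1, 8], ![4, 2, 0, 1, 3]]

theorem isWalk_walk27 : IsWalk (walkFacets walk27) 29 (walk27.getD · 0) where
  injective := by decide +kernel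
  image_mem := by decide +kernel
  step := by decide +kernel

theorem isWalk_walk28 : IsWalk (walkFacets walk28) 29 (walk28.getD · 0) where
  injective := by decide +kernel
  image_mem := by decide +kernel
  step := by decide +kernel

/-- The facets of `K27`, in the order of the walk, as numbers. -/
def facetBits27 : List ℕ :=
  [369, 376, 362, 358, 357, 327, 451, 458, 472, 465, 217, 203, 79, 110, 124, 93, 117, 309,
    405, 391, 422, 426, 440, 436, 182, 186, 62, 31, 151, 155]

/-- The facets of `K28`, in the order of the walk, as numbers. -/
def facetBits28 : List ℕ :=
  [295, 358, 484, 421, 481, 361, 362, 299, 47, 110, 124, 244, 181, 61, 121, 241, 217, 457,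
    458, 454, 214, 94, 218, 410, 406, 405, 409, 283, 279, 31]

theorem map_bits_walk27 : (walk27.map fun e => bits (Finset.univ.image e)) = facetBits27 := by
  decide +kernel

theorem map_bits_walk28 : (walk28.map fun e => bits (Finset.univ.image e)) = facetBits28 := by
  decide +kernel

theorem hasFlips_of_bits {L : List (Fin n → Fin N)} {B : List ℕ}
    (hB : (L.map fun e => bits (Finset.univ.image e)) = B)
    (h : ∀ a ∈ B, ∀ v : Fin N, a.testBit v = true →
      ∃ v' : Fin N, a.testBit v' = false ∧ a ^^^ 2 ^ (v : ℕ) ^^^ 2 ^ (v' : ℕ) ∈ B) :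
    HasFlips (walkFacets L) := by
  have hmem : ∀ a ∈ B, bitSet N a ∈ walkFacets L := by
    rw [← hB]
    intro a ha
    obtain ⟨e, he, rfl⟩ := List.mem_map.mp ha
    exact mem_walkFacets.mpr ⟨e, he, (bitSet_bits _).symm⟩
  intro t ht v hv
  obtain ⟨e, he, rfl⟩ := mem_walkFacets.mp ht
  have h1 : bits (Finset.univ.image e) ∈ B := by
    rw [← hB]
    exact List.mem_map_of_mem he
  rw [← bitSet_bits (Finset.univ.image e)] at hv ⊢
  obtain ⟨v', hv', h2⟩ := h _ h1 v (mem_bitSet.mp hv)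
  have h3 : v' ∉ bitSet N (bits (Finset.univ.image e)) := by
    rw [mem_bitSet, hv']
    exact Bool.false_ne_true
  exact ⟨v', h3, bitSet_xor_xor hv h3 ▸ hmem _ h2⟩

theorem hasFlips_walk27 : HasFlips (walkFacets walk27) :=
  hasFlips_of_bits map_bits_walk27 (by decide +kernel)

theorem hasFlips_walk28 : HasFlips (walkFacets walk28) :=
  hasFlips_of_bits map_bits_walk28 (by decide +kernel)

/-- The facets of a complex with given non-faces are recognized by an enumeration of all sets of
vertices. -/
theorem hasFacets_complexOfNonfaces {M : Finset (Finset (Fin N))} {L : List (Fin n → Fin N)}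
    (hM : ∀ m ∈ (M : Set (Finset (Fin N))), 2 ≤ m.card) {A B : List ℕ}
    (hA : M.image bits = A.toFinset)
    (hB : (L.map fun e => bits (Finset.univ.image e)) = B) (hL : L ≠ [])
    (hL' : ∀ t ∈ walkFacets L, t.card = n) (hn : 0 < n)
    (h : ∀ a < 2 ^ N, (∀ m ∈ A, m &&& a ≠ m) ↔ ∃ t ∈ B, a &&& t = a) :
    HasFacets (complexOfNonfaces (M : Set (Finset (Fin N))) hM) (walkFacets L) where
  nonempty := by
    obtain ⟨e, he⟩ := List.exists_mem_of_ne_nil L hL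
    exact ⟨_, mem_walkFacets.mpr ⟨e, he, rfl⟩⟩
  nonempty_of_mem t ht := Finset.card_pos.mp ((hL' t ht).symm ▸ hn)
  mem_faces_iff s hs := by
    refine (and_iff_right hs).trans ?_
    have h1 := h (bits s) (bits_lt s)
    have h2 : (∀ m ∈ A, m &&& bits s ≠ m) ↔ ∀ m ∈ M, ¬ m ⊆ s := by
      have h3 : ∀ b, b ∈ A ↔ ∃ m ∈ M, bits m = b := fun b => by
        rw [← List.mem_toFinset, ← hA, Finset.mem_image]
      simp only [h3, ← bits_land_eq_iff]
      exact ⟨fun h m hm => h _ ⟨m, hm, rfl⟩, fun h _ ⟨m, hm, hb⟩ => hb ▸ h m hm⟩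
    have h4 : (∃ t ∈ B, bits s &&& t = bits s) ↔ ∃ t ∈ walkFacets L, s ⊆ t := by
      simp only [← hB, List.mem_map, mem_walkFacets, ← bits_land_eq_iff]
      constructor
      · rintro ⟨_, ⟨e, he, rfl⟩, h⟩
        exact ⟨_, ⟨e, he, rfl⟩, h⟩
      · rintro ⟨_, ⟨e, he, rfl⟩, h⟩
        exact ⟨_, ⟨e, he, rfl⟩, h⟩
    rw [h2, h4] at h1
    exact h1
  antichain s hs t ht hst :=
    Finset.eq_of_subset_of_card_le hst (by rw [hL' s hs, hL' t ht])

theorem hasFacets_K27 : HasFacets K27 (walkFacets walk27) :=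
  hasFacets_complexOfNonfaces (M := nonfaces27) (L := walk27) _
    (A := [35, 41, 265, 161, 82, 274, 140, 268, 196, 224, 340])
    (by decide +kernel) map_bits_walk27 (by decide) (by decide +kernel) (by decide)
    (by decide +kernel)

theorem hasFacets_K28 : HasFacets K28 (walkFacets walk28) :=
  hasFacets_complexOfNonfaces (M := nonfaces28) (L := walk28) _
    (A := [67, 131, 69, 50, 162, 140, 268, 168, 304, 336])
    (by decide +kernel) map_bits_walk28 (by decide) (by decide +kernel) (by decide)
    (by decide +kernel)

end Complexes

end ToricNeighborly

namespace ToricNeighborly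

/-! ### The fans -/

section Fans

variable {n N : ℕ}

/-- The expansion of a determinant of order five. -/
def det5 (a b c d e : Fin 5 → ℤ) : ℤ :=
  let m2 (i j : Fin 5) : ℤ := d i * e j - d j * e i
  let m3 (i j k : Fin 5) : ℤ := c i * m2 j k - c j * m2 i k + c k * m2 i j
  let m4 (i j k l : Fin 5) : ℤ := b i * m3 j k l - b j * m3 i k l + b k * m3 i j l - b l * m3 i j k
  a 0 * m4 1 2 3 4 - a 1 * m4 0 2 3 4 + a 2 * m4 0 1 3 4 - a 3 * m4 0 1 2 4 + a 4 * m4 0 1 2 3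

theorem det_eq_det5 (r : Fin 5 → Fin 5 → ℤ) :
    Matrix.det (.of r) = det5 (r 0) (r 1) (r 2) (r 3) (r 4) := by
  simp only [Matrix.det_succ_row_zero (n := 4), Matrix.det_succ_row_zero (n := 3),
    Matrix.det_fin_three, Fin.sum_univ_five, Fin.sum_univ_four, Matrix.submatrix_apply,
    Matrix.of_apply, det5]
  simp [Fin.succAbove, Fin.lt_def]
  ring

/-- The scalar product of order five. -/
def dot5 (a b : Fin 5 → ℤ) : ℤ := a 0 * b 0 + a 1 * b 1 + a 2 * b 2 + a 3 * b 3 + a 4 * b 4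

theorem dotProduct_eq_dot5 (a b : Fin 5 → ℤ) : a ⬝ᵥ b = dot5 a b := Fin.sum_univ_five _

theorem map_eq_of_components {α : Type} {W : List α} {a b c : α → ℕ} {M : List (ℕ × ℕ × ℕ)}
    (h1 : W.map a = M.map (·.1)) (h2 : W.map b = M.map (·.2.1)) (h3 : W.map c = M.map (·.2.2)) :
    (W.map fun f => (a f, b f, c f)) = M := by
  induction W generalizing M with
  | nil => simpa using h1
  | cons f W ih =>
    cases M with
    | nil => simp at h1
    | cons x M =>
      simp only [List.map_cons, List.cons.injEq] at h1 h2 h3 ⊢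
      exact ⟨Prod.ext h1.1 (Prod.ext h2.1 h3.1), ih h1.2 h2.2 h3.2⟩

/-- A criterion for a unimodular fan that is decided by computation: among the hyperplanes with the
normals `W` there are enough to exhibit each vector of each facet as a member of a lattice basis,
and to separate each pair of cones down to a common face. The hyperplanes enter through the table `M`
of the sets of vectors on either side and at distance at most one, the facets through the table `B`. -/
theorem isUnimodularFan_of_walk {ℓ : Fin N → Fin 5 → ℤ} {L : List (Fin 5 → Fin N)} {B : List ℕ}
    (hB : (L.map fun e => bits (Finset.univ.image e)) = B) (hL : L ≠ [])
    (hinj : ∀ e ∈ L, Function.Injective e) {W : List (Fin 5 → ℤ)} {M : List (ℕ × ℕ × ℕ)}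
    (hM1 : (W.map fun f => positiveBits fun v => dot5 f (ℓ v)) = M.map (·.1))
    (hM2 : (W.map fun f => positiveBits fun v => -dot5 f (ℓ v)) = M.map (·.2.1))
    (hM3 : (W.map fun f => positiveBits fun v => 2 - ((dot5 f (ℓ v)).natAbs : ℤ)) = M.map (·.2.2))
    (hdual : ∀ a ∈ B, ∀ v : Fin N, a.testBit v = true → ∃ f ∈ M,
      Nat.land (Nat.lor f.1 f.2.1) a = 2 ^ (v : ℕ) ∧ f.2.2.testBit v = true)
    (hsep : ∀ a ∈ B, ∀ b ∈ B, isSeparated M a b = true) : IsUnimodularFan (walkFacets L) ℓ := by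
  have hM' : hyperplaneBits ℓ W = M := by
    simp only [← dotProduct_eq_dot5] at hM1 hM2 hM3
    exact map_eq_of_components hM1 hM2 hM3
  have hmem : ∀ e ∈ L, bits (Finset.univ.image e) ∈ B := fun e he =>
    hB ▸ List.mem_map_of_mem he
  refine ⟨?_, fun t ht => ?_, fun s hs t ht => ?_⟩
  · obtain ⟨e, he⟩ := List.exists_mem_of_ne_nil L hL
    exact ⟨_, mem_walkFacets.mpr ⟨e, he, rfl⟩⟩
  · obtain ⟨e, he, rfl⟩ := mem_walkFacets.mp ht
    have h1 := exists_isDualBasis_of_hyperplaneBits (ℓ := ℓ) (W := W)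
      (a := bits (Finset.univ.image e)) (by
        rw [bitSet_bits, Finset.card_image_of_injective _ (hinj e he), Finset.card_univ,
          Fintype.card_fin]) (hM' ▸ hdual _ (hmem e he))
    rwa [bitSet_bits] at h1
  · obtain ⟨e, he, rfl⟩ := mem_walkFacets.mp hs
    obtain ⟨e', he', rfl⟩ := mem_walkFacets.mp ht
    have h1 := hsep _ (hmem e he) _ (hmem e' he')
    rw [← hM'] at h1
    have h2 := coneOf_inf_le_of_isSeparated h1
    rwa [bitSet_bits, bitSet_bits] at h2

theorem walk27_ne_nil : walk27 ≠ [] := by decide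

theorem injective_of_mem_walk27 : ∀ e ∈ walk27, Function.Injective e := by
  intro e he
  obtain ⟨i, hi, rfl⟩ := List.mem_iff_getElem.mp he
  rw [← List.getD_eq_getElem _ 0 hi]
  exact isWalk_walk27.injective i (Nat.le_of_lt_succ hi)

theorem walk28_ne_nil : walk28 ≠ [] := by decide

theorem injective_of_mem_walk28 : ∀ e ∈ walk28, Function.Injective e := by
  intro e he
  obtain ⟨i, hi, rfl⟩ := List.mem_iff_getElem.mp he
  rw [← List.getD_eq_getElem _ 0 hi]
  exact isWalk_walk28.injective i (Nat.le_of_lt_succ hi)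

/-- A characteristic map over `K27`. -/
def map27a : Fin 9 → Fin 5 → ℤ :=
  ![![1, 0, 0, 0, 0], ![0, -1, -1, -1, 0], ![1, -1, 0, -1, -1], ![-1, 0, -1, 0, 0],
    ![0, 1, 0, 0, 0], ![0, 0, 1, 0, 0], ![0, 0, 0, 1, 0], ![0, 0, -1, -1, 1], ![0, 0, 0, 0, 1]]

/-- The normals of the walls of the fan of `map27a`. -/
def walls27a : List (Fin 5 → ℤ) :=
  [![0, 0, 0, 0, 1], ![0, 0, 0, 1, 0], ![0, 0, 1, 0, 0], ![0, 1, 0, 0, 0], ![1, 0, 0, 0, 0],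
    ![0, 0, 0, 1, -1], ![0, 0, 0, 1, 1], ![0, 0, 1, -1, 0], ![0, 0, 1, 0, 1], ![0, 1, -1, 0, 0],
    ![0, 1, 0, -1, 0], ![0, 1, 0, 0, -1], ![1, 0, -1, 0, 0], ![1, 0, 0, 0, 1], ![1, 0, 0, 1, 0],
    ![1, 1, 0, 0, 0], ![0, 0, 1, -1, 1], ![0, 1, -1, 0, -1], ![0, 1, 0, -1, -1], ![0, 1, 1, -1, 0],
    ![1, 0, -1, 0, -1], ![1, 0, -1, 0, 1], ![1, 0, -1, 1, 0], ![1, 1, -1, 0, 0], ![0, 0, 2, -1, 1],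
    ![1, -1, 0, 1, 1], ![1, 1, -1, 0, -1], ![2, 0, 0, 1, 1]]

/-- The hyperplanes with the normals in `walls27a`: the sets of vectors on the positive side, on the
negative side, and at distance at most one. -/
def wallBits27a : List (ℕ × ℕ × ℕ) :=
  [(384, 4, 511), (64, 134, 511), (32, 138, 511), (16, 6, 511), (5, 8, 511), (64, 386, 383),
    (320, 6, 507), (36, 72, 511), (288, 14, 511), (152, 36, 511), (144, 64, 511), (16, 386,
    511), (135, 32, 511), (385, 8, 511), (65, 138, 511), (17, 10, 511), (416, 72, 511), (24,
    288, 511), (20, 320, 511), (48, 74, 511), (7, 288, 507), (387, 32, 383), (65, 32, 511),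
    (145, 32, 511), (288, 74, 471), (321, 24, 511), (21, 288, 511), (321, 10, 502)]

theorem positive_map27a :
    (walls27a.map fun f => positiveBits fun v => dot5 f (map27a v)) = wallBits27a.map (·.1) := by
  decide +kernel

theorem negative_map27a :
    (walls27a.map fun f => positiveBits fun v => -dot5 f (map27a v)) = wallBits27a.map (·.2.1) := by
  decide +kernel

theorem natAbs_le_one_map27a :
    (walls27a.map fun f => positiveBits fun v => 2 - ((dot5 f (map27a v)).natAbs : ℤ)) =
      wallBits27a.map (·.2.2) := by
  decide +kernel

theorem exists_dual_map27a : ∀ a ∈ facetBits27, ∀ v : Fin 9, a.testBit v = true →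
    ∃ f ∈ wallBits27a, Nat.land (Nat.lor f.1 f.2.1) a = 2 ^ (v : ℕ) ∧ f.2.2.testBit v = true := by
  decide +kernel

theorem isSeparated_map27a :
    ∀ a ∈ facetBits27, ∀ b ∈ facetBits27, isSeparated wallBits27a a b = true := by
  decide +kernel

theorem isUnimodularFan_map27a : IsUnimodularFan (walkFacets walk27) map27a :=
  isUnimodularFan_of_walk map_bits_walk27 walk27_ne_nil injective_of_mem_walk27 positive_map27a
    negative_map27a natAbs_le_one_map27a exists_dual_map27a isSeparated_map27a

/-- A characteristic map over `K27`. -/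
def map27b : Fin 9 → Fin 5 → ℤ :=
  ![![1, 0, 0, 0, 0], ![-1, -1, 0, 0, -1], ![0, -1, 1, -1, -1], ![-1, 0, 0, 1, -1],
    ![0, 1, 0, 0, 0], ![0, 0, 1, 0, 0], ![0, 0, 0, 1, 0], ![-1, 0, -1, 0, 0], ![0, 0, 0, 0, 1]]

/-- The normals of the walls of the fan of `map27b`. -/
def walls27b : List (Fin 5 → ℤ) :=
  [![0, 0, 0, 0, 1], ![0, 0, 0, 1, 0], ![0, 0, 1, 0, 0], ![0, 1, 0, 0, 0], ![1, 0, 0, 0, 0],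
    ![0, 0, 0, 1, -1], ![0, 0, 0, 1, 1], ![0, 0, 1, 0, 1], ![0, 0, 1, 1, 0], ![0, 1, 0, -1, 0],
    ![0, 1, 0, 0, -1], ![0, 1, 1, 0, 0], ![1, -1, 0, 0, 0], ![1, 0, -1, 0, 0], ![1, 0, 0, 0, -1],
    ![1, 0, 0, 1, 0], ![0, 1, 0, -1, -1], ![1, -1, -1, 0, 0], ![1, -1, 0, 1, 0], ![1, 0, -1, -1, 0],
    ![1, 0, -1, 0, -1], ![1, 0, -1, 1, 0], ![1, 0, 0, 1, -1], ![1, 1, 0, 0, -1], ![0, 0, 2, 1, 1],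
    ![0, 1, -1, -1, -1], ![1, -1, -1, 1, 0], ![2, 0, 0, 1, -1]]

/-- The hyperplanes with the normals in `walls27b`: the sets of vectors on the positive side, on the
negative side, and at distance at most one. -/
def wallBits27b : List (ℕ × ℕ × ℕ) :=
  [(256, 14, 511), (72, 4, 511), (36, 128, 511), (16, 6, 511), (1, 138, 511), (74, 256, 503),
    (320, 6, 507), (288, 138, 511), (104, 128, 511), (16, 74, 511), (24, 256, 511), (48, 130,
    511), (5, 152, 511), (1, 46, 511), (5, 384, 511), (65, 134, 511), (20, 320, 511), (1, 56,
    511), (65, 144, 511), (1, 106, 503), (1, 288, 511), (65, 38, 507), (73, 384, 511), (17,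
    386, 511), (352, 130, 351), (144, 352, 511), (65, 52, 511), (65, 386, 382)]

theorem positive_map27b :
    (walls27b.map fun f => positiveBits fun v => dot5 f (map27b v)) = wallBits27b.map (·.1) := by
  decide +kernel

theorem negative_map27b :
    (walls27b.map fun f => positiveBits fun v => -dot5 f (map27b v)) = wallBits27b.map (·.2.1) := by
  decide +kernel

theorem natAbs_le_one_map27b :
    (walls27b.map fun f => positiveBits fun v => 2 - ((dot5 f (map27b v)).natAbs : ℤ)) =
      wallBits27b.map (·.2.2) := by
  decide +kernel

theorem exists_dual_map27b : ∀ a ∈ facetBits27, ∀ v : Fin 9, a.testBit v = true →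
    ∃ f ∈ wallBits27b, Nat.land (Nat.lor f.1 f.2.1) a = 2 ^ (v : ℕ) ∧ f.2.2.testBit v = true := by
  decide +kernel

theorem isSeparated_map27b :
    ∀ a ∈ facetBits27, ∀ b ∈ facetBits27, isSeparated wallBits27b a b = true := by
  decide +kernel

theorem isUnimodularFan_map27b : IsUnimodularFan (walkFacets walk27) map27b :=
  isUnimodularFan_of_walk map_bits_walk27 walk27_ne_nil injective_of_mem_walk27 positive_map27b
    negative_map27b natAbs_le_one_map27b exists_dual_map27b isSeparated_map27b

/-- A characteristic map over `K28`. -/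
def map28a : Fin 9 → Fin 5 → ℤ :=
  ![![1, 0, 0, 0, 0], ![0, 1, 0, 0, 0], ![0, 0, 1, 0, 0], ![0, 1, -1, 0, -1], ![0, 0, 1, -1, -1],
    ![0, 0, 0, 1, 0], ![-1, 0, -1, 1, 0], ![-1, -1, 0, 0, 0], ![0, 0, 0, 0, 1]]

/-- The normals of the walls of the fan of `map28a`. -/
def walls28a : List (Fin 5 → ℤ) :=
  [![0, 0, 0, 0, 1], ![0, 0, 0, 1, 0], ![0, 0, 1, 0, 0], ![0, 1, 0, 0, 0], ![1, 0, 0, 0, 0],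
    ![0, 0, 0, 1, -1], ![0, 0, 1, 0, -1], ![0, 0, 1, 0, 1], ![0, 0, 1, 1, 0], ![0, 1, 0, 0, 1],
    ![0, 1, 1, 0, 0], ![1, -1, 0, 0, 0], ![1, 0, -1, 0, 0], ![1, 0, 0, 1, 0], ![0, 0, 1, 1, -1],
    ![0, 1, 0, -1, 1], ![0, 1, 1, 1, 0], ![1, -1, -1, 0, 0], ![1, -1, 0, 1, 0], ![1, 0, -1, 0, 1],
    ![1, 0, 0, 1, -1], ![0, 0, 1, 2, -1], ![0, 2, 1, 0, 1], ![1, -1, -1, -1, 0],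
    ![1, -1, -1, 0, -1], ![1, -1, 0, 1, -1], ![1, -2, -1, 0, -1], ![1, 0, 1, 2, -1]]

/-- The hyperplanes with the normals in `walls28a`: the sets of vectors on the positive side, on the
negative side, and at distance at most one. -/
def wallBits28a : List (ℕ × ℕ × ℕ) :=
  [(256, 24, 511), (96, 16, 511), (20, 72, 511), (10, 128, 511), (1, 192, 511), (104, 256,
    511), (20, 320, 495), (260, 72, 503), (36, 8, 511), (258, 144, 511), (22, 192, 511), (1,
    74, 511), (9, 148, 511), (33, 144, 511), (52, 256, 511), (258, 224, 511), (38, 128, 511),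
    (1, 22, 511), (33, 26, 511), (257, 148, 495), (41, 384, 511), (100, 256, 479), (262, 192,
    381), (1, 102, 511), (9, 262, 511), (33, 258, 511), (129, 262, 509), (37, 384, 479)]

theorem positive_map28a :
    (walls28a.map fun f => positiveBits fun v => dot5 f (map28a v)) = wallBits28a.map (·.1) := by
  decide +kernel

theorem negative_map28a :
    (walls28a.map fun f => positiveBits fun v => -dot5 f (map28a v)) = wallBits28a.map (·.2.1) := by
  decide +kernel

theorem natAbs_le_one_map28a :
    (walls28a.map fun f => positiveBits fun v => 2 - ((dot5 f (map28a v)).natAbs : ℤ)) =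
      wallBits28a.map (·.2.2) := by
  decide +kernel

theorem exists_dual_map28a : ∀ a ∈ facetBits28, ∀ v : Fin 9, a.testBit v = true →
    ∃ f ∈ wallBits28a, Nat.land (Nat.lor f.1 f.2.1) a = 2 ^ (v : ℕ) ∧ f.2.2.testBit v = true := by
  decide +kernel

theorem isSeparated_map28a :
    ∀ a ∈ facetBits28, ∀ b ∈ facetBits28, isSeparated wallBits28a a b = true := by
  decide +kernel

theorem isUnimodularFan_map28a : IsUnimodularFan (walkFacets walk28) map28a :=
  isUnimodularFan_of_walk map_bits_walk28 walk28_ne_nil injective_of_mem_walk28 positive_map28a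
    negative_map28a natAbs_le_one_map28a exists_dual_map28a isSeparated_map28a

/-- A characteristic map over `K28`. -/
def map28b : Fin 9 → Fin 5 → ℤ :=
  ![![1, 0, 0, 0, 0], ![0, 1, 0, 0, 0], ![0, 0, 1, 0, 0], ![0, 1, -1, 0, -1], ![1, 0, 1, -1, -1],
    ![0, 0, 0, 1, 0], ![-1, -1, 0, 0, 1], ![0, -1, 1, -1, 1], ![0, 0, 0, 0, 1]]

/-- The normals of the walls of the fan of `map28b`. -/
def walls28b : List (Fin 5 → ℤ) :=
  [![0, 0, 0, 0, 1], ![0, 0, 0, 1, 0], ![0, 0, 1, 0, 0], ![0, 1, 0, 0, 0], ![1, 0, 0, 0, 0],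
    ![0, 0, 0, 1, -1], ![0, 0, 1, 0, -1], ![0, 0, 1, 1, 0], ![0, 1, 0, -1, 0], ![0, 1, 0, 0, 1],
    ![0, 1, 1, 0, 0], ![1, -1, 0, 0, 0], ![1, 0, 0, 0, 1], ![1, 0, 0, 1, 0], ![0, 1, 0, -1, 1],
    ![0, 1, 1, 0, 1], ![0, 1, 1, 1, 0], ![1, -1, -1, 0, 0], ![1, -1, 0, 1, 0], ![1, 0, -1, 0, 1],
    ![1, 0, 0, 1, 1], ![1, 1, 0, 0, 1], ![0, 0, 1, 2, -1], ![0, 2, 0, -1, 1], ![0, 2, 1, 0, 1],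
    ![1, 0, -1, -1, 1], ![2, 0, -1, 0, 1], ![2, 0, 0, 1, 1]]

/-- The hyperplanes with the normals in `walls28b`: the sets of vectors on the positive side, on the
negative side, and at distance at most one. -/
def wallBits28b : List (ℕ × ℕ × ℕ) :=
  [(448, 24, 511), (32, 144, 511), (148, 8, 511), (10, 192, 511), (17, 64, 511), (40, 448,
    383), (20, 320, 495), (36, 8, 511), (26, 96, 511), (258, 16, 511), (22, 64, 511), (145,
    10, 511), (385, 8, 511), (33, 192, 511), (386, 32, 511), (390, 8, 511), (38, 192, 511),
    (1, 6, 511), (33, 10, 511), (257, 20, 511), (289, 24, 511), (259, 64, 511), (36, 448,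
    351), (266, 96, 509), (262, 64, 509), (385, 36, 511), (257, 68, 510), (289, 72, 510)]

theorem positive_map28b :
    (walls28b.map fun f => positiveBits fun v => dot5 f (map28b v)) = wallBits28b.map (·.1) := by
  decide +kernel

theorem negative_map28b :
    (walls28b.map fun f => positiveBits fun v => -dot5 f (map28b v)) = wallBits28b.map (·.2.1) := by
  decide +kernel

theorem natAbs_le_one_map28b :
    (walls28b.map fun f => positiveBits fun v => 2 - ((dot5 f (map28b v)).natAbs : ℤ)) =
      wallBits28b.map (·.2.2) := by
  decide +kernel

theorem exists_dual_map28b : ∀ a ∈ facetBits28, ∀ v : Fin 9, a.testBit v = true →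
    ∃ f ∈ wallBits28b, Nat.land (Nat.lor f.1 f.2.1) a = 2 ^ (v : ℕ) ∧ f.2.2.testBit v = true := by
  decide +kernel

theorem isSeparated_map28b :
    ∀ a ∈ facetBits28, ∀ b ∈ facetBits28, isSeparated wallBits28b a b = true := by
  decide +kernel

theorem isUnimodularFan_map28b : IsUnimodularFan (walkFacets walk28) map28b :=
  isUnimodularFan_of_walk map_bits_walk28 walk28_ne_nil injective_of_mem_walk28 positive_map28b
    negative_map28b natAbs_le_one_map28b exists_dual_map28b isSeparated_map28b

/-- A characteristic map over `K28`. -/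
def map28c : Fin 9 → Fin 5 → ℤ :=
  ![![1, 0, 0, 0, 0], ![0, 1, 0, 0, 0], ![0, 0, 1, 0, 0], ![0, 1, -1, 0, -1], ![0, -1, 1, -1, 0],
    ![0, 0, 0, 1, 0], ![-1, 0, -1, 1, 0], ![-1, -1, 0, 0, 1], ![0, 0, 0, 0, 1]]

/-- The normals of the walls of the fan of `map28c`. -/
def walls28c : List (Fin 5 → ℤ) :=
  [![0, 0, 0, 0, 1], ![0, 0, 0, 1, 0], ![0, 0, 1, 0, 0], ![0, 1, 0, 0, 0], ![1, 0, 0, 0, 0],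
    ![0, 0, 1, 0, -1], ![0, 0, 1, 1, 0], ![0, 1, 0, -1, 0], ![0, 1, 0, 0, 1], ![0, 1, 1, 0, 0],
    ![1, -1, 0, 0, 0], ![1, 0, -1, 0, 0], ![1, 0, 0, 0, 1], ![1, 0, 0, 1, 0], ![0, 0, 1, 1, -1],
    ![0, 1, 0, -1, 1], ![0, 1, 1, 0, 1], ![0, 1, 1, 1, 0], ![1, -1, -1, 0, 0], ![1, -1, 0, 1, 0],
    ![1, 0, -1, 0, 1], ![1, 0, 0, 1, 1], ![1, -1, 0, 1, -1], ![1, 0, -1, -1, 1]]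

/-- The hyperplanes with the normals in `walls28c`: the sets of vectors on the positive side, on the
negative side, and at distance at most one. -/
def wallBits28c : List (ℕ × ℕ × ℕ) :=
  [(384, 8, 511), (96, 16, 511), (20, 72, 511), (10, 144, 511), (1, 192, 511), (20, 448,
    511), (36, 8, 511), (10, 224, 511), (258, 16, 511), (6, 192, 511), (17, 74, 511), (9, 148,
    511), (257, 72, 511), (33, 144, 511), (36, 384, 511), (258, 96, 511), (262, 72, 511), (38,
    144, 511), (1, 6, 511), (33, 10, 511), (257, 20, 511), (289, 24, 511), (33, 386, 511),
    (257, 100, 511)]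

theorem positive_map28c :
    (walls28c.map fun f => positiveBits fun v => dot5 f (map28c v)) = wallBits28c.map (·.1) := by
  decide +kernel

theorem negative_map28c :
    (walls28c.map fun f => positiveBits fun v => -dot5 f (map28c v)) = wallBits28c.map (·.2.1) := by
  decide +kernel

theorem natAbs_le_one_map28c :
    (walls28c.map fun f => positiveBits fun v => 2 - ((dot5 f (map28c v)).natAbs : ℤ)) =
      wallBits28c.map (·.2.2) := by
  decide +kernel

theorem exists_dual_map28c : ∀ a ∈ facetBits28, ∀ v : Fin 9, a.testBit v = true →
    ∃ f ∈ wallBits28c, Nat.land (Nat.lor f.1 f.2.1) a = 2 ^ (v : ℕ) ∧ f.2.2.testBit v = true := by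
  decide +kernel

theorem isSeparated_map28c :
    ∀ a ∈ facetBits28, ∀ b ∈ facetBits28, isSeparated wallBits28c a b = true := by
  decide +kernel

theorem isUnimodularFan_map28c : IsUnimodularFan (walkFacets walk28) map28c :=
  isUnimodularFan_of_walk map_bits_walk28 walk28_ne_nil injective_of_mem_walk28 positive_map28c
    negative_map28c natAbs_le_one_map28c exists_dual_map28c isSeparated_map28c

/-- A characteristic map over `K28`. -/
def map28d : Fin 9 → Fin 5 → ℤ :=
  ![![1, 0, 0, 0, 0], ![0, 1, 0, 0, 0], ![0, 0, 1, 0, 0], ![0, 1, -1, 1, -1], ![0, -1, 0, -1, 0],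
    ![0, 0, 0, 1, 0], ![-1, 0, -1, 1, 0], ![-1, -1, -1, 0, 1], ![0, 0, 0, 0, 1]]

/-- The normals of the walls of the fan of `map28d`. -/
def walls28d : List (Fin 5 → ℤ) :=
  [![0, 0, 0, 0, 1], ![0, 0, 0, 1, 0], ![0, 0, 1, 0, 0], ![0, 1, 0, 0, 0], ![1, 0, 0, 0, 0],
    ![0, 0, 0, 1, 1], ![0, 0, 1, 0, -1], ![0, 0, 1, 0, 1], ![0, 0, 1, 1, 0], ![0, 1, -1, 0, 0],
    ![0, 1, 0, -1, 0], ![0, 1, 0, 0, 1], ![0, 1, 1, 0, 0], ![1, -1, 0, 0, 0], ![1, 0, -1, 0, 0],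
    ![1, 0, 0, 0, 1], ![1, 0, 0, 1, 0], ![0, 1, -1, -1, 0], ![0, 1, 0, -1, 1], ![1, -1, -1, 0, 0],
    ![1, -1, 0, 1, 0], ![1, 0, -1, -1, 0], ![1, 0, -1, 0, 1], ![1, 0, 0, 1, 1], ![0, 1, -1, -2, 0],
    ![0, 1, -1, -1, 1], ![2, 0, -1, 0, 1], ![0, 2, -1, -2, 1]]

/-- The hyperplanes with the normals in `walls28d`: the sets of vectors on the positive side, on the
negative side, and at distance at most one. -/
def wallBits28d : List (ℕ × ℕ × ℕ) :=
  [(384, 8, 511), (104, 16, 511), (4, 200, 511), (10, 144, 511), (1, 192, 511), (480, 16,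
    511), (4, 448, 383), (260, 72, 503), (36, 144, 511), (74, 20, 503), (2, 224, 511), (258,
    16, 511), (6, 208, 383), (17, 74, 511), (9, 4, 511), (257, 72, 511), (41, 144, 511), (10,
    36, 511), (258, 104, 511), (145, 6, 511), (33, 2, 511), (17, 100, 511), (385, 4, 511),
    (289, 16, 511), (18, 100, 479), (386, 36, 511), (257, 68, 510), (258, 100, 477)]

theorem positive_map28d :
    (walls28d.map fun f => positiveBits fun v => dot5 f (map28d v)) = wallBits28d.map (·.1) := by
  decide +kernel

theorem negative_map28d :
    (walls28d.map fun f => positiveBits fun v => -dot5 f (map28d v)) = wallBits28d.map (·.2.1) := by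
  decide +kernel

theorem natAbs_le_one_map28d :
    (walls28d.map fun f => positiveBits fun v => 2 - ((dot5 f (map28d v)).natAbs : ℤ)) =
      wallBits28d.map (·.2.2) := by
  decide +kernel

theorem exists_dual_map28d : ∀ a ∈ facetBits28, ∀ v : Fin 9, a.testBit v = true →
    ∃ f ∈ wallBits28d, Nat.land (Nat.lor f.1 f.2.1) a = 2 ^ (v : ℕ) ∧ f.2.2.testBit v = true := by
  decide +kernel

theorem isSeparated_map28d :
    ∀ a ∈ facetBits28, ∀ b ∈ facetBits28, isSeparated wallBits28d a b = true := by
  decide +kernel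

theorem isUnimodularFan_map28d : IsUnimodularFan (walkFacets walk28) map28d :=
  isUnimodularFan_of_walk map_bits_walk28 walk28_ne_nil injective_of_mem_walk28 positive_map28d
    negative_map28d natAbs_le_one_map28d exists_dual_map28d isSeparated_map28d

end Fans

end ToricNeighborly

namespace ToricNeighborly

/-! ### Solving the determinant equations -/

theorem exists_eq_vec5 (r : Fin 5 → ℤ) : ∃ a b c d e, r = ![a, b, c, d, e] :=
  ⟨r 0, r 1, r 2, r 3, r 4, by funext i; fin_cases i <;> rfl⟩

/-- The solutions of the determinant equations along the walk through the facets of `K27`, in the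
basis of the first facet. -/
theorem eq_map27_of_det {x : Fin 9 → Fin 5 → ℤ}
    (hbase : ∀ i, x (walk27.getD 0 0 i) = Pi.single i 1)
    (hdet : ∀ k ≤ 29, Matrix.det (.of fun j => x (walk27.getD k 0 j)) = (-1) ^ k) :
    x = map27a ∨ x = map27b := by
  simp only [det_eq_det5] at hdet
  obtain ⟨b0, b1, b2, b3, b4, hb⟩ := exists_eq_vec5 (x 1)
  obtain ⟨c0, c1, c2, c3, c4, hc⟩ := exists_eq_vec5 (x 2)
  obtain ⟨d0, d1, d2, d3, d4, hd⟩ := exists_eq_vec5 (x 3)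
  obtain ⟨k0, k1, k2, k3, k4, hk⟩ := exists_eq_vec5 (x 7)
  obtain rfl : x =
      ![![1, 0, 0, 0, 0], ![b0, b1, b2, b3, b4], ![c0, c1, c2, c3, c4], ![d0, d1, d2, d3, d4],
        ![0, 1, 0, 0, 0], ![0, 0, 1, 0, 0], ![0, 0, 0, 1, 0], ![k0, k1, k2, k3, k4],
        ![0, 0, 0, 0, 1]] := by
    funext v
    fin_cases v
    · exact (hbase 0).trans (by decide : (Pi.single 0 1 : Fin 5 → ℤ) = ![1, 0, 0, 0, 0])
    · exact hb
    · exact hc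
    · exact hd
    · exact (hbase 1).trans (by decide : (Pi.single 1 1 : Fin 5 → ℤ) = ![0, 1, 0, 0, 0])
    · exact (hbase 2).trans (by decide : (Pi.single 2 1 : Fin 5 → ℤ) = ![0, 0, 1, 0, 0])
    · exact (hbase 3).trans (by decide : (Pi.single 3 1 : Fin 5 → ℤ) = ![0, 0, 0, 1, 0])
    · exact hk
    · exact (hbase 4).trans (by decide : (Pi.single 4 1 : Fin 5 → ℤ) = ![0, 0, 0, 0, 1])
  clear hbase hb hc hd hk
  obtain rfl : d0 = -1 := by
    have h := hdet 1 (by decide)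
    simp only [walk27, det5, List.getD_cons_succ, List.getD_cons_zero, Matrix.cons_val] at h
    linear_combination h
  obtain rfl : c1 = -1 := by
    have h := hdet 4 (by decide)
    simp only [walk27, det5, List.getD_cons_succ, List.getD_cons_zero, Matrix.cons_val] at h
    linear_combination -h
  obtain rfl : k2 = -1 := by
    have h := hdet 9 (by decide)
    simp only [walk27, det5, List.getD_cons_succ, List.getD_cons_zero, Matrix.cons_val] at h
    linear_combination h
  obtain rfl : c4 = -1 := by
    have h := hdet 16 (by decide)
    simp only [walk27, det5, List.getD_cons_succ, List.getD_cons_zero, Matrix.cons_val] at h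
    linear_combination -h
  obtain rfl : c3 = -1 := by
    have h := hdet 17 (by decide)
    simp only [walk27, det5, List.getD_cons_succ, List.getD_cons_zero, Matrix.cons_val] at h
    linear_combination h
  have q8 : d2 * k0 = 0 := by
    have h := hdet 8 (by decide)
    simp only [walk27, det5, List.getD_cons_succ, List.getD_cons_zero, Matrix.cons_val] at h
    linear_combination -h
  have q14 : c0 * d4 = 0 := by
    have h := hdet 14 (by decide)
    simp only [walk27, det5, List.getD_cons_succ, List.getD_cons_zero, Matrix.cons_val] at h
    linear_combination -h
  have q18 : c2 * k3 = 0 := by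
    have h := hdet 18 (by decide)
    simp only [walk27, det5, List.getD_cons_succ, List.getD_cons_zero, Matrix.cons_val] at h
    linear_combination -h
  have q2 : b0 * d1 + b1 + 1 = 0 := by
    have h := hdet 2 (by decide)
    simp only [walk27, det5, List.getD_cons_succ, List.getD_cons_zero, Matrix.cons_val] at h
    linear_combination -h
  have q3 : b1 * c0 + b0 + 1 = 0 := by
    have h := hdet 3 (by decide)
    simp only [walk27, det5, List.getD_cons_succ, List.getD_cons_zero, Matrix.cons_val] at h
    linear_combination h
  have q5 : b1 * c2 + b2 + 1 = 0 := by
    have h := hdet 5 (by decide)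
    simp only [walk27, det5, List.getD_cons_succ, List.getD_cons_zero, Matrix.cons_val] at h
    linear_combination h
  have q6 : b2 * k1 + b1 + 1 = 0 := by
    have h := hdet 6 (by decide)
    simp only [walk27, det5, List.getD_cons_succ, List.getD_cons_zero, Matrix.cons_val] at h
    linear_combination -h
  have q10 : d2 * k4 + d4 + 1 = 0 := by
    have h := hdet 10 (by decide)
    simp only [walk27, det5, List.getD_cons_succ, List.getD_cons_zero, Matrix.cons_val] at h
    linear_combination -h
  have q15 : c2 * d4 + d2 + 1 = 0 := by
    have h := hdet 15 (by decide)
    simp only [walk27, det5, List.getD_cons_succ, List.getD_cons_zero, Matrix.cons_val] at h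
    linear_combination h
  have q22 : d3 * k0 + k3 + 1 = 0 := by
    have h := hdet 22 (by decide)
    simp only [walk27, det5, List.getD_cons_succ, List.getD_cons_zero, Matrix.cons_val] at h
    linear_combination -h
  have q23 : c0 * k3 + k0 + 1 = 0 := by
    have h := hdet 23 (by decide)
    simp only [walk27, det5, List.getD_cons_succ, List.getD_cons_zero, Matrix.cons_val] at h
    linear_combination h
  have q11 : -b1 * d2 * k4 + b2 * d1 * k4 - b2 * d4 * k1 + b4 * d2 * k1 - b1 * d4 + b4 * d1 + 1 =
      0 := by
    have h := hdet 11 (by decide)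
    simp only [walk27, det5, List.getD_cons_succ, List.getD_cons_zero, Matrix.cons_val] at h
    linear_combination h
  have q13 : -b1 * c0 * d4 + b4 * c0 * d1 + b0 * d1 - b0 * d4 + b1 - b4 + 1 = 0 := by
    have h := hdet 13 (by decide)
    simp only [walk27, det5, List.getD_cons_succ, List.getD_cons_zero, Matrix.cons_val] at h
    linear_combination h
  have q19 : -b1 * c2 * k3 + b3 * c2 * k1 + b2 * k1 - b2 * k3 + b1 - b3 + 1 = 0 := by
    have h := hdet 19 (by decide)
    simp only [walk27, det5, List.getD_cons_succ, List.getD_cons_zero, Matrix.cons_val] at h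
    linear_combination h
  have q20 : -b1 * c0 * k3 + b3 * c0 * k1 + b0 * k1 - b0 * k3 - b1 * k0 + b3 * k0 + 1 = 0 := by
    have h := hdet 20 (by decide)
    simp only [walk27, det5, List.getD_cons_succ, List.getD_cons_zero, Matrix.cons_val] at h
    linear_combination -h
  have q24 : b3 * c0 * k4 - b4 * c0 * k3 - b0 * k3 + b0 * k4 + b3 * k0 - b4 * k0 + 1 = 0 := by
    have h := hdet 24 (by decide)
    simp only [walk27, det5, List.getD_cons_succ, List.getD_cons_zero, Matrix.cons_val] at h
    linear_combination -h
  have q26 : -b3 * c0 * d4 + b4 * c0 * d3 + b0 * d3 - b0 * d4 + b3 - b4 + 1 = 0 := by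
    have h := hdet 26 (by decide)
    simp only [walk27, det5, List.getD_cons_succ, List.getD_cons_zero, Matrix.cons_val] at h
    linear_combination -h
  have q27 : -b3 * c2 * d4 + b4 * c2 * d3 + b2 * d3 - b2 * d4 - b3 * d2 + b4 * d2 + 1 = 0 := by
    have h := hdet 27 (by decide)
    simp only [walk27, det5, List.getD_cons_succ, List.getD_cons_zero, Matrix.cons_val] at h
    linear_combination h
  have q28 : b3 * c2 * k4 - b4 * c2 * k3 - b2 * k3 + b2 * k4 - b3 + b4 + 1 = 0 := by
    have h := hdet 28 (by decide)
    simp only [walk27, det5, List.getD_cons_succ, List.getD_cons_zero, Matrix.cons_val] at h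
    linear_combination -h
  clear hdet
  -- `q` with a number is the equation of the facet of that number in the walk
  rcases mul_eq_zero.mp (show d2 * k0 = 0 by linear_combination q8) with rfl | rfl
  · obtain rfl : d4 = -1 := by linear_combination q10
    obtain rfl : c0 = 0 := by linear_combination -q14
    obtain rfl : b0 = -1 := by linear_combination q3
    obtain rfl : c2 = 1 := by linear_combination -q15
    obtain rfl : k3 = 0 := by linear_combination q18
    obtain rfl : k0 = -1 := by linear_combination q23
    obtain rfl : d3 = 1 := by linear_combination -q22
    obtain rfl : b1 = d1 - 1 := by linear_combination q2
    obtain rfl : b4 = -1 := by linear_combination -q13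
    obtain rfl : b3 = 0 := by linear_combination q26
    obtain rfl : k4 = 0 := by linear_combination -q24
    obtain rfl : b2 = 0 := by linarith
    obtain rfl : d1 = 0 := by linear_combination q5
    obtain rfl : k1 = 0 := by linear_combination -q20
    exact Or.inr rfl
  · obtain rfl : k3 = -1 := by linear_combination q22
    obtain rfl : c2 = 0 := by linear_combination -q18
    obtain rfl : b2 = -1 := by linear_combination q5
    obtain rfl : d2 = -1 := by linear_combination q15
    obtain rfl : c0 = 1 := by linear_combination -q23
    obtain rfl : d4 = 0 := by linear_combination q14
    obtain rfl : k4 = 1 := by linear_combination -q10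
    obtain rfl : b1 = -b0 - 1 := by linear_combination q3
    obtain rfl : k1 = -b0 := by linear_combination -q6
    obtain rfl : b3 = -1 := by linear_combination -q19
    obtain rfl : b4 = 0 := by linear_combination q28
    obtain rfl : b0 = 0 := by linarith
    obtain rfl : d1 = 0 := by linear_combination -q11
    obtain rfl : d3 = 0 := by linear_combination -q27
    exact Or.inl rfl

/-- The solutions of the determinant equations along the walk through the facets of `K28`, in the
basis of the first facet. -/
theorem eq_map28_of_det {x : Fin 9 → Fin 5 → ℤ}
    (hbase : ∀ i, x (walk28.getD 0 0 i) = Pi.single i 1)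
    (hdet : ∀ k ≤ 29, Matrix.det (.of fun j => x (walk28.getD k 0 j)) = (-1) ^ k) :
    x = map28a ∨ x = map28b ∨ x = map28c ∨ x = map28d := by
  simp only [det_eq_det5] at hdet
  obtain ⟨d0, d1, d2, d3, d4, hd⟩ := exists_eq_vec5 (x 3)
  obtain ⟨e0, e1, e2, e3, e4, he⟩ := exists_eq_vec5 (x 4)
  obtain ⟨g0, g1, g2, g3, g4, hg⟩ := exists_eq_vec5 (x 6)
  obtain ⟨k0, k1, k2, k3, k4, hk⟩ := exists_eq_vec5 (x 7)
  obtain rfl : x =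
      ![![1, 0, 0, 0, 0], ![0, 1, 0, 0, 0], ![0, 0, 1, 0, 0], ![d0, d1, d2, d3, d4],
        ![e0, e1, e2, e3, e4], ![0, 0, 0, 1, 0], ![g0, g1, g2, g3, g4], ![k0, k1, k2, k3, k4],
        ![0, 0, 0, 0, 1]] := by
    funext v
    fin_cases v
    · exact (hbase 0).trans (by decide : (Pi.single 0 1 : Fin 5 → ℤ) = ![1, 0, 0, 0, 0])
    · exact (hbase 1).trans (by decide : (Pi.single 1 1 : Fin 5 → ℤ) = ![0, 1, 0, 0, 0])
    · exact (hbase 2).trans (by decide : (Pi.single 2 1 : Fin 5 → ℤ) = ![0, 0, 1, 0, 0])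
    · exact hd
    · exact he
    · exact (hbase 3).trans (by decide : (Pi.single 3 1 : Fin 5 → ℤ) = ![0, 0, 0, 1, 0])
    · exact hg
    · exact hk
    · exact (hbase 4).trans (by decide : (Pi.single 4 1 : Fin 5 → ℤ) = ![0, 0, 0, 0, 1])
  clear hbase hd he hg hk
  obtain rfl : g0 = -1 := by
    have h := hdet 1 (by decide)
    simp only [walk28, det5, List.getD_cons_succ, List.getD_cons_zero, Matrix.cons_val] at h
    linear_combination h
  obtain rfl : k1 = -1 := by
    have h := hdet 3 (by decide)
    simp only [walk28, det5, List.getD_cons_succ, List.getD_cons_zero, Matrix.cons_val] at h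
    linear_combination h
  obtain rfl : d2 = -1 := by
    have h := hdet 7 (by decide)
    simp only [walk28, det5, List.getD_cons_succ, List.getD_cons_zero, Matrix.cons_val] at h
    linear_combination h
  obtain rfl : d4 = -1 := by
    have h := hdet 8 (by decide)
    simp only [walk28, det5, List.getD_cons_succ, List.getD_cons_zero, Matrix.cons_val] at h
    linear_combination -h
  obtain rfl : e3 = -1 := by
    have h := hdet 28 (by decide)
    simp only [walk28, det5, List.getD_cons_succ, List.getD_cons_zero, Matrix.cons_val] at h
    linear_combination -h
  have q2 : g1 * k0 = 0 := by
    have h := hdet 2 (by decide)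
    simp only [walk28, det5, List.getD_cons_succ, List.getD_cons_zero, Matrix.cons_val] at h
    linear_combination -h
  have q6 : d0 * g2 = 0 := by
    have h := hdet 6 (by decide)
    simp only [walk28, det5, List.getD_cons_succ, List.getD_cons_zero, Matrix.cons_val] at h
    linear_combination -h
  have q9 : d0 * g4 = 0 := by
    have h := hdet 9 (by decide)
    simp only [walk28, det5, List.getD_cons_succ, List.getD_cons_zero, Matrix.cons_val] at h
    linear_combination h
  have q25 : e1 * k3 = 0 := by
    have h := hdet 25 (by decide)
    simp only [walk28, det5, List.getD_cons_succ, List.getD_cons_zero, Matrix.cons_val] at h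
    linear_combination h
  have q27 : d3 * e2 = 0 := by
    have h := hdet 27 (by decide)
    simp only [walk28, det5, List.getD_cons_succ, List.getD_cons_zero, Matrix.cons_val] at h
    linear_combination h
  have q29 : d3 * e4 = 0 := by
    have h := hdet 29 (by decide)
    simp only [walk28, det5, List.getD_cons_succ, List.getD_cons_zero, Matrix.cons_val] at h
    linear_combination h
  have q4 : g1 * k2 + g2 + 1 = 0 := by
    have h := hdet 4 (by decide)
    simp only [walk28, det5, List.getD_cons_succ, List.getD_cons_zero, Matrix.cons_val] at h
    linear_combination -h
  have q5 : d1 * g2 + g1 + 1 = 0 := by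
    have h := hdet 5 (by decide)
    simp only [walk28, det5, List.getD_cons_succ, List.getD_cons_zero, Matrix.cons_val] at h
    linear_combination h
  have q12 : e1 * k4 + e4 + 1 = 0 := by
    have h := hdet 12 (by decide)
    simp only [walk28, det5, List.getD_cons_succ, List.getD_cons_zero, Matrix.cons_val] at h
    linear_combination -h
  have q13 : d1 * e4 + e1 + 1 = 0 := by
    have h := hdet 13 (by decide)
    simp only [walk28, det5, List.getD_cons_succ, List.getD_cons_zero, Matrix.cons_val] at h
    linear_combination h
  have q19 : g3 * k0 + k3 + 1 = 0 := by
    have h := hdet 19 (by decide)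
    simp only [walk28, det5, List.getD_cons_succ, List.getD_cons_zero, Matrix.cons_val] at h
    linear_combination h
  have q24 : e0 * k3 + k0 + 1 = 0 := by
    have h := hdet 24 (by decide)
    simp only [walk28, det5, List.getD_cons_succ, List.getD_cons_zero, Matrix.cons_val] at h
    linear_combination -h
  have q21 : d0 * e4 * g3 + d3 * e0 * g4 + d0 * g4 + d3 * e4 + e0 * g3 = 0 := by
    have h := hdet 21 (by decide)
    simp only [walk28, det5, List.getD_cons_succ, List.getD_cons_zero, Matrix.cons_val] at h
    linear_combination h
  have q26 : d1 * e2 * k3 + d3 * e1 * k2 + d1 * k2 + d3 * e2 + e1 * k3 = 0 := by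
    have h := hdet 26 (by decide)
    simp only [walk28, det5, List.getD_cons_succ, List.getD_cons_zero, Matrix.cons_val] at h
    linear_combination -h
  have q10 : -d0 * e1 * g4 + d0 * e4 * g1 + d1 * e0 * g4 + d1 * e4 + e0 * g1 + e1 + 1 = 0 := by
    have h := hdet 10 (by decide)
    simp only [walk28, det5, List.getD_cons_succ, List.getD_cons_zero, Matrix.cons_val] at h
    linear_combination -h
  have q11 : e0 * g1 * k4 + e1 * g4 * k0 - e4 * g1 * k0 + e0 * g4 + e1 * k4 + e4 + 1 = 0 := by
    have h := hdet 11 (by decide)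
    simp only [walk28, det5, List.getD_cons_succ, List.getD_cons_zero, Matrix.cons_val] at h
    linear_combination h
  have q14 : d1 * e2 * g4 - d1 * e4 * g2 - e1 * g2 + e1 * g4 + e2 * g1 - e4 * g1 + 1 = 0 := by
    have h := hdet 14 (by decide)
    simp only [walk28, det5, List.getD_cons_succ, List.getD_cons_zero, Matrix.cons_val] at h
    linear_combination -h
  have q17 : -d1 * g2 * k3 + d1 * g3 * k2 - d3 * g1 * k2 - d3 * g2 - g1 * k3 - g3 + 1 = 0 := by
    have h := hdet 17 (by decide)
    simp only [walk28, det5, List.getD_cons_succ, List.getD_cons_zero, Matrix.cons_val] at h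
    linear_combination h
  have q18 : -d0 * g2 * k3 + d0 * g3 * k2 + d3 * g2 * k0 + d3 * k2 + g3 * k0 + k3 + 1 = 0 := by
    have h := hdet 18 (by decide)
    simp only [walk28, det5, List.getD_cons_succ, List.getD_cons_zero, Matrix.cons_val] at h
    linear_combination -h
  have q20 : e0 * g3 * k4 - e0 * g4 * k3 - e4 * g3 * k0 - e4 * k3 - g4 * k0 - k4 + 1 = 0 := by
    have h := hdet 20 (by decide)
    simp only [walk28, det5, List.getD_cons_succ, List.getD_cons_zero, Matrix.cons_val] at h
    linear_combination -h
  have q23 : d0 * e2 * k3 + d3 * e0 * k2 - d3 * e2 * k0 + d0 * k2 + e0 * k3 + k0 + 1 = 0 := by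
    have h := hdet 23 (by decide)
    simp only [walk28, det5, List.getD_cons_succ, List.getD_cons_zero, Matrix.cons_val] at h
    linear_combination h
  have q16 : d1 * e2 * g3 * k4 - d1 * e2 * g4 * k3 + d1 * e4 * g2 * k3 - d1 * e4 * g3 * k2 + d3 *
      e1 * g2 * k4 - d3 * e1 * g4 * k2 - d3 * e2 * g1 * k4 + d3 * e4 * g1 * k2 + d1 * g2 * k4 -
      d1 * g4 * k2 - d3 * e2 * g4 + d3 * e4 * g2 + e1 * g2 * k3 - e1 * g3 * k2 + e1 * g3 * k4 -
      e1 * g4 * k3 - e2 * g1 * k3 + e4 * g1 * k3 - e2 * g3 + e4 * g3 - g1 * k2 + g1 * k4 - g2 +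
      g4 + 1 = 0 := by
    have h := hdet 16 (by decide)
    simp only [walk28, det5, List.getD_cons_succ, List.getD_cons_zero, Matrix.cons_val] at h
    linear_combination -h
  have q22 : d0 * e2 * g3 * k4 - d0 * e2 * g4 * k3 + d0 * e4 * g2 * k3 - d0 * e4 * g3 * k2 + d3 *
      e0 * g2 * k4 - d3 * e0 * g4 * k2 + d3 * e2 * g4 * k0 - d3 * e4 * g2 * k0 + d0 * g2 * k4 -
      d0 * g4 * k2 + d3 * e2 * k4 - d3 * e4 * k2 + e0 * g2 * k3 - e0 * g3 * k2 + e0 * g3 * k4 -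
      e0 * g4 * k3 + e2 * g3 * k0 - e4 * g3 * k0 + e2 * k3 - e4 * k3 + g2 * k0 - g4 * k0 + k2 -
      k4 + 1 = 0 := by
    have h := hdet 22 (by decide)
    simp only [walk28, det5, List.getD_cons_succ, List.getD_cons_zero, Matrix.cons_val] at h
    linear_combination -h
  clear hdet
  -- `q` with a number is the equation of the facet of that number in the walk
  rcases mul_eq_zero.mp (show g1 * k0 = 0 by linear_combination q2) with rfl | rfl
  · obtain rfl : g2 = -1 := by linear_combination q4
    obtain rfl : d0 = 0 := by linear_combination -q6
    obtain rfl : d1 = 1 := by linear_combination -q5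
    rcases mul_eq_zero.mp (show e1 * k3 = 0 by linear_combination q25) with rfl | rfl
    · obtain rfl : e4 = -1 := by linear_combination q12
      obtain rfl : d3 = 0 := by linear_combination -q29
      obtain rfl : k2 = -e2 * k3 := by linear_combination q26
      rcases mul_eq_zero.mp (show e0 * g3 = 0 by linear_combination q21) with rfl | rfl
      · obtain rfl : k0 = -1 := by linear_combination q24
        rcases mul_eq_zero.mp (show e2 * g4 = 0 by linear_combination q14) with rfl | rfl
        · obtain rfl : g3 = k3 + 1 := by linear_combination -q19
          obtain rfl : k4 = g4 := by linear_combination -q20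
          exact absurd (show (1 : ℤ) = 0 by linear_combination q16) (by decide)
        · obtain rfl : g3 = k3 + 1 := by linear_combination -q19
          obtain rfl : k4 = 0 := by linear_combination -q20
          rcases mul_eq_zero.mp (show e2 * (k3 * k3 + k3) = 0 by linear_combination -q17) with
              rfl | r1
          · exact absurd (show (1 : ℤ) = 0 by linear_combination q16) (by decide)
          · rcases mul_eq_zero.mp (show k3 * (k3 + 1) = 0 by linear_combination r1) with rfl | r2
            · obtain rfl : e2 = 1 := by linear_combination -q16
              exact Or.inl rfl
            · obtain rfl : k3 = -1 := by linear_combination r2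
              exact absurd (show (1 : ℤ) = 0 by linear_combination q16) (by decide)
      · obtain rfl : k3 = -1 := by linear_combination q19
        rcases mul_eq_zero.mp (show e0 * g4 = 0 by linear_combination q10) with rfl | rfl
        · obtain rfl : k0 = -1 := by linear_combination q24
          obtain rfl : k4 = g4 := by linear_combination -q20
          exact absurd (show (1 : ℤ) = 0 by linear_combination q16) (by decide)
        · obtain rfl : k4 = 0 := by linear_combination -q20
          exact absurd (show (1 : ℤ) = 0 by linear_combination q16) (by decide)
    · obtain rfl : k0 = -1 := by linear_combination q24
      obtain rfl : g3 = 1 := by linear_combination -q19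
      obtain rfl : d3 = -k2 := by linear_combination q17
      rcases mul_eq_zero.mp (show k2 * (k2 + 1) = 0 by linear_combination -q18) with rfl | r1
      · obtain rfl : e0 = 0 := by linear_combination q21
        obtain rfl : e1 = -e4 - 1 := by linear_combination q13
        rcases mul_eq_zero.mp (show g4 * (e2 - e4 - 1) = 0 by linear_combination q14) with rfl |
            r1
        · obtain rfl : k4 = e4 + 1 := by linear_combination -q20
          obtain rfl : e2 = 1 := by linear_combination -q22
          rcases mul_eq_zero.mp (show e4 * (e4 + 1) = 0 by linear_combination -q12) with rfl | r1
          · exact Or.inr (Or.inr (Or.inl rfl))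
          · obtain rfl : e4 = -1 := by linear_combination r1
            exact Or.inl rfl
        · obtain rfl : e4 = e2 - 1 := by linear_combination -r1
          rcases mul_eq_zero.mp (show e2 * (-k4 + 1) = 0 by linear_combination q12) with rfl | r2
          · obtain rfl : k4 = g4 := by linear_combination -q20
            exact absurd (show (1 : ℤ) = 0 by linear_combination q16) (by decide)
          · obtain rfl : k4 = 1 := by linear_combination -r2
            obtain rfl : g4 = 0 := by linear_combination q16
            obtain rfl : e2 = 1 := by linear_combination q20
            exact Or.inr (Or.inr (Or.inl rfl))
      · obtain rfl : k2 = -1 := by linear_combination r1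
        obtain rfl : e2 = 0 := by linear_combination q27
        obtain rfl : e4 = 0 := by linear_combination q29
        obtain rfl : e0 = 0 := by linear_combination -q23
        obtain rfl : e1 = -1 := by linear_combination q13
        obtain rfl : g4 = 0 := by linear_combination -q14
        obtain rfl : k4 = 1 := by linear_combination -q12
        exact Or.inr (Or.inr (Or.inr rfl))
  · obtain rfl : k3 = -1 := by linear_combination q19
    obtain rfl : e1 = 0 := by linear_combination -q25
    obtain rfl : e4 = -1 := by linear_combination q12
    obtain rfl : d3 = 0 := by linear_combination -q29
    obtain rfl : d1 = 1 := by linear_combination -q13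
    obtain rfl : e0 = 1 := by linear_combination -q24
    obtain rfl : k2 = e2 := by linear_combination q26
    obtain rfl : g4 = -g1 * k4 := by linear_combination q11
    rcases mul_eq_zero.mp (show d0 * g2 = 0 by linear_combination q6) with rfl | rfl
    · obtain rfl : g3 = 0 := by linear_combination q21
      rcases mul_eq_zero.mp (show g1 * (-k4 + 1) = 0 by linear_combination q10) with rfl | r1
      · obtain rfl : k4 = 0 := by linear_combination -q20
        exact absurd (show (1 : ℤ) = 0 by linear_combination q16) (by decide)
      · obtain rfl : k4 = 1 := by linear_combination -r1
        obtain rfl : g1 = -1 := by linear_combination -q20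
        obtain rfl : g2 = 0 := by linear_combination q5
        obtain rfl : k2 = 1 := by linear_combination -q4
        exact Or.inr (Or.inl rfl)
    · obtain rfl : g1 = -1 := by linear_combination q5
      obtain rfl : k2 = 1 := by linear_combination -q4
      obtain rfl : k4 = 1 := by linear_combination q14
      obtain rfl : d0 = 0 := by linear_combination q9
      obtain rfl : g3 = 0 := by linear_combination q21
      exact Or.inr (Or.inl rfl)

end ToricNeighborly

namespace ToricNeighborly

/-! ### Counting D-J classes -/

section Counting

variable {n N : ℕ} {V ι : Type} [DecidableEq V] {T : Finset (Finset V)}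
  {K : AbstractSimplicialComplex V}
  {e : ℕ → Fin n → V} {r : ι → V → Fin n → ℤ}

/-- A matrix that maps the standard basis to itself is trivial. -/
theorem mulVec_eq_self_of_single {g : Matrix (Fin n) (Fin n) ℤ}
    (h : ∀ j, g.mulVec (Pi.single j 1) = Pi.single j 1) (x : Fin n → ℤ) : g.mulVec x = x := by
  have h1 : g = 1 := by
    ext i j
    have h2 := congrFun (h j) i
    rw [Matrix.mulVec_single_one] at h2
    rw [Matrix.one_apply, ← Pi.single_apply, ← h2]
    rfl
  rw [h1, Matrix.one_mulVec]

/-- Representatives of the D-J classes are found among the solutions of the determinant equations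
along a walk through the facets. -/
theorem FanGivingMap.exists_eq_mulVec (hK : HasFacets K T) (he : IsWalk T N e)
    (hall : ∀ x : V → Fin n → ℤ, (∀ i, x (e 0 i) = Pi.single i 1) →
      (∀ k ≤ N, Matrix.det (.of fun j => x (e k j)) = (-1) ^ k) → ∃ i, x = r i)
    (ℓ : FanGivingMap n K) :
    ∃ i, ∃ g : GL (Fin n) ℤ, ∀ v, ℓ.1 v = (g : Matrix (Fin n) (Fin n) ℤ).mulVec (r i v) := by
  obtain ⟨F, hF⟩ := ℓ.2
  obtain ⟨g, x, hx, hbase, hdet⟩ := (hF.isUnimodularFan hK).exists_normal_form he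
  obtain ⟨i, rfl⟩ := hall x hbase hdet
  exact ⟨i, g, hx⟩

/-- The D-J classes correspond to the solutions of the determinant equations that belong to a
fan. -/
theorem card_djClass [Fintype ι] (hK : HasFacets K T) (hT : HasFlips T) (he : IsWalk T N e)
    (hr : ∀ i, IsUnimodularFan T (r i)) (hbase : ∀ i j, r i (e 0 j) = Pi.single j 1)
    (hinj : Function.Injective r)
    (hall : ∀ x : V → Fin n → ℤ, (∀ i, x (e 0 i) = Pi.single i 1) →
      (∀ k ≤ N, Matrix.det (.of fun j => x (e k j)) = (-1) ^ k) → ∃ i, x = r i) :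
    Nat.card (DJClass n K) = Fintype.card ι := by
  let R : ι → FanGivingMap n K := fun i =>
    ⟨r i, (hr i).fan, (hr i).isFanOf hK ((hr i).exists_mem_coneOf hT)⟩
  have hbij : Function.Bijective fun i => (Quotient.mk (djSetoid n K) (R i) : DJClass n K) := by
    constructor
    · intro i j hij
      obtain ⟨g, hg⟩ := Quotient.exact hij
      have hg : ∀ v, r j v = (g : Matrix (Fin n) (Fin n) ℤ).mulVec (r i v) := hg
      have hg1 := mulVec_eq_self_of_single (g := (g : Matrix (Fin n) (Fin n) ℤ)) fun k => by
        rw [← hbase i k, ← hg, hbase j k, hbase i k]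
      exact hinj (funext fun v => by rw [hg v, hg1])
    · intro c
      obtain ⟨ℓ, rfl⟩ := Quotient.exists_rep c
      obtain ⟨i, g, hg⟩ := FanGivingMap.exists_eq_mulVec hK he hall ℓ
      exact ⟨i, Quotient.sound ⟨g, hg⟩⟩
  rw [← Nat.card_eq_fintype_card]
  exact (Nat.card_congr (Equiv.ofBijective _ hbij)).symm

/-- The two characteristic maps over `K27`. -/
def maps27 : Fin 2 → Fin 9 → Fin 5 → ℤ := ![map27a, map27b]

/-- The four characteristic maps over `K28`. -/
def maps28 : Fin 4 → Fin 9 → Fin 5 → ℤ := ![map28a, map28b, map28c, map28d]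

theorem isUnimodularFan_maps27 (i : Fin 2) : IsUnimodularFan (walkFacets walk27) (maps27 i) := by
  fin_cases i
  exacts [isUnimodularFan_map27a, isUnimodularFan_map27b]

theorem isUnimodularFan_maps28 (i : Fin 4) : IsUnimodularFan (walkFacets walk28) (maps28 i) := by
  fin_cases i
  exacts [isUnimodularFan_map28a, isUnimodularFan_map28b, isUnimodularFan_map28c,
    isUnimodularFan_map28d]

theorem exists_eq_maps27 {x : Fin 9 → Fin 5 → ℤ} (h0 : ∀ i, x (walk27.getD 0 0 i) = Pi.single i 1)
    (hdet : ∀ k ≤ 29, Matrix.det (.of fun j => x (walk27.getD k 0 j)) = (-1) ^ k) :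
    ∃ i, x = maps27 i := by
  rcases eq_map27_of_det h0 hdet with h | h
  exacts [⟨0, h⟩, ⟨1, h⟩]

theorem exists_eq_maps28 {x : Fin 9 → Fin 5 → ℤ} (h0 : ∀ i, x (walk28.getD 0 0 i) = Pi.single i 1)
    (hdet : ∀ k ≤ 29, Matrix.det (.of fun j => x (walk28.getD k 0 j)) = (-1) ^ k) :
    ∃ i, x = maps28 i := by
  rcases eq_map28_of_det h0 hdet with h | h | h | h
  exacts [⟨0, h⟩, ⟨1, h⟩, ⟨2, h⟩, ⟨3, h⟩]

theorem card_djClass_K27 : Nat.card (DJClass 5 K27) = 2 :=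
  card_djClass hasFacets_K27 hasFlips_walk27 isWalk_walk27 isUnimodularFan_maps27
    (by decide +kernel) (by decide +kernel) fun _ => exists_eq_maps27

theorem card_djClass_K28 : Nat.card (DJClass 5 K28) = 4 :=
  card_djClass hasFacets_K28 hasFlips_walk28 isWalk_walk28 isUnimodularFan_maps28
    (by decide +kernel) (by decide +kernel) fun _ => exists_eq_maps28

end Counting

end ToricNeighborly

namespace ToricNeighborly

open CategoryTheory

/-! ### Support functions of the toric manifolds -/

section Supports

variable {n N : ℕ} {V : Type} [DecidableEq V] {T : Finset (Finset V)}
  {K : AbstractSimplicialComplex V}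
  {ℓ r : V → Fin n → ℤ} {F : Fan n} {X : Over specC} {g : Matrix (Fin n) (Fin n) ℤ}

theorem HasFlips.exists_erase_subset (hT : HasFlips T) {t : Finset V} (ht : t ∈ T) {v : V}
    (hv : v ∈ t) : ∃ t' ∈ T, t.erase v ⊆ t' ∧ v ∉ t' := by
  obtain ⟨v', hv', ht'⟩ := hT t ht v hv
  refine ⟨_, ht', Finset.subset_insert _ _, fun h => ?_⟩
  rcases Finset.mem_insert.mp h with rfl | h
  · exact hv' hv
  · exact Finset.notMem_erase _ _ h

omit [DecidableEq V] in
theorem IsStrictSupport.mulVec {h : V → ℤ} {m : Finset V → Fin n → ℤ} (H : IsStrictSupport T r h m)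
    {g : GL (Fin n) ℤ} (hg : ∀ v, ℓ v = (g : Matrix (Fin n) (Fin n) ℤ).mulVec (r v)) :
    IsStrictSupport T ℓ h fun t => Matrix.vecMul (m t) (g⁻¹ : GL (Fin n) ℤ) := by
  intro t ht v
  have h1 : Matrix.vecMul (m t) (g⁻¹ : GL (Fin n) ℤ) ⬝ᵥ ℓ v = m t ⬝ᵥ r v := by
    rw [hg v, ← Matrix.dotProduct_mulVec, Matrix.mulVec_mulVec, ← Units.val_mul, inv_mul_cancel,
      Units.val_one, Matrix.one_mulVec]
  simp only [h1]
  exact H t ht v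

/-- A criterion for a strict support function that is decided by computation. -/
theorem exists_isStrictSupport {ℓ : Fin N → Fin 5 → ℤ} {L : List (Fin 5 → Fin N)} {B : List ℕ}
    (hB : (L.map fun e => bits (Finset.univ.image e)) = B) {M : List (Fin 5 → ℤ)} {h : Fin N → ℤ}
    (hM : ∀ a ∈ B, ∃ f ∈ M, ∀ v : Fin N, (a.testBit v = true → dot5 f (ℓ v) = h v) ∧
      (a.testBit v = false → h v < dot5 f (ℓ v))) : ∃ m, IsStrictSupport (walkFacets L) ℓ h m := by
  choose! m hm using hM
  refine ⟨fun t => m (bits t), fun t ht v => ?_⟩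
  obtain ⟨e, he, rfl⟩ := mem_walkFacets.mp ht
  have h1 := (hm _ (hB ▸ List.mem_map_of_mem he)).2 v
  have h2 := mem_bitSet (N := N) (a := bits (Finset.univ.image e)) (v := v)
  rw [bitSet_bits] at h2
  simp only [h2, dotProduct_eq_dot5, Bool.not_eq_true]
  exact h1

/-- The linear relation `∑ r w • ℓ w = 0` between the vectors of two adjacent facets, which differ
by the exchange of `v` and `v'`. -/
structure IsWallRelation [Fintype V] (T : Finset (Finset V)) (ℓ : V → Fin n → ℤ) (t : Finset V)
    (v v' : V) (c : V → ℤ) : Prop where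
  mem : t ∈ T
  mem' : insert v' (t.erase v) ∈ T
  not_mem : v' ∉ t
  mem_vertex : v ∈ t
  eq_one : c v' = 1
  eq_zero : ∀ w, w ∉ t → w ≠ v' → c w = 0
  sum_eq : ∑ w, c w • ℓ w = 0

theorem IsWallRelation.mulVec [Fintype V] {t : Finset V} {v v' : V} {c : V → ℤ}
    (hc : IsWallRelation T r t v v' c) (hg : ∀ v, ℓ v = g.mulVec (r v)) :
    IsWallRelation T ℓ t v v' c where
  __ := hc
  sum_eq := by
    have h1 : ∀ w, c w • ℓ w = g.mulVec (c w • r w) := fun w => by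
      rw [hg w, Matrix.mulVec_smul]
    rw [Finset.sum_congr rfl fun w _ => h1 w, ← Matrix.mulVec_sum, hc.sum_eq, Matrix.mulVec_zero]

/-- A concave support function with different linear functions on different cones is strictly
concave across each wall. -/
theorem IsWallRelation.sum_mul_neg [Fintype V] {t : Finset V} {v v' : V} {c : V → ℤ}
    (hc : IsWallRelation T ℓ t v v' c) (hU : IsUnimodularFan T ℓ) {h : V → ℤ}
    {m : Finset V → Fin n → ℤ} (hm : ∀ t ∈ T, (∀ v, h v ≤ m t ⬝ᵥ ℓ v) ∧
      (∀ v ∈ t, m t ⬝ᵥ ℓ v = h v) ∧ ∀ s ∈ T, m s = m t → s = t) : ∑ w, c w * h w < 0 := by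
  have h1 : ∑ w, c w * h w = h v' - m t ⬝ᵥ ℓ v' := by
    have h2 : ∑ w, c w * (m t ⬝ᵥ ℓ w) = 0 := by
      have h3 := congrArg (m t ⬝ᵥ ·) hc.sum_eq
      simpa only [dotProduct_sum, dotProduct_smul, smul_eq_mul, dotProduct_zero] using h3
    rw [← sub_zero (∑ w, c w * h w), ← h2, ← Finset.sum_sub_distrib,
      Finset.sum_eq_single_of_mem v' (Finset.mem_univ _), hc.eq_one, one_mul, one_mul]
    intro w _ hw
    by_cases hwt : w ∈ t
    · rw [(hm t hc.mem).2.1 w hwt, sub_self]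
    · rw [hc.eq_zero w hwt hw, zero_mul, zero_mul, sub_self]
  rw [h1, sub_neg]
  refine lt_of_le_of_ne ((hm t hc.mem).1 v') fun heq => hc.not_mem ?_
  -- otherwise the linear functions of the two facets agree on the vectors of the second one
  obtain ⟨d, hd⟩ := hU.exists_dual _ hc.mem'
  have h2 : m t = m (insert v' (t.erase v)) := by
    rw [hd.eq_sum_dual (m t), hd.eq_sum_dual (m (insert v' (t.erase v)))]
    refine Finset.sum_congr rfl fun w hw => ?_
    rw [(hm _ hc.mem').2.1 w hw]
    rcases Finset.mem_insert.mp hw with rfl | hw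
    · rw [heq]
    · rw [(hm t hc.mem).2.1 w (Finset.mem_of_mem_erase hw)]
  rw [(hm _ hc.mem').2.2 t hc.mem h2]
  exact Finset.mem_insert_self _ _

/-- Three wall relations with sum zero exclude a strictly concave support function, hence a
projective embedding. -/
theorem IsFanOf.not_isProjective [Fintype V] (hF : IsFanOf K ℓ F) (hK : HasFacets K T)
    (hX : IsToricVarietyOf F X) (hg : ∀ v, ℓ v = g.mulVec (r v)) {t₁ t₂ t₃ : Finset V}
    {v₁ v₁' v₂ v₂' v₃ v₃' : V} {r₁ r₂ r₃ : V → ℤ} (h₁ : IsWallRelation T r t₁ v₁ v₁' r₁)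
    (h₂ : IsWallRelation T r t₂ v₂ v₂' r₂) (h₃ : IsWallRelation T r t₃ v₃ v₃' r₃)
    (hsum : ∀ v, r₁ v + r₂ v + r₃ v = 0) : ¬ IsProjective X := by
  intro hp
  obtain ⟨h, m, hm⟩ := hF.exists_support hK hX hp
  have hU := hF.isUnimodularFan hK
  have h1 := (h₁.mulVec hg).sum_mul_neg hU hm
  have h2 := (h₂.mulVec hg).sum_mul_neg hU hm
  have h3 := (h₃.mulVec hg).sum_mul_neg hU hm
  have h4 : ∑ w, r₁ w * h w + ∑ w, r₂ w * h w + ∑ w, r₃ w * h w = 0 := by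
    rw [← Finset.sum_add_distrib, ← Finset.sum_add_distrib]
    exact Finset.sum_eq_zero fun w _ => by rw [← add_mul, ← add_mul, hsum, zero_mul]
  omega

/-- The values of a strictly concave support function on the rays of the fan of `map27a`. -/
def height27a : Fin 9 → ℤ := ![-2, -1, -1, -2, -2, -2, -2, -2, -1]

/-- The covectors of the support function `height27a` on the facets, in the order of the walk. -/
def vertices27a : List (Fin 5 → ℤ) :=
  [![-2, -2, -2, -2, -1], ![4, -2, -2, -2, -1], ![4, 5, -2, -2, -1], ![1, 5, -2, -2, -1],
    ![-2, 2, -2, -2, -1], ![-2, 2, 1, -2, -1], ![-2, 0, 3, -2, -1], ![-1, 0, 3, -2, -1],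
    ![-1, -2, 3, -2, -1], ![-2, -2, 3, -2, -1], ![-2, -2, 4, -2, 0], ![-2, -1, 4, -2, 0],
    ![-2, -1, 4, -2, 2], ![4, 5, -2, -2, 2], ![4, -2, -2, -2, 9], ![-2, -2, 4, -2, 3],
    ![-2, -2, -2, -2, 3], ![-2, -2, -2, 2, -1], ![-2, -2, -1, 2, -1], ![-2, 0, 1, 0, -1],
    ![1, 0, -2, 3, -1], ![4, 0, -2, 3, -1], ![4, -2, -2, 3, -1], ![-1, -2, -2, 3, -1],
    ![3, -2, -2, 5, 1], ![4, -2, -2, 5, 1], ![4, -2, -2, 5, 2], ![-2, -2, 4, -1, 2],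
    ![-2, -2, 3, 0, 1], ![-2, -2, 4, -1, 1]]

theorem exists_covector_map27a : ∀ a ∈ facetBits27, ∃ f ∈ vertices27a, ∀ v : Fin 9,
    (a.testBit v = true → dot5 f (map27a v) = height27a v) ∧
      (a.testBit v = false → height27a v < dot5 f (map27a v)) := by
  decide +kernel

theorem exists_isStrictSupport_map27a :
    ∃ m, IsStrictSupport (walkFacets walk27) map27a height27a m :=
  exists_isStrictSupport map_bits_walk27 exists_covector_map27a

/-- The values of a strictly concave support function on the rays of the fan of `map27b`. -/
def height27b : Fin 9 → ℤ := ![-2, -1, -1, -2, -2, -2, -1, -2, -2]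

/-- The covectors of the support function `height27b` on the facets, in the order of the walk. -/
def vertices27b : List (Fin 5 → ℤ) :=
  [![-2, -2, -2, -1, -2], ![3, -2, -2, -1, -2], ![3, 0, -2, -1, -2], ![1, 2, -2, -1, -2],
    ![-2, 2, -2, -1, -2], ![-2, 5, 1, -1, -2], ![-2, 5, 4, -1, -2], ![3, 0, -1, -1, -2],
    ![3, -2, -1, -1, -2], ![-2, -2, 4, -1, -2], ![-2, -2, 4, -1, 3], ![-2, 0, 4, -1, 3],
    ![-2, 0, 1, -1, 3], ![1, 0, -2, -1, 0], ![-1, -2, -2, -1, 2], ![-2, -2, -1, -1, 3],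
    ![-2, -2, -2, -1, 2], ![-2, -2, -2, 3, -2], ![-2, -2, 4, 9, -2], ![-2, 5, 4, 2, -2],
    ![4, -1, -2, 2, -2], ![4, -1, -2, 0, -2], ![4, -2, -2, 0, -2], ![4, -2, -2, 3, -2],
    ![4, -2, -2, 2, -1], ![4, -2, -2, 1, -1], ![3, -2, -2, 1, 0], ![-2, -2, 3, 1, 5],
    ![-2, -2, 4, 2, 5], ![-2, -2, 4, 1, 5]]

theorem exists_covector_map27b : ∀ a ∈ facetBits27, ∃ f ∈ vertices27b, ∀ v : Fin 9,
    (a.testBit v = true → dot5 f (map27b v) = height27b v) ∧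
      (a.testBit v = false → height27b v < dot5 f (map27b v)) := by
  decide +kernel

theorem exists_isStrictSupport_map27b :
    ∃ m, IsStrictSupport (walkFacets walk27) map27b height27b m :=
  exists_isStrictSupport map_bits_walk27 exists_covector_map27b

theorem isProjective_of_K27 {ℓ : FanGivingMap 5 K27} (hX : IsToricManifoldOf K27 ℓ.1 X) :
    IsProjective X := by
  obtain ⟨F, hF, hX⟩ := hX
  obtain ⟨i, g, hg⟩ := FanGivingMap.exists_eq_mulVec hasFacets_K27 isWalk_walk27
    (fun _ => exists_eq_maps27) ℓ
  have hadj := fun t ht v hv => hasFlips_walk27.exists_erase_subset (t := t) ht (v := v) hv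
  fin_cases i
  · obtain ⟨m, hm⟩ := exists_isStrictSupport_map27a
    exact hF.isProjective hasFacets_K27 hadj (hm.mulVec hg) hX
  · obtain ⟨m, hm⟩ := exists_isStrictSupport_map27b
    exact hF.isProjective hasFacets_K27 hadj (hm.mulVec hg) hX

theorem not_isProjective_map28a {ℓ : Fin 9 → Fin 5 → ℤ} {F : Fan 5} {X : Over specC}
    (hF : IsFanOf K28 ℓ F) (hX : IsToricVarietyOf F X) {g : Matrix (Fin 5) (Fin 5) ℤ}
    (hg : ∀ v, ℓ v = g.mulVec (map28a v)) : ¬ IsProjective X :=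
  hF.not_isProjective hasFacets_K28 hX hg
    (r₁ := ![1, 1, 0, -1, 0, -1, 1, 0, -1]) (r₂ := ![-1, 0, 0, 1, -1, 1, -2, 1, 0])
    (r₃ := ![0, -1, 0, 0, 1, 0, 1, -1, 1])
    (.mk (t := {1, 3, 5, 6, 8}) (v := 6) (v' := 0) (by decide +kernel)
      (by decide +kernel) (by decide) (by decide) (by decide) (by decide) (by decide +kernel))
    (.mk (t := {0, 4, 5, 6, 7}) (v := 7) (v' := 3) (by decide +kernel)
      (by decide +kernel) (by decide) (by decide) (by decide) (by decide) (by decide +kernel))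
    (.mk (t := {1, 3, 6, 7, 8}) (v := 8) (v' := 4) (by decide +kernel)
      (by decide +kernel) (by decide) (by decide) (by decide) (by decide) (by decide +kernel))
    (by decide)

theorem not_isProjective_map28b {ℓ : Fin 9 → Fin 5 → ℤ} {F : Fan 5} {X : Over specC}
    (hF : IsFanOf K28 ℓ F) (hX : IsToricVarietyOf F X) {g : Matrix (Fin 5) (Fin 5) ℤ}
    (hg : ∀ v, ℓ v = g.mulVec (map28b v)) : ¬ IsProjective X :=
  hF.not_isProjective hasFacets_K28 hX hg
    (r₁ := ![-1, 1, -2, -1, 1, 1, 0, 0, 0]) (r₂ := ![1, 0, 1, 0, 0, -1, 1, -1, 0])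
    (r₃ := ![0, -1, 1, 1, -1, 0, -1, 1, 0])
    (.mk (t := {0, 2, 3, 4, 5}) (v := 5) (v' := 1) (by decide +kernel)
      (by decide +kernel) (by decide) (by decide) (by decide) (by decide) (by decide +kernel))
    (.mk (t := {2, 5, 6, 7, 8}) (v := 6) (v' := 0) (by decide +kernel)
      (by decide +kernel) (by decide) (by decide) (by decide) (by decide) (by decide +kernel))
    (.mk (t := {1, 3, 4, 6, 7}) (v := 7) (v' := 2) (by decide +kernel)
      (by decide +kernel) (by decide) (by decide) (by decide) (by decide) (by decide +kernel))
    (by decide)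

theorem not_isProjective_map28c {ℓ : Fin 9 → Fin 5 → ℤ} {F : Fan 5} {X : Over specC}
    (hF : IsFanOf K28 ℓ F) (hX : IsToricVarietyOf F X) {g : Matrix (Fin 5) (Fin 5) ℤ}
    (hg : ∀ v, ℓ v = g.mulVec (map28c v)) : ¬ IsProjective X :=
  hF.not_isProjective hasFacets_K28 hX hg
    (r₁ := ![1, 1, 0, -1, 0, -1, 1, 0, -1]) (r₂ := ![-1, 0, -1, 0, 1, 1, 0, -1, 1])
    (r₃ := ![0, -1, 1, 1, -1, 0, -1, 1, 0])
    (.mk (t := {1, 3, 5, 6, 8}) (v := 6) (v' := 0) (by decide +kernel)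
      (by decide +kernel) (by decide) (by decide) (by decide) (by decide) (by decide +kernel))
    (.mk (t := {0, 2, 5, 7, 8}) (v := 8) (v' := 4) (by decide +kernel)
      (by decide +kernel) (by decide) (by decide) (by decide) (by decide) (by decide +kernel))
    (.mk (t := {1, 3, 4, 6, 7}) (v := 7) (v' := 2) (by decide +kernel)
      (by decide +kernel) (by decide) (by decide) (by decide) (by decide) (by decide +kernel))
    (by decide)

theorem not_isProjective_map28d {ℓ : Fin 9 → Fin 5 → ℤ} {F : Fan 5} {X : Over specC}
    (hF : IsFanOf K28 ℓ F) (hX : IsToricVarietyOf F X) {g : Matrix (Fin 5) (Fin 5) ℤ}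
    (hg : ∀ v, ℓ v = g.mulVec (map28d v)) : ¬ IsProjective X :=
  hF.not_isProjective hasFacets_K28 hX hg
    (r₁ := ![0, -1, 1, 1, 0, -1, 0, 0, 1]) (r₂ := ![1, 1, 0, -1, -1, 0, 0, 1, -2])
    (r₃ := ![-1, 0, -1, 0, 1, 1, 0, -1, 1])
    (.mk (t := {1, 3, 5, 6, 8}) (v := 8) (v' := 2) (by decide +kernel)
      (by decide +kernel) (by decide) (by decide) (by decide) (by decide) (by decide +kernel))
    (.mk (t := {1, 3, 4, 7, 8}) (v := 7) (v' := 0) (by decide +kernel)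
      (by decide +kernel) (by decide) (by decide) (by decide) (by decide) (by decide +kernel))
    (.mk (t := {0, 2, 5, 7, 8}) (v := 8) (v' := 4) (by decide +kernel)
      (by decide +kernel) (by decide) (by decide) (by decide) (by decide) (by decide +kernel))
    (by decide)

theorem not_isProjective_of_K28 {ℓ : FanGivingMap 5 K28} (hX : IsToricManifoldOf K28 ℓ.1 X) :
    ¬ IsProjective X := by
  obtain ⟨F, hF, hX⟩ := hX
  obtain ⟨i, g, hg⟩ := FanGivingMap.exists_eq_mulVec hasFacets_K28 isWalk_walk28
    (fun _ => exists_eq_maps28) ℓ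
  fin_cases i
  exacts [not_isProjective_map28a hF hX hg, not_isProjective_map28b hF hX hg,
    not_isProjective_map28c hF hX hg, not_isProjective_map28d hF hX hg]

end Supports

end ToricNeighborly

namespace ToricNeighborly

/-! ### Simplicial polytopes -/

section Polytopes

variable {n N : ℕ} {V : Type} {T : Finset (Finset V)} {K : AbstractSimplicialComplex V}
  {p : V → Fin n → ℝ} {φ : Finset V → Module.Dual ℝ (Fin n → ℝ)}

/-- The points of a finite configuration where a linear form attains its maximum span the face where
it does. -/
theorem mem_convexHull_image_of_apply_eq {l : Module.Dual ℝ (Fin n → ℝ)} {s : Set V} {c : ℝ}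
    (hs : ∀ v ∈ s, l (p v) = c) (hs' : ∀ v ∉ s, l (p v) < c) {x : Fin n → ℝ}
    (hx : x ∈ convexHull ℝ (Set.range p)) (hlx : l x = c) : x ∈ convexHull ℝ (p '' s) := by
  have hB : convexHull ℝ (p '' sᶜ) ⊆ {y | l y < c} :=
    convexHull_min (by rintro _ ⟨v, hv, rfl⟩; exact hs' v hv) (convex_halfSpace_lt l.isLinear c)
  have hA : convexHull ℝ (p '' s) ⊆ {y | l y = c} :=
    convexHull_min (by rintro _ ⟨v, hv, rfl⟩; exact hs v hv) (convex_hyperplane l.isLinear c)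
  rw [← Set.image_univ, ← Set.union_compl_self s, Set.image_union] at hx
  rcases (p '' s).eq_empty_or_nonempty with h0 | h0
  · rw [h0, Set.empty_union] at hx
    exact absurd hlx (hB hx).ne
  rcases (p '' sᶜ).eq_empty_or_nonempty with h1 | h1
  · rwa [h1, Set.union_empty] at hx
  rw [convexHull_union h0 h1, mem_convexJoin] at hx
  obtain ⟨a, ha, b, hb, α, β, hα, hβ, hαβ, rfl⟩ := hx
  have h2 : l a = c := hA ha
  have h3 : l b < c := hB hb
  rw [map_add, map_smul, map_smul, smul_eq_mul, smul_eq_mul, h2] at hlx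
  have h4 : β * (c - l b) = 0 := by linear_combination c * hαβ - hlx
  have h5 : β = 0 := (mul_eq_zero.mp h4).resolve_right (sub_pos.mpr h3).ne'
  rw [h5, add_zero] at hαβ
  rwa [h5, hαβ, one_smul, zero_smul, add_zero]

variable [DecidableEq V]

/-- In a complex without boundary, a face is the intersection of the facets that contain it. -/
theorem HasFlips.exists_notMem (hT : HasFlips T) {s t : Finset V} (ht : t ∈ T) (hst : s ⊆ t) {v : V}
    (hv : v ∉ s) : ∃ t' ∈ T, s ⊆ t' ∧ v ∉ t' := by
  by_cases hvt : v ∈ t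
  · obtain ⟨t', ht', h1, h2⟩ := hT.exists_erase_subset ht hvt
    exact ⟨t', ht', fun w hw => h1 (Finset.mem_erase.mpr ⟨fun h => hv (h ▸ hw), hst hw⟩), h2⟩
  · exact ⟨t, ht, hst, hvt⟩

/-- Each face of the complex has a linear form whose maximum on the points is attained exactly at
the vertices of the face: the sum of the linear forms of the facets that contain the face. -/
theorem exists_apply_eq_of_subset (hT : HasFlips T) (hφ : ∀ t ∈ T, ∀ v ∈ t, φ t (p v) = 1)
    (hφ' : ∀ t ∈ T, ∀ v ∉ t, φ t (p v) < 1) {s t : Finset V} (ht : t ∈ T) (hst : s ⊆ t) :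
    ∃ (l : Module.Dual ℝ (Fin n → ℝ)) (c : ℝ), (∀ v ∈ s, l (p v) = c) ∧ ∀ v ∉ s, l (p v) < c := by
  classical
  refine ⟨∑ t ∈ T with s ⊆ t, φ t, ∑ t ∈ T with s ⊆ t, 1, fun v hv => ?_, fun v hv => ?_⟩
  · rw [LinearMap.sum_apply]
    refine Finset.sum_congr rfl fun t ht => ?_
    rw [Finset.mem_filter] at ht
    exact hφ t ht.1 v (ht.2 hv)
  · rw [LinearMap.sum_apply]
    obtain ⟨t', ht', hst', hvt'⟩ := hT.exists_notMem ht hst hv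
    refine Finset.sum_lt_sum (fun t ht => ?_)
      ⟨t', Finset.mem_filter.mpr ⟨ht', hst'⟩, hφ' t' ht' v hvt'⟩
    rw [Finset.mem_filter] at ht
    by_cases h : v ∈ t
    · exact (hφ t ht.1 v h).le
    · exact (hφ' t ht.1 v h).le

/-- The cones over the facets cover the space: the linear form of a facet and that of a neighbor
differ by a multiple of the coordinate of the vertex that is exchanged. -/
theorem exists_eq_sum_of_facets (hT : HasFlips T) (hne : T.Nonempty) (hcard : ∀ t ∈ T, t.card = n)
    (hφ : ∀ t ∈ T, ∀ v ∈ t, φ t (p v) = 1) (hφ' : ∀ t ∈ T, ∀ v ∉ t, φ t (p v) < 1)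
    (x : Fin n → ℝ) : ∃ t ∈ T, ∃ c : V → ℝ, (∀ v, 0 ≤ c v) ∧ x = ∑ v ∈ t, c v • p v := by
  refine exists_mem_cone hne (fun t ht => ?_) x
  choose! f hf hf' using hT t ht
  have hmem : ∀ v ∈ t, v ∉ insert (f v) (t.erase v) := fun v hv h => by
    rcases Finset.mem_insert.mp h with h | h
    · exact hf v hv (h ▸ hv)
    · exact Finset.notMem_erase _ _ h
  refine ⟨fun v => φ t - φ (insert (f v) (t.erase v)), hcard t ht, fun v hv => ?_,
    fun v hv w hw hvw => ?_, fun v hv => ⟨f v, hf v hv, hf' v hv, ?_⟩⟩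
  · rw [LinearMap.sub_apply, hφ t ht v hv]
    exact sub_pos.mpr (hφ' _ (hf' v hv) v (hmem v hv))
  · rw [LinearMap.sub_apply, hφ t ht w hw, hφ _ (hf' v hv) w
      (Finset.mem_insert_of_mem (Finset.mem_erase.mpr ⟨hvw.symm, hw⟩)), sub_self]
  · rw [LinearMap.sub_apply, hφ _ (hf' v hv) _ (Finset.mem_insert_self _ _)]
    exact sub_neg.mpr (hφ' t ht _ (hf v hv))

/-- If each facet of a complex without boundary has a linear form that is at most `1` on all points,
with equality at its vertices only, then the complex is the boundary complex of the convex hull. -/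
theorem isPolytopal_of_linear_forms [Finite V] (hK : HasFacets K T) (hT : HasFlips T)
    (hcard : ∀ t ∈ T, t.card = n) (hφ : ∀ t ∈ T, ∀ v ∈ t, φ t (p v) = 1)
    (hφ' : ∀ t ∈ T, ∀ v ∉ t, φ t (p v) < 1) : IsPolytopal n K := by
  have hcone := exists_eq_sum_of_facets hT hK.nonempty hcard hφ hφ'
  have hle : ∀ t ∈ T, ∀ v, φ t (p v) ≤ 1 := fun t ht v => by
    by_cases h : v ∈ t
    · exact (hφ t ht v h).le
    · exact (hφ' t ht v h).le
  have hface : ∀ s ∈ K.faces, ∃ (l : Module.Dual ℝ (Fin n → ℝ)) (c : ℝ), (∀ v ∈ s, l (p v) = c) ∧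
      ∀ v ∉ s, l (p v) < c := by
    intro s hs
    obtain ⟨t, ht, hst⟩ := (hK.mem_faces_iff s (K.isRelLowerSet_faces hs).1).mp hs
    exact exists_apply_eq_of_subset hT hφ hφ' ht hst
  have hexp : ∀ s ∈ K.faces, IsExposed ℝ (convexHull ℝ (Set.range p))
      (convexHull ℝ (p '' (s : Set V))) := by
    intro s hs _
    obtain ⟨l, c, hl, hl'⟩ := hface s hs
    have hlc : ∀ x ∈ convexHull ℝ (Set.range p), l x ≤ c := fun x hx => by
      refine convexHull_min ?_ (convex_halfSpace_le l.isLinear c) hx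
      rintro _ ⟨v, rfl⟩
      by_cases h : v ∈ s
      · exact (hl v h).le
      · exact (hl' v h).le
    obtain ⟨w, hw⟩ := (K.isRelLowerSet_faces hs).1
    refine ⟨LinearMap.toContinuousLinearMap l, Set.ext fun x => ⟨fun hx => ?_, fun hx => ?_⟩⟩
    · have h1 : l x = c := by
        refine convexHull_min ?_ (convex_hyperplane l.isLinear c) hx
        rintro _ ⟨v, hv, rfl⟩
        exact hl v hv
      exact ⟨convexHull_mono (Set.image_subset_range _ _) hx, fun y hy => (hlc y hy).trans h1.ge⟩
    · refine mem_convexHull_image_of_apply_eq (fun v hv => hl v hv) (fun v hv => hl' v hv) hx.1 ?_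
      exact le_antisymm (hlc x hx.1) ((hl w hw).ge.trans
        (hx.2 (p w) (subset_convexHull ℝ _ ⟨w, rfl⟩)))
  refine ⟨inferInstance, p, fun v w hvw => ?_,
    Set.Subset.antisymm ?_ extremePoints_convexHull_subset, ?_,
    fun s hs => ⟨fun hsK => ⟨hexp s hsK, fun heq => ?_⟩, fun ⟨h1, h2⟩ => ?_⟩⟩
  · obtain ⟨l, c, hl, hl'⟩ := hface {v} (K.singleton_mem v)
    by_contra hne
    have h1 := hl' w (by simpa using Ne.symm hne)
    rw [← hvw, hl v (Finset.mem_singleton_self v)] at h1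
    exact lt_irrefl _ h1
  · rintro _ ⟨v, rfl⟩
    have h1 := (hexp {v} (K.singleton_mem v)).isExtreme
    rwa [Finset.coe_singleton, Set.image_singleton, convexHull_singleton, isExtreme_singleton] at h1
  · -- the origin is a convex combination of the points, which generate the space
    obtain ⟨t, ht⟩ := hK.nonempty
    obtain ⟨v, hv⟩ := hK.nonempty_of_mem t ht
    have h0 : (0 : Fin n → ℝ) ∈ affineSpan ℝ (Set.range p) := by
      obtain ⟨t', -, c, hc, hx⟩ := hcone (-p v)
      have hpos : 0 < 1 + ∑ w ∈ t', c w := add_pos_of_pos_of_nonneg one_pos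
        (Finset.sum_nonneg fun w _ => hc w)
      refine convexHull_subset_affineSpan _ ?_
      by_cases hc0 : ∑ w ∈ t', c w = 0
      · have h1 : p v = 0 := by
          rw [← neg_eq_zero, hx]
          refine Finset.sum_eq_zero fun w hw => ?_
          rw [(Finset.sum_eq_zero_iff_of_nonneg fun w _ => hc w).mp hc0 w hw, zero_smul]
        exact h1 ▸ subset_convexHull ℝ _ ⟨v, rfl⟩
      · have hcpos : 0 < ∑ w ∈ t', c w :=
          lt_of_le_of_ne (Finset.sum_nonneg fun w _ => hc w) (Ne.symm hc0)
        have h1 := t'.centerMass_mem_convexHull (s := Set.range p) (z := p) (fun w _ => hc w) hcpos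
          fun w _ => ⟨w, rfl⟩
        rw [Finset.centerMass, ← hx] at h1
        have h2 := (convex_convexHull ℝ (Set.range p)) (subset_convexHull ℝ _ ⟨v, rfl⟩) h1
          (a := 1 / (1 + ∑ w ∈ t', c w)) (b := (∑ w ∈ t', c w) / (1 + ∑ w ∈ t', c w))
          (by positivity) (by positivity) (by field_simp)
        have h3 : (1 / (1 + ∑ w ∈ t', c w)) • p v + ((∑ w ∈ t', c w) / (1 + ∑ w ∈ t', c w)) •
            ((∑ w ∈ t', c w)⁻¹ • -p v) = 0 := by
          rw [smul_smul, smul_neg, ← sub_eq_add_neg, ← sub_smul]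
          have h4 : 1 / (1 + ∑ w ∈ t', c w) - (∑ w ∈ t', c w) / (1 + ∑ w ∈ t', c w) *
              (∑ w ∈ t', c w)⁻¹ = 0 := by
            field_simp
            ring
          rw [h4, zero_smul]
        rwa [h3] at h2
    rw [eq_top_iff]
    intro x _
    obtain ⟨t', -, c, -, hx⟩ := hcone x
    have h1 : x ∈ (affineSpan ℝ (Set.range p)).direction := by
      rw [hx]
      refine Submodule.sum_mem _ fun w _ => Submodule.smul_mem _ _ ?_
      have h2 := AffineSubspace.vsub_mem_direction (mem_affineSpan ℝ (Set.mem_range_self w)) h0 (p₁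
          := p w)
      simpa using h2
    simpa using AffineSubspace.vadd_mem_of_mem_direction h1 h0
  · obtain ⟨l, c, hl, hl'⟩ := hface s hsK
    obtain ⟨t, ht, hst⟩ := (hK.mem_faces_iff s hs).mp hsK
    obtain ⟨v, hv⟩ := hs
    obtain ⟨v', hv', -⟩ := hT t ht v (hst hv)
    have h1 : p v' ∈ convexHull ℝ (p '' (s : Set V)) :=
      heq ▸ subset_convexHull ℝ _ ⟨v', rfl⟩
    have h2 : l (p v') = c := by
      refine convexHull_min ?_ (convex_hyperplane l.isLinear c) h1
      rintro _ ⟨v, hv, rfl⟩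
      exact hl v hv
    exact (hl' v' fun h => hv' (hst h)).ne h2
  · obtain ⟨v, hv⟩ := hs
    obtain ⟨l, hl⟩ := h1 ⟨p v, subset_convexHull ℝ _ ⟨v, hv, rfl⟩⟩
    have hmax : ∀ w ∈ s, ∀ w', l (p w') ≤ l (p w) := fun w hw w' => by
      have h3 : p w ∈ convexHull ℝ (p '' (s : Set V)) := subset_convexHull ℝ _ ⟨w, hw, rfl⟩
      rw [hl] at h3
      exact h3.2 _ (subset_convexHull ℝ _ ⟨w', rfl⟩)
    have hpos : 0 < l (p v) := by
      by_contra! hneg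
      have hl0 : ∀ x, l x ≤ 0 := fun x => by
        obtain ⟨t, -, c, hc, rfl⟩ := hcone x
        rw [map_sum]
        refine Finset.sum_nonpos fun w _ => ?_
        rw [map_smul]
        exact mul_nonpos_of_nonneg_of_nonpos (hc w) ((hmax v hv w).trans hneg)
      have hl0' : ∀ x, l x = 0 := fun x => le_antisymm (hl0 x) (by simpa using hl0 (-x))
      refine h2 (hl.trans (Set.ext fun x => ⟨fun hx => hx.1, fun hx => ⟨hx, fun y _ => ?_⟩⟩))
      rw [hl0', hl0']
    -- the facet whose cone contains the sum of the vertices of `s` contains `s`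
    obtain ⟨t, ht, c, hc, hx⟩ := hcone (∑ w ∈ s, p w)
    have h3 : ∑ w ∈ s, φ t (p w) = ∑ w ∈ t, c w := by
      rw [← map_sum, hx, map_sum]
      exact Finset.sum_congr rfl fun w hw => by rw [map_smul, hφ t ht w hw, smul_eq_mul, mul_one]
    have h4 : (s.card : ℝ) * l (p v) ≤ (∑ w ∈ t, c w) * l (p v) := by
      have h5 : ∑ w ∈ s, l (p w) = s.card * l (p v) := by
        rw [Finset.sum_congr rfl fun w hw => le_antisymm (hmax v hv w) (hmax w hw v),
          Finset.sum_const, nsmul_eq_mul]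
      rw [← h5, ← map_sum, hx, map_sum, Finset.sum_mul]
      refine Finset.sum_le_sum fun w _ => ?_
      rw [map_smul, smul_eq_mul]
      exact mul_le_mul_of_nonneg_left (hmax v hv w) (hc w)
    have h5 : (s.card : ℝ) ≤ ∑ w ∈ t, c w := le_of_mul_le_mul_right h4 hpos
    refine (hK.mem_faces_iff s ⟨v, hv⟩).mpr ⟨t, ht, fun w hw => ?_⟩
    by_contra hwt
    have h6 : ∑ w ∈ s, φ t (p w) < ∑ w ∈ s, 1 :=
      Finset.sum_lt_sum (fun w _ => hle t ht w) ⟨w, hw, hφ' t ht w hwt⟩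
    rw [h3, Finset.sum_const, nsmul_eq_mul, mul_one] at h6
    exact absurd h5 (not_le.mpr h6)

/-- A strictly concave support function with negative values yields a simplicial polytope: its
vertices are the points of the opposite rays where the function, extended by linearity, is `1`. -/
theorem IsStrictSupport.isPolytopal [Finite V] {ℓ : V → Fin n → ℤ} {h : V → ℤ}
    {m : Finset V → Fin n → ℤ} (H : IsStrictSupport T ℓ h m) (hneg : ∀ v, h v < 0)
    (hK : HasFacets K T) (hT : HasFlips T) (hcard : ∀ t ∈ T, t.card = n) : IsPolytopal n K := by
  have hneg' : ∀ v, (h v : ℝ) < 0 := fun v => by exact_mod_cast hneg v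
  have hval : ∀ t v, pairDual (m t) ((h v : ℝ)⁻¹ • toReal (ℓ v)) =
      ((m t ⬝ᵥ ℓ v : ℤ) : ℝ) / h v := by
    intro t v
    rw [map_smul, smul_eq_mul, div_eq_inv_mul]
    exact congrArg _ (pair_toReal _ _)
  refine isPolytopal_of_linear_forms (p := fun v => (h v : ℝ)⁻¹ • toReal (ℓ v))
    (φ := fun t => pairDual (m t)) hK hT hcard (fun t ht v hv => ?_) fun t ht v hv => ?_
  · rw [hval, (H t ht v).1 hv, div_self (hneg' v).ne]
  · rw [hval, div_lt_one_of_neg (hneg' v)]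
    exact_mod_cast (H t ht v).2 hv

end Polytopes

end ToricNeighborly

namespace ToricNeighborly

/-! ### The two complexes are neighborly polytopal seeds -/

section Seeds

variable {N : ℕ}

theorem isPolytopal_K27 : IsPolytopal 5 K27 := by
  obtain ⟨m, hm⟩ := exists_isStrictSupport_map27a
  exact hm.isPolytopal (by decide) hasFacets_K27 hasFlips_walk27 (by decide +kernel)

/-- The vertices of a polytope with boundary complex `K28`. -/
def points28 : Fin 9 → Fin 5 → ℤ :=
  ![![1, 0, 0, 0, 0], ![0, 1, 0, 0, 0], ![0, 0, 1, 0, 0], ![0, 0, 0, 1, 0], ![0, -2, 2, 1, -2],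
    ![0, 0, 0, 0, 1], ![-2, -1, -1, 0, 1], ![-1, -1, -1, -1, -1], ![1, 2, -2, -2, 0]]

/-- The normals of the facets of the polytope with the vertices `points28`, with the common
right-hand side `-420`. -/
def normals28 : List (Fin 5 → ℤ) :=
  [![-420, -420, -420, 0, -420], ![420, -420, -420, 420, -420], ![84, 252, -420, 924, -420],
    ![-420, 630, -420, 1050, -420], ![-420, 630, 210, 420, -420], ![-420, 210, 630, -420, -420],
    ![84, -420, 252, -420, -420], ![-420, -420, 0, -420, -420], ![-420, -420, -420, -420, -420],
    ![420, -420, -420, -420, -420], ![210, 0, -420, -420, -420], ![-84, 588, -420, 756, -420],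
    ![-420, 700, -420, 980, -420], ![-420, 0, -420, -420, -420], ![-420, 630, 210, -420, -420],
    ![-420, 840, 0, 420, -420], ![-420, 630, 630, -420, 0], ![-420, 420, 840, -420, 0],
    ![420, -420, 420, -420, 420], ![660, -420, -420, 540, 60], ![780, -420, -420, 180, 300],
    ![630, -420, -420, -420, 0], ![630, -420, 105, -420, 525], ![210, -420, 315, -420, 735],
    ![420, -420, -420, 420, 420], ![-420, 560, -420, 980, -280], ![-420, 210, 630, -420, 420],
    ![-420, -420, 0, -420, 420], ![-420, -420, -420, 0, 210], ![-420, -420, -420, -420, 0]]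

theorem exists_normal_points28 : ∀ a ∈ facetBits28, ∃ f ∈ normals28, ∀ v : Fin 9,
    (a.testBit v = true → dot5 f (points28 v) = -420) ∧
      (a.testBit v = false → -420 < dot5 f (points28 v)) := by
  decide +kernel

theorem isPolytopal_K28 : IsPolytopal 5 K28 := by
  obtain ⟨m, hm⟩ := exists_isStrictSupport (h := fun _ => -420) map_bits_walk28
    exists_normal_points28
  exact hm.isPolytopal (by decide) hasFacets_K28 hasFlips_walk28 (by decide +kernel)

theorem isNeighborly_five_complexOfNonfaces {M : Finset (Finset (Fin N))}
    (hM : ∀ m ∈ (M : Set (Finset (Fin N))), 2 ≤ m.card) (h : ∀ m ∈ M, 3 ≤ m.card) :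
    IsNeighborly 5 (complexOfNonfaces (M : Set (Finset (Fin N))) hM) := by
  intro s hs hcard
  refine ⟨hs, fun m hm hms => ?_⟩
  have h1 := h m (Finset.mem_coe.mp hm)
  have h2 := Finset.card_le_card hms
  omega

theorem isNeighborly_K27 : IsNeighborly 5 K27 :=
  isNeighborly_five_complexOfNonfaces _ (by decide +kernel)

theorem isNeighborly_K28 : IsNeighborly 5 K28 :=
  isNeighborly_five_complexOfNonfaces _ (by decide +kernel)

open Classical in
/-- A face of a wedge that avoids both new vertices is a face of the base, so it remains a face when
one of the new vertices is added. -/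
theorem insert_mem_faces_wedge {W : Type} {L : AbstractSimplicialComplex W} {w : W}
    {x : Option W} (hx : x = some w ∨ x = none) {s : Finset (Option W)} (hs : s ∈ (wedge L w).faces)
    (h1 : some w ∉ s) (h2 : none ∉ s) : insert x s ∈ (wedge L w).faces := by
  obtain ⟨hne, σ, t, rfl, hσ, h⟩ := hs
  have hσ0 : σ = ∅ := by
    refine Finset.eq_empty_of_forall_notMem fun y hy => ?_
    rcases Finset.mem_insert.mp (hσ hy) with rfl | h
    · exact h1 (Finset.mem_union_left _ hy)
    · exact h2 (Finset.mem_union_left _ (Finset.mem_singleton.mp h ▸ hy))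
  subst hσ0
  rw [Finset.empty_union] at hne h1 ⊢
  have ht : t.Nonempty := Finset.map_nonempty.mp hne
  refine ⟨Finset.insert_nonempty _ _, {x}, t, Finset.insert_eq _ _, by simpa using hx, Or.inr
    ⟨fun h => ?_, fun h => h1 (Finset.mem_map_of_mem _ h), Or.inr ?_⟩⟩
  · have h3 := congrArg Finset.card h
    rw [Finset.card_singleton, Finset.card_pair (by simp)] at h3
    omega
  · rcases h with h | ⟨-, -, h⟩
    · exact (L.isRelLowerSet_faces h.2).2 (Finset.subset_insert _ _) ht
    · exact h.resolve_left ht.ne_empty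

/-- A minimal non-face of a wedge contains both new vertices or neither. -/
theorem some_mem_iff_none_mem_of_minimal {W : Type} {L : AbstractSimplicialComplex W} {w : W}
    {s : Finset (Option W)} (hns : s ∉ (wedge L w).faces)
    (hmin : ∀ t ⊂ s, t.Nonempty → t ∈ (wedge L w).faces) : some w ∈ s ↔ none ∈ s := by
  classical
  have key : ∀ x y : Option W, (x = some w ∨ x = none) → x ∈ s →
      (∀ z, z = some w ∨ z = none → z = x ∨ z = y) → y ∈ s := by
    intro x y hx hxs hxy
    by_contra hy
    have h1 : ∀ z, z = some w ∨ z = none → z ∉ s.erase x := fun z hz hzs => by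
      rcases hxy z hz with rfl | rfl
      · exact Finset.notMem_erase _ _ hzs
      · exact hy (Finset.mem_of_mem_erase hzs)
    refine hns (Finset.insert_erase hxs ▸ ?_)
    rcases (s.erase x).eq_empty_or_nonempty with h0 | h0
    · rw [h0]
      exact (wedge L w).singleton_mem x
    · convert insert_mem_faces_wedge hx (hmin _ (Finset.erase_ssubset hxs) h0) (h1 _ (Or.inl rfl))
        (h1 _ (Or.inr rfl))
  exact ⟨fun h => key _ none (Or.inl rfl) h fun z hz => hz,
    fun h => key _ (some w) (Or.inr rfl) h fun z hz => hz.symm⟩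

/-- If each pair of vertices is separated by a minimal non-face, the complex is a seed. -/
theorem isSeed_complexOfNonfaces {M : Finset (Finset (Fin N))}
    (hM : ∀ m ∈ (M : Set (Finset (Fin N))), 2 ≤ m.card)
    (hanti : ∀ m ∈ M, ∀ m' ∈ M, m ⊆ m' → m = m')
    (h : ∀ a b : Fin N, a ≠ b → ∃ m ∈ M, ¬ (a ∈ m ↔ b ∈ m)) :
    IsSeed (complexOfNonfaces (M : Set (Finset (Fin N))) hM) := by
  rintro W L w ⟨e, he⟩
  obtain ⟨m, hm, hab⟩ := h (e.symm (some w)) (e.symm none) (by simp)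
  have h1 := some_mem_iff_none_mem_of_minimal (L := L) (w := w) (s := m.map e.toEmbedding)
    (fun hs => ((he m).mpr hs).2 m (Finset.mem_coe.mpr hm) subset_rfl) fun t ht htne => ?_
  · rw [Finset.mem_map_equiv, Finset.mem_map_equiv] at h1
    exact hab h1
  · have h2 : (t.map e.symm.toEmbedding).map e.toEmbedding = t := by
      ext x
      simp [Finset.mem_map_equiv]
    rw [← h2] at ht ⊢
    have h3 := Finset.map_ssubset_map.mp ht
    refine (he _).mp ⟨Finset.map_nonempty.mpr htne, fun m' hm' hsub => h3.2 ?_⟩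
    rwa [hanti m' (Finset.mem_coe.mp hm') m hm (hsub.trans h3.1)] at hsub

theorem isSeed_K27 : IsSeed K27 :=
  isSeed_complexOfNonfaces _ (by decide +kernel) (by decide +kernel)

theorem isSeed_K28 : IsSeed K28 :=
  isSeed_complexOfNonfaces _ (by decide +kernel) (by decide +kernel)

end Seeds

end ToricNeighborly

namespace ToricNeighborly

open CategoryTheory

/-! ### Existence of the toric manifolds -/

section Manifolds

variable {n : ℕ} {V : Type} [DecidableEq V] {T : Finset (Finset V)}
  {K : AbstractSimplicialComplex V}

theorem FanGivingMap.exists_isToricManifoldOf (hK : HasFacets K T) (ℓ : FanGivingMap n K) :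
    ∃ X : Over specC, IsToricManifoldOf K ℓ.1 X := by
  obtain ⟨F, hF⟩ := ℓ.2
  obtain ⟨X, hX⟩ := hF.exists_isToricVarietyOf hK
  exact ⟨X, F, hF, hX⟩

theorem nonempty_fanGivingMap (hK : HasFacets K T) (hT : HasFlips T) {ℓ : V → Fin n → ℤ}
    (hU : IsUnimodularFan T ℓ) : Nonempty (FanGivingMap n K) :=
  ⟨⟨ℓ, hU.fan, hU.isFanOf hK (hU.exists_mem_coneOf hT)⟩⟩

end Manifolds

end ToricNeighborly

open ToricNeighborly CategoryTheory in
theorem mainTheorem3 :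
    -- there are projective and non-projective toric manifolds supported by neighborly polytopes
    (∃ (n m : ℕ) (K : AbstractSimplicialComplex (Fin m)) (X : Over specC),
      4 ≤ n ∧ n + 3 ≤ m ∧ IsPolytopal n K ∧ IsNeighborly n K ∧
        IsToricManifoldOver n K X ∧ IsProjective X) ∧
    (∃ (n m : ℕ) (K : AbstractSimplicialComplex (Fin m)) (X : Over specC),
      4 ≤ n ∧ n + 3 ≤ m ∧ IsPolytopal n K ∧ IsNeighborly n K ∧
        IsToricManifoldOver n K X ∧ ¬ IsProjective X) ∧
    ¬ GKSConjecture ∧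
    -- the witness with exactly two toric manifolds, both projective
    (IsPolytopal 5 K27 ∧ IsNeighborly 5 K27 ∧ IsSeed K27 ∧
      Nat.card (DJClass 5 K27) = 2 ∧
      ∀ ℓ : FanGivingMap 5 K27,
        (∃ X : Over specC, IsToricManifoldOf K27 ℓ.1 X) ∧
        ∀ X : Over specC, IsToricManifoldOf K27 ℓ.1 X → IsProjective X) ∧
    -- the witness with exactly four toric manifolds, all non-projective
    (IsPolytopal 5 K28 ∧ IsNeighborly 5 K28 ∧ IsSeed K28 ∧
      Nat.card (DJClass 5 K28) = 4 ∧
      ∀ ℓ : FanGivingMap 5 K28,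
        (∃ X : Over specC, IsToricManifoldOf K28 ℓ.1 X) ∧
        ∀ X : Over specC, IsToricManifoldOf K28 ℓ.1 X → ¬ IsProjective X) := by
  have h27 := FanGivingMap.exists_isToricManifoldOf (n := 5) hasFacets_K27
  have h28 := FanGivingMap.exists_isToricManifoldOf (n := 5) hasFacets_K28
  obtain ⟨ℓ⟩ := nonempty_fanGivingMap hasFacets_K27 hasFlips_walk27 isUnimodularFan_map27a
  obtain ⟨ℓ'⟩ := nonempty_fanGivingMap hasFacets_K28 hasFlips_walk28 isUnimodularFan_map28a
  obtain ⟨X, hX⟩ := h27 ℓ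
  obtain ⟨X', hX'⟩ := h28 ℓ'
  exact ⟨⟨5, 9, K27, X, by decide, by decide, isPolytopal_K27, isNeighborly_K27, ⟨ℓ.1, hX⟩,
      isProjective_of_K27 hX⟩,
    ⟨5, 9, K28, X', by decide, by decide, isPolytopal_K28, isNeighborly_K28, ⟨ℓ'.1, hX'⟩,
      not_isProjective_of_K28 hX'⟩,
    fun h => h 5 9 (by decide) (by decide) K27 isPolytopal_K27 isNeighborly_K27 ⟨X, ℓ.1, hX⟩,
    ⟨isPolytopal_K27, isNeighborly_K27, isSeed_K27, card_djClass_K27,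
      fun ℓ => ⟨h27 ℓ, fun _ => isProjective_of_K27⟩⟩,
    ⟨isPolytopal_K28, isNeighborly_K28, isSeed_K28, card_djClass_K28,
      fun ℓ => ⟨h28 ℓ, fun _ => not_isProjective_of_K28⟩⟩⟩
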